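/- **Setting.** Fix the number of factors $r$ and a probability space. For $k=1,2$ and every $d>r$ let $X^k_t=\Lambda_kF^k_t+\varepsilon^k_t\in\mathbb R^d$, $t\in\mathbb Z$, where $\{F^k_t\}$ is an $\mathbb R^r$-valued process not depending on $d$, while the loadings $\Lambda_k\in\mathbb R^{d\times r}$ and the errors $\varepsilon^k_t\in\mathbb R^d$ may depend on $d$ (a triangular array). Write $\|\cdot\|$ for the spectral norm and $\|\cdot\|_F$ for the Frobenius norm. *White noise* means: independent over time, mean zero, with a covariance matrix not depending on time. Both models ($k=1,2$; index dropped) satisfy: 1. $\{X_t\}$ is second-order stationary with mean zero, and $\operatorname{Var}(X_{j,t})\le M$ with $M$ not depending on $d$. 2. $\{F_t\}$ and $\{\varepsilon_t\}$ are independent. $F_t=\sum_{k\ge0}C_ka_{t-k}$ with $\sum_k\|C_k\|<\infty$ and $\{a_t\}$ an $\mathbb R^r$-valued white noise with bounded fourth moments, and $\mathbb E F_tF_t'=\Sigma_F$ is positive definite. $\varepsilon_t=\sum_{k\ge0}D_kb_{t-k}$ with $\{b_t\}$ an $\mathbb R^d$-valued white noise, where $\sum_k\|D_k\|\le K$ and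 $\mathbb E b_{j,t}^4\le M$ with $K,M$ not depending on $d$. 3. If $\Pi_\Lambda$ is the diagonal matrix of the eigenvalues of $\Lambda'\Lambda$ in decreasing order, there is a positive definite diagonal $\widetilde\Pi$ with $\|\Pi_\Lambda/d-\widetilde\Pi\|=O(1/\sqrt d)$. 4. For each $d$, the eigenvalues of $\Lambda'\Lambda$ are distinct. 5. $\limsup_{d\to\infty}\sum_{h\in\mathbb Z}\|\mathbb E\,\varepsilon_{h}\varepsilon_0'\|<\infty$. 6. The entries of $\Lambda$ are bounded in absolute value by a constant not depending on $d$. Assume the null hypothesis: for each $d>r$ there are $\Lambda\in\mathbb R^{d\times r}$ of full column rank and nonsingular $\Phi_1,\Phi_2\in\mathbb R^{r\times r}$ with $\Lambda_k=\Lambda\Phi_k$, $k=1,2$. **Estimators.** For $T\ge r$ a *PCA factor estimator* of a $T\times d$ matrix $Z$ is $\sqrt T\,Q$, where the columns of $Q\in\mathbb R^{T\times r}$ are orthonormal eigenvectors for the $r$ largest eigenvalues of $ZZ'$, in decreasing order. Let $X^k$ be the $T\times d$ matrix with rows $X_1^{k\prime},\dots,X_T^{k\prime}$, $\widehat F^k$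 a PCA factor estimator of $X^k$, $\widehat\Lambda_k'=\frac1T\widehat F^{k\prime}X^k$, $\widehat P_k=\widehat\Lambda_k(\widehat\Lambda_k'\widehat\Lambda_k)^{-1}\widehat\Lambda_k'$ and $\widehat P^k_I=\frac12(\widehat P_k+I_d)$. Let $F$ be the $T\times r$ matrix with rows $F_1^{2\prime},\dots,F_T^{2\prime}$. For a matrix with $T$ rows, superscripts $b$ and $a$ denote the submatrices of the rows $t\le\lfloor T/2\rfloor$ and $t>\lfloor T/2\rfloor$. Let $Y$ be the $T\times d$ matrix with rows $(\widehat P^1_IX_t^2)'$ for $t\le\lfloor T/2\rfloor$ and $(\widehat P^2_IX_t^2)'$ for $t>\lfloor T/2\rfloor$, let $\widehat F$ be a PCA factor estimator of $Y$, and let $\widehat V_r$ be the diagonal matrix of the $r$ largest eigenvalues of $\frac1{dT}YY'$. Put $$H_1=\tfrac1{dT}\big(\Lambda_2'\widehat P^{1\prime}_I\widehat P^1_I\Lambda_2F^{b\prime}\widehat F^b+\Lambda_2'\widehat P^{1\prime}_I\widehat P^2_I\Lambda_2F^{a\prime}\widehat F^a\big)\widehat V_r^{-1},$$ $$H_2=\tfrac1{dT}\big(\Lambda_2'\widehat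 P^{2\prime}_I\widehat P^1_I\Lambda_2F^{b\prime}\widehat F^b+\Lambda_2'\widehat P^{2\prime}_I\widehat P^2_I\Lambda_2F^{a\prime}\widehat F^a\big)\widehat V_r^{-1},\qquad \widetilde F\widetilde H=\begin{pmatrix}F^bH_1\\F^aH_2\end{pmatrix}.$$ **Claim.** Whatever choices of eigenvectors are made, with $\delta_{dT}=\min\{\sqrt d,\sqrt T\}$, $$\frac1T\big\|\widehat F-\widetilde F\widetilde H\big\|_F^2=O_p\!\Big(\frac1{\delta_{dT}^2}\Big)\quad\text{as } d,T\to\infty \text{ jointly},$$ that is, for every $\eta>0$ there are $K,d_0,T_0$ such that for all $d\ge d_0$, $T\ge T_0$ the probability that the left-hand side exceeds $K/\delta_{dT}^2$ is at most $\eta$. (Inverses of singular matrices, which occur only with asymptotically vanishing probability, may be set to $0$.) -/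

import Mathlib

open MeasureTheory ProbabilityTheory Filter

namespace FactorTest

noncomputable section

/- Matrix notions: spectral and Frobenius norms, ordered eigenvalues, leading eigenvectors. -/

section Norms

open scoped Matrix.Norms.L2Operator

/-- The spectral norm, i.e. the operator norm for the Euclidean norms. -/
def specNorm {m n : ℕ} (A : Matrix (Fin m) (Fin n) ℝ) : ℝ := ‖A‖

end Norms

/-- The squared Frobenius norm. -/
def frobSq {m n : ℕ} (A : Matrix (Fin m) (Fin n) ℝ) : ℝ := ∑ i, ∑ j, A i j ^ 2

open Classical in
/-- The eigenvalues of a real symmetric `n × n` matrix in decreasing order, repeated according to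
multiplicity and numbered from `0`; the value is `0` when `j ≥ n`. -/
def eigenvalueDesc {n : ℕ} (A : Matrix (Fin n) (Fin n) ℝ) (j : ℕ) : ℝ :=
  if h : A.IsHermitian ∧ j < Fintype.card (Fin n) then h.1.eigenvalues₀ ⟨j, h.2⟩ else 0

/-- The diagonal matrix of the `r` largest eigenvalues of `A`, in decreasing order. -/
def leadingEigenvalues {n : ℕ} (r : ℕ) (A : Matrix (Fin n) (Fin n) ℝ) :
    Matrix (Fin r) (Fin r) ℝ :=
  Matrix.diagonal fun j => eigenvalueDesc A j

/-- The columns of `Q` are orthonormal eigenvectors belonging to the `r` largest eigenvalues. -/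
def IsLeadingEigenvectors {n r : ℕ} (A : Matrix (Fin n) (Fin n) ℝ)
    (Q : Matrix (Fin n) (Fin r) ℝ) : Prop :=
  Q.transpose * Q = 1 ∧ A * Q = Q * leadingEigenvalues r A

/- PCA. A series of length `T` is stored as a `T × d` matrix whose rows are the observations. -/

/-- `Fhat` is a PCA factor estimator of the `T × d` data matrix `Z`: it is `√T` times a matrix of
orthonormal eigenvectors for the `r` largest eigenvalues of `Z Z'`. -/
def IsPCAFactor {T d r : ℕ} (Z : Matrix (Fin T) (Fin d) ℝ) (Fhat : Matrix (Fin T) (Fin r) ℝ) :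
    Prop :=
  ∃ Q : Matrix (Fin T) (Fin r) ℝ,
    IsLeadingEigenvectors (Z * Z.transpose) Q ∧ Fhat = Real.sqrt T • Q

/-- The PCA loading estimator: its transpose is `T⁻¹ Fhat' Z`. -/
def pcaLoading {T d r : ℕ} (Z : Matrix (Fin T) (Fin d) ℝ) (Fhat : Matrix (Fin T) (Fin r) ℝ) :
    Matrix (Fin d) (Fin r) ℝ :=
  ((1 / (T : ℝ)) • (Fhat.transpose * Z)).transpose

/-- The projection matrix `L (L' L)⁻¹ L'` onto the column space of `L`. -/
def projMatrix {d r : ℕ} (L : Matrix (Fin d) (Fin r) ℝ) : Matrix (Fin d) (Fin d) ℝ :=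
  L * (L.transpose * L)⁻¹ * L.transpose

/-- `½ (Phat + I)`, where `Phat` is the projection matrix of the PCA loading estimator. -/
def halfProj {T d r : ℕ} (Z : Matrix (Fin T) (Fin d) ℝ) (Fhat : Matrix (Fin T) (Fin r) ℝ) :
    Matrix (Fin d) (Fin d) ℝ :=
  (1 / 2 : ℝ) • (projMatrix (pcaLoading Z Fhat) + 1)

/- The two halves of the sample, and the transformed series. -/

/-- The rows `t = 1, …, T/2`. -/
def before {T n : ℕ} (A : Matrix (Fin T) (Fin n) ℝ) :
    Matrix {t : Fin T // (t : ℕ) < T / 2} (Fin n) ℝ :=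
  A.submatrix Subtype.val id

/-- The rows `t = T/2 + 1, …, T`. -/
def after {T n : ℕ} (A : Matrix (Fin T) (Fin n) ℝ) :
    Matrix {t : Fin T // ¬ (t : ℕ) < T / 2} (Fin n) ℝ :=
  A.submatrix Subtype.val id

/-- The `T × n` matrix with the upper block `A` and the lower block `B`. -/
def stack {T n : ℕ} (A : Matrix {t : Fin T // (t : ℕ) < T / 2} (Fin n) ℝ)
    (B : Matrix {t : Fin T // ¬ (t : ℕ) < T / 2} (Fin n) ℝ) : Matrix (Fin T) (Fin n) ℝ :=
  Matrix.of fun t j => if h : (t : ℕ) < T / 2 then A ⟨t, h⟩ j else B ⟨t, h⟩ j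

/-- The transformed data matrix `Y`: the observations of the second series are multiplied by `P1`
in the first half of the sample and by `P2` in the second half. -/
def transformed {T d : ℕ} (P1 P2 : Matrix (Fin d) (Fin d) ℝ) (X2 : Matrix (Fin T) (Fin d) ℝ) :
    Matrix (Fin T) (Fin d) ℝ :=
  stack (before X2 * P1.transpose) (after X2 * P2.transpose)

/-- The diagonal matrix of the `r` largest eigenvalues of `(1/(dT)) Y Y'`. -/
def Vhat {T d : ℕ} (r : ℕ) (Y : Matrix (Fin T) (Fin d) ℝ) : Matrix (Fin r) (Fin r) ℝ :=
  leadingEigenvalues r ((1 / ((d : ℝ) * T)) • (Y * Y.transpose))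

/-- The rotation `(dT)⁻¹ (L2' A' P1 L2 Fᵇ' Fhatᵇ + L2' A' P2 L2 Fᵃ' Fhatᵃ) Vhat⁻¹`. The rotation of
the first half is obtained for `A = P1`, that of the second half for `A = P2`. -/
def rotation {T d r : ℕ} (A P1 P2 : Matrix (Fin d) (Fin d) ℝ) (L2 : Matrix (Fin d) (Fin r) ℝ)
    (F Fhat : Matrix (Fin T) (Fin r) ℝ) (V : Matrix (Fin r) (Fin r) ℝ) :
    Matrix (Fin r) (Fin r) ℝ :=
  (1 / ((d : ℝ) * T)) •
    ((L2.transpose * A.transpose * P1 * L2 * (before F).transpose * before Fhat +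
        L2.transpose * A.transpose * P2 * L2 * (after F).transpose * after Fhat) * V⁻¹)

/-- The `T × r` matrix with the upper block `Fᵇ H₁` and the lower block `Fᵃ H₂`. -/
def rotatedFactors {T d r : ℕ} (P1 P2 : Matrix (Fin d) (Fin d) ℝ) (L2 : Matrix (Fin d) (Fin r) ℝ)
    (F Fhat : Matrix (Fin T) (Fin r) ℝ) (V : Matrix (Fin r) (Fin r) ℝ) :
    Matrix (Fin T) (Fin r) ℝ :=
  stack (before F * rotation P1 P1 P2 L2 F Fhat V) (after F * rotation P2 P1 P2 L2 F Fhat V)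

/- Stochastic processes indexed by `ℤ` with values in `ℝⁿ`. -/

variable {Ω : Type*}

/-- The `T × n` matrix with the rows `Z_1', …, Z_T'`. -/
def sample {n : ℕ} (T : ℕ) (Z : ℤ → Ω → Fin n → ℝ) (ω : Ω) : Matrix (Fin T) (Fin n) ℝ :=
  Matrix.of fun t j => Z ((t : ℤ) + 1) ω j

/-- The observed series `X_t = L F_t + ε_t`. -/
def observed {d r : ℕ} (L : Matrix (Fin d) (Fin r) ℝ) (F : ℤ → Ω → Fin r → ℝ)
    (e : ℤ → Ω → Fin d → ℝ) : ℤ → Ω → Fin d → ℝ :=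
  fun t ω => L.mulVec (F t ω) + e t ω

variable [MeasurableSpace Ω]

/-- The autocovariance matrix `E Z_h Z_0'` of a stationary mean-zero process. -/
def autocov {n : ℕ} (P : Measure Ω) (Z : ℤ → Ω → Fin n → ℝ) (h : ℤ) : Matrix (Fin n) (Fin n) ℝ :=
  Matrix.of fun i j => ∫ ω, Z h ω i * Z 0 ω j ∂P

/-- Mean zero and (second-order) stationary. -/
structure IsCenteredStationary {n : ℕ} (P : Measure Ω) (Z : ℤ → Ω → Fin n → ℝ) : Prop where
  measurable : ∀ t, Measurable (Z t)
  memLp : ∀ t i, MemLp (fun ω => Z t ω i) 2 P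
  mean_zero : ∀ t i, ∫ ω, Z t ω i ∂P = 0
  stationary : ∀ s t h i j,
    ∫ ω, Z (s + h) ω i * Z (t + h) ω j ∂P = ∫ ω, Z s ω i * Z t ω j ∂P

/-- Strong white noise: independent over time, mean zero, with a covariance matrix that does not
depend on time. -/
structure IsWhiteNoise {n : ℕ} (P : Measure Ω) (a : ℤ → Ω → Fin n → ℝ) : Prop where
  measurable : ∀ t, Measurable (a t)
  indep : iIndepFun a P
  memLp : ∀ t i, MemLp (fun ω => a t ω i) 2 P
  mean_zero : ∀ t i, ∫ ω, a t ω i ∂P = 0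
  cov_const : ∀ s t i j, ∫ ω, a s ω i * a s ω j ∂P = ∫ ω, a t ω i * a t ω j ∂P

/-- All fourth moments of all coordinates are bounded by `M`. -/
def FourthMomentsLE {n : ℕ} (P : Measure Ω) (M : ℝ) (a : ℤ → Ω → Fin n → ℝ) : Prop :=
  ∀ t i, MemLp (fun ω => a t ω i) 4 P ∧ ∫ ω, a t ω i ^ 4 ∂P ≤ M

/-- `Z_t = ∑_{k ≥ 0} C_k a_{t-k}` almost surely, for every `t`. -/
def IsMovingAverage {n : ℕ} (P : Measure Ω) (C : ℕ → Matrix (Fin n) (Fin n) ℝ)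
    (a Z : ℤ → Ω → Fin n → ℝ) : Prop :=
  ∀ t : ℤ, ∀ᵐ ω ∂P, HasSum (fun k : ℕ => (C k).mulVec (a (t - k) ω)) (Z t ω)

/-- The assumptions on one factor model `X_t = L_d F_t + ε_t` with `r` factors. The `r`-dimensional
factors do not depend on the cross-sectional dimension `d`; the errors and loadings form a
triangular array indexed by `d > r`. -/
structure FactorModelAssumptions {r : ℕ} (P : Measure Ω) (F : ℤ → Ω → Fin r → ℝ)
    (e : (d : ℕ) → ℤ → Ω → Fin d → ℝ) (L : (d : ℕ) → Matrix (Fin d) (Fin r) ℝ) : Prop where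
  /-- The observed series is stationary with mean zero. -/
  stationary : ∀ d, r < d → IsCenteredStationary P (observed (L d) F (e d))
  /-- The variances of the observations are bounded, uniformly in `d`. -/
  var_bounded : ∃ M : ℝ, ∀ d, r < d → ∀ t i,
    variance (fun ω => observed (L d) F (e d) t ω i) P ≤ M
  measurable_factor : ∀ t, Measurable (F t)
  measurable_error : ∀ d, r < d → ∀ t, Measurable (e d t)
  /-- The factor process and the error process are independent. -/
  indep : ∀ d, r < d → IndepFun (fun ω t => F t ω) (fun ω t => e d t ω) P
  /-- The factors are a linear process in a white noise with finite fourth moments. -/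
  factor_linear : ∃ (C : ℕ → Matrix (Fin r) (Fin r) ℝ) (a : ℤ → Ω → Fin r → ℝ) (M : ℝ),
    Summable (fun k => specNorm (C k)) ∧ IsWhiteNoise P a ∧ FourthMomentsLE P M a ∧
      IsMovingAverage P C a F
  /-- The factors have a positive definite covariance matrix. -/
  factor_cov : ∃ S : Matrix (Fin r) (Fin r) ℝ, S.PosDef ∧
    ∀ t i j, ∫ ω, F t ω i * F t ω j ∂P = S i j
  /-- The errors are linear processes in white noises with bounded fourth moments. -/
  error_linear : ∃ (D : (d : ℕ) → ℕ → Matrix (Fin d) (Fin d) ℝ)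
    (b : (d : ℕ) → ℤ → Ω → Fin d → ℝ) (K M : ℝ), ∀ d, r < d →
      Summable (fun k => specNorm (D d k)) ∧ ∑' k, specNorm (D d k) ≤ K ∧
      IsWhiteNoise P (b d) ∧ FourthMomentsLE P M (b d) ∧ IsMovingAverage P (D d) (b d) (e d)
  /-- The ordered eigenvalues of `L'L`, divided by `d`, converge at rate `1/√d` to positive
  limits. -/
  pervasive : ∃ p : Fin r → ℝ, (∀ j, 0 < p j) ∧
    (fun d : ℕ => specNorm ((1 / (d : ℝ)) • leadingEigenvalues r ((L d).transpose * L d)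
      - Matrix.diagonal p)) =O[atTop] (fun d : ℕ => 1 / Real.sqrt d)
  /-- The eigenvalues of `L'L` are distinct. -/
  distinct : ∀ d, r < d → Function.Injective
    fun j : Fin r => eigenvalueDesc ((L d).transpose * L d) j
  /-- `limsup_d ∑_{h ∈ ℤ} ‖Γ_ε(h)‖ < ∞`. -/
  error_autocov :
    limsup (fun d => ∑' h : ℤ, ENNReal.ofReal (specNorm (autocov P (e d) h))) atTop < ⊤
  /-- The loadings are bounded, uniformly in `d`. -/
  loading_bounded : ∃ B : ℝ, ∀ d, r < d → ∀ i j, |L d i j| ≤ B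

/-- The null hypothesis: both loading matrices arise from one matrix of full column rank by
nonsingular linear transformations. -/
def NullHypothesis {d r : ℕ} (L1 L2 : Matrix (Fin d) (Fin r) ℝ) : Prop :=
  ∃ (L : Matrix (Fin d) (Fin r) ℝ) (A1 A2 : Matrix (Fin r) (Fin r) ℝ),
    L.rank = r ∧ IsUnit A1.det ∧ IsUnit A2.det ∧ L1 = L * A1 ∧ L2 = L * A2

/-- `Z = O_p(ρ)` as `d, T → ∞` jointly. -/
def IsBigOInProbability (P : Measure Ω) (Z : ℕ → ℕ → Ω → ℝ) (ρ : ℕ → ℕ → ℝ) : Prop :=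
  ∀ η : ℝ, 0 < η → ∃ K : ℝ, ∀ᶠ p : ℕ × ℕ in atTop,
    P {ω | K * ρ p.1 p.2 < |Z p.1 p.2 ω|} ≤ ENNReal.ofReal η

/-- `δ_{dT} = min (√d) (√T)`. -/
def delta (d T : ℕ) : ℝ := min (Real.sqrt d) (Real.sqrt T)

end

end FactorTest

set_option linter.unusedSectionVars false

namespace FactorTest

open scoped Matrix.Norms.L2Operator Matrix

/-! ### Spectral norm and Euclidean quadratic forms -/

section OperatorNorm

variable {l m n : Type*} [Fintype l] [Fintype m] [Fintype n] [DecidableEq l] [DecidableEq m]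
  [DecidableEq n]

/-! Let `M` and `U` be the images of the common part `F₂L₂'` and of the errors `E₂` under the
projections of the two halves, so that `Y = M + U`. The rotations are built so that the stacked
matrix equals `(dT)⁻¹ M M' F̂ V̂⁻¹` (`rotatedFactors_eq`), while the eigenvector equation gives `F̂
= (dT)⁻¹ Y Y' F̂ V̂⁻¹`. The error is therefore exactly `(dT)⁻¹ (MU' + UM' + UU') F̂ V̂⁻¹`. Since
`‖F̂‖ ≤ √T` and there are only `r` columns, it suffices that `V̂⁻¹` is bounded and that `MU'` and
`UU'` have spectral norm of order `dT/δ`; this is `frobSq_sub_rotatedFactors_le`.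

For `UU'` one needs `‖E‖² = O_p(dT/δ)`. This follows from `‖E‖⁴ ≤ ‖EE'‖_F²` and a fourth moment
computation showing that the right-hand side is of order `dT² + d²T`
(`integral_frobSq_sample_mul_transpose_le`).

For `MU'` the blocks are `F₂ L₂' P_i P_j E₂'` with `P_i = I - R_i/2`, where `R_i` is the residual
projection of the i-th PCA fit. The term `F₂ L₂' E₂'` is of order `√T · √(dT)` by second moments.
All other terms contain `L₂'R_i`, of order `√(d/δ)`: the estimated loadings nearly span the true
ones (`exists_residual_projection`), and under the null hypothesis the fit to the first series
serves for `L₂` too. This rests on a dimension count (`transpose_mulVec_le_of_orthogonal`): off the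
leading `r` eigenvectors the data matrix is no larger than the noise. Convergence of individual
eigenvectors plays no role. The bound on `V̂⁻¹` is Courant–Fischer with the range of `F₂` as trial
space.

The probabilistic input is a law of large numbers for `F'F/T` and the moment bounds for `E` and
`L'E'`. They are computed for truncated moving averages, where all sums are finite, and carried to
the limit by Fatou's lemma (`measure_gt_le_of_tendsto`). A union bound (`exists_good_event`) joins
them to the deterministic estimate. -/

lemma dotProduct_self_eq_norm_sq (x : n → ℝ) : x ⬝ᵥ x = ‖WithLp.toLp 2 x‖ ^ 2 := by
  rw [EuclideanSpace.norm_sq_eq]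
  simp [dotProduct, sq]

lemma mulVec_dotProduct_self_le (A : Matrix m n ℝ) (x : n → ℝ) :
    (A *ᵥ x) ⬝ᵥ (A *ᵥ x) ≤ ‖A‖ ^ 2 * (x ⬝ᵥ x) := by
  rw [dotProduct_self_eq_norm_sq, dotProduct_self_eq_norm_sq, ← mul_pow]
  exact pow_le_pow_left₀ (norm_nonneg _) (Matrix.l2_opNorm_mulVec A (WithLp.toLp 2 x)) 2

lemma opNorm_le_of_mulVec {A : Matrix m n ℝ} {c : ℝ} (hc : 0 ≤ c)
    (h : ∀ x, (A *ᵥ x) ⬝ᵥ (A *ᵥ x) ≤ c ^ 2 * (x ⬝ᵥ x)) : ‖A‖ ≤ c := by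
  rw [Matrix.l2_opNorm_def]
  refine ContinuousLinearMap.opNorm_le_bound _ hc fun x => ?_
  have := h x.ofLp
  rw [dotProduct_self_eq_norm_sq, dotProduct_self_eq_norm_sq, ← mul_pow] at this
  exact (pow_le_pow_iff_left₀ (norm_nonneg _) (by positivity) two_ne_zero).1 this

lemma opNorm_transpose (A : Matrix m n ℝ) : ‖Aᵀ‖ = ‖A‖ := by
  rw [← Matrix.conjTranspose_eq_transpose_of_trivial, Matrix.l2_opNorm_conjTranspose]

lemma opNorm_mul_transpose_self (A : Matrix m n ℝ) : ‖A * Aᵀ‖ = ‖A‖ ^ 2 := by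
  have := Matrix.l2_opNorm_conjTranspose_mul_self Aᵀ
  rw [Matrix.conjTranspose_eq_transpose_of_trivial, Matrix.transpose_transpose,
    opNorm_transpose] at this
  rw [this, sq]

lemma opNorm_transpose_mul_self (A : Matrix m n ℝ) : ‖Aᵀ * A‖ = ‖A‖ ^ 2 := by
  rw [sq, ← Matrix.l2_opNorm_conjTranspose_mul_self,
    Matrix.conjTranspose_eq_transpose_of_trivial]

lemma opNorm_sq_le_sum (A : Matrix m n ℝ) : ‖A‖ ^ 2 ≤ ∑ i, ∑ j, A i j ^ 2 := by
  have h0 : 0 ≤ ∑ i, ∑ j, A i j ^ 2 := by positivity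
  have h : ‖A‖ ≤ √(∑ i, ∑ j, A i j ^ 2) := by
    refine opNorm_le_of_mulVec (Real.sqrt_nonneg _) fun x => ?_
    rw [Real.sq_sqrt h0, Finset.sum_mul]
    refine Finset.sum_le_sum fun i _ => ?_
    simpa [dotProduct, Matrix.mulVec, sq] using
      Finset.sum_mul_sq_le_sq_mul_sq Finset.univ (A i) x
  calc ‖A‖ ^ 2 ≤ √(∑ i, ∑ j, A i j ^ 2) ^ 2 := pow_le_pow_left₀ (norm_nonneg _) h 2
    _ = _ := Real.sq_sqrt h0

/-- Each column is the image of a unit vector. The factor counts columns only: it is `r` for a `T ×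
r` matrix, whatever `T` is. -/
lemma sum_sq_le_card_mul_opNorm_sq (A : Matrix m n ℝ) :
    ∑ i, ∑ j, A i j ^ 2 ≤ Fintype.card n * ‖A‖ ^ 2 := by
  rw [Finset.sum_comm, ← nsmul_eq_mul, ← Finset.card_univ]
  refine Finset.sum_le_card_nsmul _ _ _ fun j _ => ?_
  have := mulVec_dotProduct_self_le A (Pi.single j 1)
  simp only [Matrix.mulVec_single_one, dotProduct_single, Pi.single_eq_same, mul_one] at this
  simpa [dotProduct, sq] using this

lemma abs_entry_le_opNorm (A : Matrix m n ℝ) (i : m) (j : n) : |A i j| ≤ ‖A‖ := by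
  have := mulVec_dotProduct_self_le A (Pi.single j 1)
  simp only [Matrix.mulVec_single_one, dotProduct_single, Pi.single_eq_same, mul_one] at this
  refine abs_le_of_sq_le_sq (le_trans ?_ this) (norm_nonneg _)
  rw [sq]
  exact Finset.single_le_sum (f := fun k => A k j * A k j) (fun k _ => mul_self_nonneg _)
    (Finset.mem_univ i)

lemma dotProduct_mulVec_le (A : Matrix n n ℝ) (x : n → ℝ) :
    |x ⬝ᵥ (A *ᵥ x)| ≤ ‖A‖ * (x ⬝ᵥ x) := by
  have h := abs_real_inner_le_norm (WithLp.toLp 2 x) (WithLp.toLp 2 (A *ᵥ x))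
  have h2 := Matrix.l2_opNorm_mulVec A (WithLp.toLp 2 x)
  have h3 : inner ℝ (WithLp.toLp 2 x) (WithLp.toLp 2 (A *ᵥ x)) = x ⬝ᵥ (A *ᵥ x) := by
    simp [EuclideanSpace.inner_eq_star_dotProduct, dotProduct_comm]
  rw [h3] at h
  rw [dotProduct_self_eq_norm_sq]
  calc _ ≤ _ := h
    _ ≤ ‖WithLp.toLp 2 x‖ * (‖A‖ * ‖WithLp.toLp 2 x‖) := by gcongr; exact h2
    _ = _ := by ring

lemma dotProduct_transpose_mul_self_mulVec (A : Matrix m n ℝ) (x : n → ℝ) :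
    x ⬝ᵥ ((Aᵀ * A) *ᵥ x) = (A *ᵥ x) ⬝ᵥ (A *ᵥ x) := by
  rw [← Matrix.mulVec_mulVec, Matrix.dotProduct_mulVec, Matrix.vecMul_transpose]

lemma opNorm_le_one_of_projection {R : Matrix n n ℝ} (hs : Rᵀ = R) (hi : R * R = R) :
    ‖R‖ ≤ 1 := by
  have h := opNorm_transpose_mul_self R
  rw [hs, hi] at h
  nlinarith [norm_nonneg R]

end OperatorNorm

/-! ### Ordered eigenvalues and Courant–Fischer -/

section Eigenvalues

variable {n r : ℕ}

lemma eigenvalueDesc_antitone (A : Matrix (Fin n) (Fin n) ℝ) {i j : ℕ} (hij : i ≤ j) (hj : j < n) :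
    eigenvalueDesc A j ≤ eigenvalueDesc A i := by
  unfold eigenvalueDesc
  by_cases hA : A.IsHermitian
  · rw [dif_pos ⟨hA, by simpa using hj⟩, dif_pos ⟨hA, by simpa using hij.trans_lt hj⟩]
    exact hA.eigenvalues₀_antitone hij
  · rw [dif_neg (fun h => hA h.1), dif_neg (fun h => hA h.1)]

/-- The spectral theorem, with the eigenbasis reindexed by `e` so that its columns follow the
decreasing order of `eigenvalueDesc`. -/
lemma exists_orthonormal_eigenvectors {A : Matrix (Fin n) (Fin n) ℝ} (hA : A.IsHermitian) :
    ∃ U : Matrix (Fin n) (Fin n) ℝ, IsLeadingEigenvectors A U := by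
  classical
  let e : Fin n ≃ Fin n :=
    (finCongr (Fintype.card_fin n).symm).trans (Fintype.equivOfCardEq (Fintype.card_fin _))
  let V : Matrix (Fin n) (Fin n) ℝ := hA.eigenvectorUnitary
  have hV : Vᵀ * V = 1 := by
    have := Unitary.coe_star_mul_self hA.eigenvectorUnitary
    rwa [Matrix.star_eq_conjTranspose, Matrix.conjTranspose_eq_transpose_of_trivial] at this
  have hval : ∀ j : Fin n, hA.eigenvalues (e j) = eigenvalueDesc A j := by
    intro j
    have hj : (j : ℕ) < Fintype.card (Fin n) := by simp
    rw [eigenvalueDesc, dif_pos ⟨hA, hj⟩, Matrix.IsHermitian.eigenvalues]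
    congr 1
    simp [e, Fin.ext_iff]
  refine ⟨V.submatrix id e, ?_, ?_⟩
  · rw [Matrix.transpose_submatrix, ← Matrix.submatrix_mul _ _ e id e Function.bijective_id, hV]
    simp
  · ext i j
    have h := congrFun (hA.mulVec_eigenvectorBasis (e j)) i
    rw [leadingEigenvalues, Matrix.mul_diagonal, ← hval]
    simp only [Matrix.mul_apply, Matrix.submatrix_apply, id, V,
      Matrix.IsHermitian.eigenvectorUnitary_apply]
    rw [mul_comm]
    simpa [Matrix.mulVec, dotProduct] using h

lemma dotProduct_mulVec_eq_sum {A U : Matrix (Fin n) (Fin n) ℝ} (h : IsLeadingEigenvectors A U)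
    (w : Fin n → ℝ) : w ⬝ᵥ (A *ᵥ w) = ∑ i : Fin n, eigenvalueDesc A i * (Uᵀ *ᵥ w) i ^ 2 ∧
      w ⬝ᵥ w = ∑ i : Fin n, (Uᵀ *ᵥ w) i ^ 2 := by
  have hU : U * Uᵀ = 1 := mul_eq_one_comm.1 h.1
  have hw : U *ᵥ (Uᵀ *ᵥ w) = w := by rw [Matrix.mulVec_mulVec, hU, Matrix.one_mulVec]
  have hA : A = U * leadingEigenvalues n A * Uᵀ := by
    rw [← h.2, Matrix.mul_assoc, hU, Matrix.mul_one]
  have h1 : w ⬝ᵥ (A *ᵥ w) = (Uᵀ *ᵥ w) ⬝ᵥ (leadingEigenvalues n A *ᵥ (Uᵀ *ᵥ w)) := by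
    conv_lhs => rw [hA]
    rw [← Matrix.mulVec_mulVec, ← Matrix.mulVec_mulVec, Matrix.dotProduct_mulVec,
      Matrix.mulVec_transpose]
  constructor
  · rw [h1]
    refine Finset.sum_congr rfl fun i _ => ?_
    rw [leadingEigenvalues, Matrix.mulVec_diagonal]
    ring
  · have h2 : w ⬝ᵥ w = (Uᵀ *ᵥ w) ⬝ᵥ (Uᵀ *ᵥ w) := by
      conv_lhs => rw [← hw]
      rw [Matrix.dotProduct_mulVec, ← Matrix.mulVec_transpose, hw]
    rw [h2]
    exact Finset.sum_congr rfl fun i _ => (sq _).symm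

lemma mulVec_ne_zero_kernel {j r : ℕ} (hj : j < r) (B : Matrix (Fin j) (Fin r) ℝ) :
    ∃ c, c ≠ 0 ∧ B *ᵥ c = 0 := by
  have h := LinearMap.ker_ne_bot_of_finrank_lt (f := Matrix.mulVecLin B) (by simpa using hj)
  obtain ⟨c, hc, hc0⟩ := (Submodule.ne_bot_iff _).1 h
  exact ⟨c, hc0, by simpa using hc⟩

/-- The lower bound of the Courant–Fischer theorem. -/
lemma le_eigenvalueDesc_of_subspace {A : Matrix (Fin n) (Fin n) ℝ} (hA : A.IsHermitian) {j : ℕ}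
    (hj : j < r) (G : Matrix (Fin n) (Fin r) ℝ) (hG : ∀ c, G *ᵥ c = 0 → c = 0) {a : ℝ}
    (h : ∀ c, a * ((G *ᵥ c) ⬝ᵥ (G *ᵥ c)) ≤ (G *ᵥ c) ⬝ᵥ (A *ᵥ (G *ᵥ c))) :
    a ≤ eigenvalueDesc A j := by
  obtain ⟨U, hU⟩ := exists_orthonormal_eigenvectors hA
  -- By dimension, the range of `G` contains a nonzero vector orthogonal to the first `j`
  -- eigenvectors. Nothing bounds `j` by `n` here, so missing rows are filled with zeros.
  obtain ⟨c, hc0, hc⟩ := mulVec_ne_zero_kernel hj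
    (Matrix.of fun i k => if h : (i : ℕ) < n then (Uᵀ * G) ⟨i, h⟩ k else 0 :
      Matrix (Fin j) (Fin r) ℝ)
  set w := G *ᵥ c with hw
  have hz : ∀ i : Fin n, (i : ℕ) < j → (Uᵀ *ᵥ w) i = 0 := by
    intro i hi
    have := congrFun hc ⟨i, hi⟩
    rw [hw, Matrix.mulVec_mulVec]
    simpa [Matrix.mulVec] using this
  obtain ⟨h1, h2⟩ := dotProduct_mulVec_eq_sum hU w
  have hpos : 0 < w ⬝ᵥ w := by
    have h0 : w ≠ 0 := fun h0 => hc0 (hG c h0)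
    have h1 : 0 ≤ w ⬝ᵥ w := Finset.sum_nonneg fun i _ => mul_self_nonneg _
    exact h1.lt_of_ne' (fun h => h0 (dotProduct_self_eq_zero.1 h))
  have h3 : w ⬝ᵥ (A *ᵥ w) ≤ eigenvalueDesc A j * (w ⬝ᵥ w) := by
    rw [h1, h2, Finset.mul_sum]
    refine Finset.sum_le_sum fun i _ => ?_
    rcases lt_or_ge (i : ℕ) j with hi | hi
    · rw [hz i hi]; simp
    · exact mul_le_mul_of_nonneg_right (eigenvalueDesc_antitone A hi i.2) (sq_nonneg _)
  exact le_of_mul_le_mul_right ((h c).trans h3) hpos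

/-- The span of the first `j + 1` eigenvectors of `A` is a trial space for `c • A`; the matrix `E`
selects these eigenvectors from `U`. -/
lemma mul_eigenvalueDesc_le {A : Matrix (Fin n) (Fin n) ℝ} (hA : A.IsHermitian) {c : ℝ}
    (hc : 0 < c) {j : ℕ} (hj : j < n) : c * eigenvalueDesc A j ≤ eigenvalueDesc (c • A) j := by
  obtain ⟨U, hU⟩ := exists_orthonormal_eigenvectors hA
  have hcA : (c • A).IsHermitian := by
    rw [Matrix.IsHermitian, Matrix.conjTranspose_smul, hA.eq]; simp
  let E : Matrix (Fin n) (Fin (j + 1)) ℝ := Matrix.of fun i k => if (i : ℕ) = k then 1 else 0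
  have hE : ∀ v, ∀ i : Fin n, (E *ᵥ v) i = if h : (i : ℕ) < j + 1 then v ⟨i, h⟩ else 0 := by
    intro v i
    simp only [Matrix.mulVec, dotProduct, E, Matrix.of_apply, ite_mul, one_mul, zero_mul]
    split_ifs with h
    · rw [Finset.sum_eq_single ⟨i, h⟩] <;> simp +contextual [Fin.ext_iff, eq_comm]
    · refine Finset.sum_eq_zero fun k _ => ?_
      rw [if_neg (by omega)]
  have hUE : ∀ v, Uᵀ *ᵥ ((U * E) *ᵥ v) = E *ᵥ v := by
    intro v
    rw [Matrix.mulVec_mulVec, ← Matrix.mul_assoc, hU.1, Matrix.one_mul]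
  refine le_eigenvalueDesc_of_subspace hcA (Nat.lt_succ_self j) (U * E) ?_ ?_
  · intro v hv
    have h1 := hUE v
    rw [hv, Matrix.mulVec_zero] at h1
    funext k
    have h2 := hE v ⟨k, by omega⟩
    rw [← h1] at h2
    simpa [Nat.lt_succ_iff.1 k.2, Fin.is_le] using h2.symm
  · intro v
    obtain ⟨h1, h2⟩ := dotProduct_mulVec_eq_sum hU ((U * E) *ᵥ v)
    rw [Matrix.smul_mulVec, dotProduct_smul, smul_eq_mul, h1, h2, mul_assoc]
    refine mul_le_mul_of_nonneg_left ?_ hc.le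
    rw [Finset.mul_sum]
    refine Finset.sum_le_sum fun i _ => ?_
    rw [hUE, hE]
    split_ifs with h
    · exact mul_le_mul_of_nonneg_right (eigenvalueDesc_antitone A (by omega) hj) (sq_nonneg _)
    · simp

/-- Scaling back by `c⁻¹` reverses the previous inequality. The identity is needed because `Vhat`
uses the eigenvalues of the scaled matrix and `IsPCAFactor` those of the unscaled one. -/
lemma eigenvalueDesc_smul {A : Matrix (Fin n) (Fin n) ℝ} (hA : A.IsHermitian) {c : ℝ}
    (hc : 0 < c) {j : ℕ} (hj : j < n) : eigenvalueDesc (c • A) j = c * eigenvalueDesc A j := by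
  have hcA : (c • A).IsHermitian := by
    rw [Matrix.IsHermitian, Matrix.conjTranspose_smul, hA.eq]; simp
  refine le_antisymm ?_ (mul_eigenvalueDesc_le hA hc hj)
  have h := mul_eigenvalueDesc_le hcA (inv_pos.2 hc) hj
  rw [smul_smul, inv_mul_cancel₀ hc.ne', one_smul] at h
  rwa [inv_mul_le_iff₀ hc] at h

lemma le_dotProduct_mulVec_of_le_eigenvalueDesc {A : Matrix (Fin n) (Fin n) ℝ}
    (hA : A.IsHermitian) {a : ℝ} (h : ∀ j : Fin n, a ≤ eigenvalueDesc A j) (x : Fin n → ℝ) :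
    a * (x ⬝ᵥ x) ≤ x ⬝ᵥ (A *ᵥ x) := by
  obtain ⟨U, hU⟩ := exists_orthonormal_eigenvectors hA
  obtain ⟨h1, h2⟩ := dotProduct_mulVec_eq_sum hU x
  rw [h1, h2, Finset.mul_sum]
  exact Finset.sum_le_sum fun i _ => mul_le_mul_of_nonneg_right (h i) (sq_nonneg _)

lemma exists_pos_le_of_posDef {S : Matrix (Fin n) (Fin n) ℝ} (hS : S.PosDef) :
    ∃ a : ℝ, 0 < a ∧ ∀ x, a * (x ⬝ᵥ x) ≤ x ⬝ᵥ (S *ᵥ x) := by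
  classical
  have hpos : ∀ j : Fin n, 0 < eigenvalueDesc S j := by
    intro j
    have hj : (j : ℕ) < Fintype.card (Fin n) := by simp
    rw [eigenvalueDesc, dif_pos ⟨hS.1, hj⟩]
    have := hS.eigenvalues_pos (Fintype.equivOfCardEq (Fintype.card_fin _) ⟨j, hj⟩)
    simpa [Matrix.IsHermitian.eigenvalues] using this
  rcases isEmpty_or_nonempty (Fin n) with hn | hn
  · exact ⟨1, one_pos, fun x => by simp [dotProduct]⟩
  · obtain ⟨j, hj⟩ := Finite.exists_min fun j : Fin n => eigenvalueDesc S j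
    exact ⟨_, hpos j, fun x => le_dotProduct_mulVec_of_le_eigenvalueDesc hS.1 hj x⟩

end Eigenvalues

/-! ### PCA of a low-rank signal plus noise -/

section PCA

variable {T d r : ℕ}

lemma half_dotProduct_self_le {n : Type*} [Fintype n] (a b : n → ℝ) :
    (1 / 2) * (a ⬝ᵥ a) ≤ (a + b) ⬝ᵥ (a + b) + b ⬝ᵥ b := by
  simp only [dotProduct, Finset.mul_sum, ← Finset.sum_add_distrib, Pi.add_apply]
  exact Finset.sum_le_sum fun i _ => by nlinarith [sq_nonneg (a i + 2 * b i)]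

/-- For `w = F c`, Cauchy–Schwarz gives `‖w‖² = ⟨c, F'w⟩ ≤ ‖c‖ ‖F'w‖`, and `‖c‖²` is at most `‖w‖² /
a`. Thus a lower bound for `F` is also one for `F'` on the range of `F`. -/
lemma mul_dotProduct_le_transpose_mulVec {F : Matrix (Fin T) (Fin r) ℝ} {a : ℝ} (ha : 0 < a)
    (hF : ∀ c, a * (c ⬝ᵥ c) ≤ (F *ᵥ c) ⬝ᵥ (F *ᵥ c)) (c : Fin r → ℝ) :
    a * ((F *ᵥ c) ⬝ᵥ (F *ᵥ c)) ≤ (Fᵀ *ᵥ (F *ᵥ c)) ⬝ᵥ (Fᵀ *ᵥ (F *ᵥ c)) := by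
  set w := F *ᵥ c with hw
  have h1 : w ⬝ᵥ w = c ⬝ᵥ (Fᵀ *ᵥ w) := by
    rw [Matrix.mulVec_transpose, dotProduct_comm c, ← Matrix.dotProduct_mulVec]
  have h2 : (c ⬝ᵥ (Fᵀ *ᵥ w)) ^ 2 ≤ (c ⬝ᵥ c) * ((Fᵀ *ᵥ w) ⬝ᵥ (Fᵀ *ᵥ w)) := by
    simpa [dotProduct, sq] using Finset.sum_mul_sq_le_sq_mul_sq Finset.univ c (Fᵀ *ᵥ w)
  rw [← h1] at h2
  have h3 : 0 ≤ w ⬝ᵥ w := Finset.sum_nonneg fun i _ => mul_self_nonneg _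
  have h4 : 0 ≤ (Fᵀ *ᵥ w) ⬝ᵥ (Fᵀ *ᵥ w) := Finset.sum_nonneg fun i _ => mul_self_nonneg _
  rcases h3.eq_or_lt with h | h
  · rw [← h, mul_zero]; exact h4
  · have h5 := mul_le_mul_of_nonneg_right (hF c) h4
    have h6 : a * (w ⬝ᵥ w) ^ 2 ≤ (w ⬝ᵥ w) * ((Fᵀ *ᵥ w) ⬝ᵥ (Fᵀ *ᵥ w)) := by nlinarith
    refine le_of_mul_le_mul_left ?_ h
    linarith

lemma isHermitian_mul_transpose (X : Matrix (Fin T) (Fin d) ℝ) : (X * Xᵀ).IsHermitian := by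
  rw [← Matrix.conjTranspose_eq_transpose_of_trivial]
  exact Matrix.isHermitian_mul_conjTranspose_self X

/-- The trial space is the range of `F`. There `‖X'w‖² ≥ ½ ‖L F'w‖² - ‖E'w‖²`, the signal
contributes at least `ab/2` times `‖w‖²`, and the noise removes at most half of that. -/
lemma le_eigenvalueDesc_signal_add_noise {F : Matrix (Fin T) (Fin r) ℝ}
    {L : Matrix (Fin d) (Fin r) ℝ} {E : Matrix (Fin T) (Fin d) ℝ} {a b : ℝ} (ha : 0 < a)
    (hb : 0 < b) (hF : ∀ c, a * (c ⬝ᵥ c) ≤ (F *ᵥ c) ⬝ᵥ (F *ᵥ c))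
    (hL : ∀ c, b * (c ⬝ᵥ c) ≤ (L *ᵥ c) ⬝ᵥ (L *ᵥ c)) (hE : 4 * ‖E‖ ^ 2 ≤ a * b) {j : ℕ}
    (hj : j < r) :
    a * b / 4 ≤ eigenvalueDesc ((F * Lᵀ + E) * (F * Lᵀ + E)ᵀ) j := by
  refine le_eigenvalueDesc_of_subspace (isHermitian_mul_transpose _) hj F ?_ ?_
  · intro c hc
    have h1 := hF c
    rw [hc] at h1
    have h2 : 0 ≤ c ⬝ᵥ c := Finset.sum_nonneg fun i _ => mul_self_nonneg _
    refine dotProduct_self_eq_zero.1 (le_antisymm ?_ h2)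
    simp only [dotProduct_zero] at h1
    nlinarith
  · intro c
    have h1 := mul_dotProduct_le_transpose_mulVec ha hF c
    set w := F *ᵥ c
    have h2 := hL (Fᵀ *ᵥ w)
    have h3 := half_dotProduct_self_le (L *ᵥ (Fᵀ *ᵥ w)) (Eᵀ *ᵥ w)
    have h4 := mulVec_dotProduct_self_le Eᵀ w
    rw [opNorm_transpose] at h4
    have h5 : w ⬝ᵥ (((F * Lᵀ + E) * (F * Lᵀ + E)ᵀ) *ᵥ w) =
        (L *ᵥ (Fᵀ *ᵥ w) + Eᵀ *ᵥ w) ⬝ᵥ (L *ᵥ (Fᵀ *ᵥ w) + Eᵀ *ᵥ w) := by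
      have := dotProduct_transpose_mul_self_mulVec (F * Lᵀ + E)ᵀ w
      rw [Matrix.transpose_transpose] at this
      rw [this, Matrix.transpose_add, Matrix.transpose_mul, Matrix.transpose_transpose,
        Matrix.add_mulVec, ← Matrix.mulVec_mulVec]
    rw [h5]
    have h6 : 0 ≤ w ⬝ᵥ w := Finset.sum_nonneg fun i _ => mul_self_nonneg _
    have h7 := mul_le_mul_of_nonneg_right hE h6
    have h8 := mul_le_mul_of_nonneg_left h1 hb.le
    nlinarith

/-- If the leading eigenvalues of `X X'` exceed the squared norm of the noise `E`, where
`X = F L' + E` with `F` of `r` columns, then `X'` is bounded by the norm of the noise on the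
orthogonal complement of the leading eigenvectors. -/
lemma transpose_mulVec_le_of_orthogonal {F Q : Matrix (Fin T) (Fin r) ℝ}
    {L : Matrix (Fin d) (Fin r) ℝ} {E X : Matrix (Fin T) (Fin d) ℝ} {v : Fin r → ℝ}
    (hX : X = F * Lᵀ + E) (hQ : Qᵀ * Q = 1) (hXQ : X * Xᵀ * Q = Q * Matrix.diagonal v)
    (hv : ∀ j, ‖E‖ ^ 2 < v j) {y : Fin T → ℝ} (hy : Qᵀ *ᵥ y = 0) :
    (Xᵀ *ᵥ y) ⬝ᵥ (Xᵀ *ᵥ y) ≤ ‖E‖ ^ 2 * (y ⬝ᵥ y) := by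
  -- If `y` violated the bound, `‖X'z‖²` would exceed `‖E‖² ‖z‖²` for every nonzero `z` in the span
  -- of `y` and the columns of `Q`. This span has dimension `r + 1`, while `F'` has only `r` rows,
  -- so `F'` kills some nonzero `z` in it, and there `X'` acts as `E'`.
  by_contra! hlt
  let Z : Matrix (Fin T) (Fin (r + 1)) ℝ :=
    Matrix.of fun t k => (Fin.snoc (Q t) (y t) : Fin (r + 1) → ℝ) k
  obtain ⟨c, hc0, hc⟩ := mulVec_ne_zero_kernel (Nat.lt_succ_self r) (Fᵀ * Z)
  let u : Fin r → ℝ := fun j => c j.castSucc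
  let s : ℝ := c (Fin.last r)
  have hZ : Z *ᵥ c = Q *ᵥ u + s • y := by
    funext t
    simp [Z, Matrix.mulVec, dotProduct, Fin.sum_univ_castSucc, u, s, mul_comm]
  set z := Z *ᵥ c with hz
  have hFz : Fᵀ *ᵥ z = 0 := by rw [hz, Matrix.mulVec_mulVec, hc]
  have hXz : Xᵀ *ᵥ z = Eᵀ *ᵥ z := by
    rw [hX, Matrix.transpose_add, Matrix.transpose_mul, Matrix.transpose_transpose,
      Matrix.add_mulVec, ← Matrix.mulVec_mulVec, hFz, Matrix.mulVec_zero, zero_add]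
  have hle : (Xᵀ *ᵥ z) ⬝ᵥ (Xᵀ *ᵥ z) ≤ ‖E‖ ^ 2 * (z ⬝ᵥ z) := by
    rw [hXz]
    have := mulVec_dotProduct_self_le Eᵀ z
    rwa [opNorm_transpose] at this
  have hQu : (Q *ᵥ u) ⬝ᵥ (Q *ᵥ u) = u ⬝ᵥ u := by
    rw [← dotProduct_transpose_mul_self_mulVec, hQ, Matrix.one_mulVec]
  have hQy : (Q *ᵥ u) ⬝ᵥ y = 0 := by
    rw [← Matrix.vecMul_transpose, ← Matrix.dotProduct_mulVec, hy, dotProduct_zero]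
  have hzz : z ⬝ᵥ z = u ⬝ᵥ u + s ^ 2 * (y ⬝ᵥ y) := by
    rw [hZ]
    simp only [add_dotProduct, dotProduct_add, smul_dotProduct, dotProduct_smul, smul_eq_mul]
    rw [hQu, hQy, dotProduct_comm y, hQy]
    ring
  have hXQ' : (Xᵀ *ᵥ (Q *ᵥ u)) ⬝ᵥ (Xᵀ *ᵥ (Q *ᵥ u)) = ∑ j, v j * u j ^ 2 := by
    rw [← dotProduct_transpose_mul_self_mulVec, Matrix.transpose_transpose, Matrix.mulVec_mulVec,
      hXQ, ← Matrix.mulVec_mulVec, Matrix.dotProduct_mulVec, ← Matrix.mulVec_transpose,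
      Matrix.mulVec_mulVec, hQ, Matrix.one_mulVec]
    refine Finset.sum_congr rfl fun j _ => ?_
    rw [Matrix.mulVec_diagonal]
    ring
  have hXy : (Xᵀ *ᵥ (Q *ᵥ u)) ⬝ᵥ (Xᵀ *ᵥ y) = 0 := by
    rw [Matrix.dotProduct_mulVec, Matrix.vecMul_transpose, Matrix.mulVec_mulVec,
      Matrix.mulVec_mulVec, hXQ, ← Matrix.mulVec_mulVec, ← Matrix.vecMul_transpose,
      ← Matrix.dotProduct_mulVec, hy, dotProduct_zero]
  have hXz' : (Xᵀ *ᵥ z) ⬝ᵥ (Xᵀ *ᵥ z) =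
      ∑ j, v j * u j ^ 2 + s ^ 2 * ((Xᵀ *ᵥ y) ⬝ᵥ (Xᵀ *ᵥ y)) := by
    rw [hZ, Matrix.mulVec_add, Matrix.mulVec_smul]
    simp only [add_dotProduct, dotProduct_add, smul_dotProduct, dotProduct_smul, smul_eq_mul]
    rw [hXQ', hXy, dotProduct_comm (Xᵀ *ᵥ y), hXy]
    ring
  rw [hXz', hzz, mul_add] at hle
  have h1 : ‖E‖ ^ 2 * (u ⬝ᵥ u) = ∑ j, ‖E‖ ^ 2 * u j ^ 2 := by
    rw [dotProduct, Finset.mul_sum]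
    exact Finset.sum_congr rfl fun j _ => by ring
  have h2 : ∑ j, ‖E‖ ^ 2 * u j ^ 2 ≤ ∑ j, v j * u j ^ 2 :=
    Finset.sum_le_sum fun j _ => mul_le_mul_of_nonneg_right (hv j).le (sq_nonneg _)
  have hs : s = 0 := by
    by_contra hs
    have h3 := mul_lt_mul_of_pos_left hlt (pow_pos (abs_pos.2 hs) 2)
    rw [sq_abs] at h3
    linarith
  have hu : ∀ j, u j = 0 := by
    by_contra! ⟨j, hj⟩
    have h3 : ∑ j, ‖E‖ ^ 2 * u j ^ 2 < ∑ j, v j * u j ^ 2 :=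
      Finset.sum_lt_sum (fun j _ => mul_le_mul_of_nonneg_right (hv j).le (sq_nonneg _))
        ⟨j, Finset.mem_univ j, mul_lt_mul_of_pos_right (hv j) (by positivity)⟩
    rw [hs] at hle
    linarith
  refine hc0 (funext fun k => ?_)
  induction k using Fin.lastCases with
  | last => exact hs
  | cast j => exact hu j

/-- Scaling leaves the column space unchanged, so the factor `√T / T` in the loading estimator drops
out. -/
lemma projMatrix_smul {A : Matrix (Fin d) (Fin r) ℝ} {s : ℝ} (hs : s ≠ 0)
    (hA : IsUnit (Aᵀ * A).det) : projMatrix (s • A) = A * (Aᵀ * A)⁻¹ * Aᵀ := by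
  have hinv : ((s • A)ᵀ * (s • A))⁻¹ = (s ^ 2)⁻¹ • (Aᵀ * A)⁻¹ := by
    refine Matrix.inv_eq_right_inv ?_
    simp only [Matrix.transpose_smul, Matrix.smul_mul, Matrix.mul_smul, smul_smul,
      Matrix.mul_nonsing_inv _ hA]
    rw [show (s ^ 2)⁻¹ * (s * s) = 1 by field_simp, one_smul]
  rw [projMatrix, hinv, Matrix.transpose_smul]
  simp only [Matrix.smul_mul, Matrix.mul_smul, smul_smul]
  rw [show s * ((s ^ 2)⁻¹ * s) = 1 by field_simp, one_smul]

/-- The residual projection of a PCA fit to a factor structure annihilates the loadings up to the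
size of the noise. -/
lemma exists_residual_projection {F Fhat : Matrix (Fin T) (Fin r) ℝ}
    {L : Matrix (Fin d) (Fin r) ℝ} {E X : Matrix (Fin T) (Fin d) ℝ} {a b : ℝ} (hT : 0 < T)
    (ha : 0 < a) (hb : 0 < b) (hF : ∀ c, a * (c ⬝ᵥ c) ≤ (F *ᵥ c) ⬝ᵥ (F *ᵥ c))
    (hL : ∀ c, b * (c ⬝ᵥ c) ≤ (L *ᵥ c) ⬝ᵥ (L *ᵥ c)) (hE : 4 * ‖E‖ ^ 2 < a * b)
    (hX : X = F * Lᵀ + E) (hFhat : IsPCAFactor X Fhat) :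
    ∃ R : Matrix (Fin d) (Fin d) ℝ, halfProj X Fhat = 1 - (1 / 2 : ℝ) • R ∧ Rᵀ = R ∧ ‖R‖ ≤ 1 ∧
      a * ‖Lᵀ * R‖ ^ 2 ≤ 4 * ‖E‖ ^ 2 := by
  obtain ⟨Q, ⟨hQ, hXQ⟩, rfl⟩ := hFhat
  have hv : ∀ j : Fin r, ‖E‖ ^ 2 < eigenvalueDesc (X * Xᵀ) j := fun j => by
    have := le_eigenvalueDesc_signal_add_noise ha hb hF hL hE.le j.2
    rw [← hX] at this
    linarith
  have hT' : (0 : ℝ) < T := by exact_mod_cast hT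
  set D := leadingEigenvalues r (X * Xᵀ) with hD
  have hAA : (Xᵀ * Q)ᵀ * (Xᵀ * Q) = D := by
    rw [Matrix.transpose_mul, Matrix.transpose_transpose, Matrix.mul_assoc, ← Matrix.mul_assoc X,
      hXQ, ← Matrix.mul_assoc, hQ, Matrix.one_mul]
  -- The eigenvalues exceed `‖E‖²`, so the Gram matrix of the loadings is invertible and the default
  -- value of the inverse never enters.
  have hdet : IsUnit D.det := by
    rw [hD, leadingEigenvalues, Matrix.det_diagonal, isUnit_iff_ne_zero]
    exact Finset.prod_ne_zero_iff.2 fun j _ => ((sq_nonneg _).trans_lt (hv j)).ne'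
  have hload : pcaLoading X (√(T : ℝ) • Q) = (√(T : ℝ) / T) • (Xᵀ * Q) := by
    rw [pcaLoading]
    simp only [Matrix.transpose_smul, Matrix.smul_mul, smul_smul, Matrix.transpose_mul,
      Matrix.transpose_transpose, one_div_mul_eq_div]
  have hP : projMatrix (pcaLoading X (√(T : ℝ) • Q)) = Xᵀ * Q * D⁻¹ * (Xᵀ * Q)ᵀ := by
    rw [hload, projMatrix_smul (by positivity) (by rwa [hAA]), hAA]
  set Pr := projMatrix (pcaLoading X (√(T : ℝ) • Q)) with hPr
  have hDt : (D⁻¹)ᵀ = D⁻¹ := by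
    rw [Matrix.transpose_nonsing_inv, hD, leadingEigenvalues, Matrix.diagonal_transpose]
  have hPt : Prᵀ = Pr := by
    rw [hP]
    simp only [Matrix.transpose_mul, hDt, Matrix.transpose_transpose, Matrix.mul_assoc]
  have hPP : Pr * Pr = Pr := by
    have h1 : Xᵀ * Q * D⁻¹ * (Xᵀ * Q)ᵀ * (Xᵀ * Q * D⁻¹ * (Xᵀ * Q)ᵀ) =
        Xᵀ * Q * D⁻¹ * (((Xᵀ * Q)ᵀ * (Xᵀ * Q)) * D⁻¹) * (Xᵀ * Q)ᵀ := by
      simp only [Matrix.mul_assoc]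
    rw [hP, h1, hAA, Matrix.mul_nonsing_inv _ hdet, Matrix.mul_one]
  have hRt : (1 - Pr)ᵀ = 1 - Pr := by rw [Matrix.transpose_sub, hPt, Matrix.transpose_one]
  have hR1 : ‖1 - Pr‖ ≤ 1 := by
    refine opNorm_le_one_of_projection hRt ?_
    simp [Matrix.sub_mul, Matrix.mul_sub, hPP]
  -- Projecting `X` on the estimated loadings is the same as projecting it on the estimated factors,
  -- so the residual is `X'` on the orthogonal complement of `Q`, where the dimension count applies.
  have hXR : X * (1 - Pr) = (Xᵀ * (1 - Q * Qᵀ))ᵀ := by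
    have h1 : X * Pr = Q * Qᵀ * X := by
      have h2 : X * (Xᵀ * Q * D⁻¹ * (Xᵀ * Q)ᵀ) = X * Xᵀ * Q * D⁻¹ * (Xᵀ * Q)ᵀ := by
        simp only [Matrix.mul_assoc]
      rw [hP, h2, hXQ, Matrix.mul_assoc Q, Matrix.mul_nonsing_inv _ hdet, Matrix.mul_one,
        Matrix.transpose_mul, Matrix.transpose_transpose, Matrix.mul_assoc]
    rw [Matrix.mul_sub, h1, Matrix.transpose_mul, Matrix.transpose_transpose,
      Matrix.transpose_sub, Matrix.transpose_mul, Matrix.transpose_transpose,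
      Matrix.transpose_one, Matrix.sub_mul, Matrix.one_mul, Matrix.mul_one]
  have hS1 : ‖1 - Q * Qᵀ‖ ≤ 1 := by
    refine opNorm_le_one_of_projection ?_ ?_
    · rw [Matrix.transpose_sub, Matrix.transpose_mul, Matrix.transpose_transpose,
        Matrix.transpose_one]
    · have h1 : Q * Qᵀ * (Q * Qᵀ) = Q * Qᵀ := by
        rw [Matrix.mul_assoc, ← Matrix.mul_assoc Qᵀ, hQ, Matrix.one_mul]
      simp [Matrix.sub_mul, Matrix.mul_sub, h1]
  have hXRn : ‖X * (1 - Pr)‖ ≤ ‖E‖ := by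
    rw [hXR, opNorm_transpose]
    refine opNorm_le_of_mulVec (norm_nonneg _) fun x => ?_
    rw [← Matrix.mulVec_mulVec]
    refine (transpose_mulVec_le_of_orthogonal hX hQ hXQ hv ?_).trans ?_
    · rw [Matrix.mulVec_mulVec, Matrix.mul_sub, ← Matrix.mul_assoc, hQ]
      simp
    · refine mul_le_mul_of_nonneg_left ?_ (sq_nonneg _)
      refine (mulVec_dotProduct_self_le _ x).trans ?_
      refine mul_le_of_le_one_left (Finset.sum_nonneg fun i _ => mul_self_nonneg _) ?_
      exact pow_le_one₀ (norm_nonneg _) hS1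
  -- The signal in the residual is the residual minus its noise, each of norm at most `‖E‖`. The
  -- lower bound on `F` then removes `F`.
  have hFLR : ‖F * (Lᵀ * (1 - Pr))‖ ≤ 2 * ‖E‖ := by
    have h1 : F * (Lᵀ * (1 - Pr)) = X * (1 - Pr) - E * (1 - Pr) := by
      rw [← Matrix.sub_mul, hX, add_sub_cancel_right, Matrix.mul_assoc]
    rw [h1]
    refine (norm_sub_le _ _).trans ?_
    have h2 := (Matrix.l2_opNorm_mul E (1 - Pr)).trans
      (mul_le_of_le_one_right (norm_nonneg _) hR1)
    linarith
  refine ⟨1 - Pr, ?_, hRt, hR1, ?_⟩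
  · rw [halfProj, ← hPr]
    ext i j
    simp only [Matrix.smul_apply, Matrix.add_apply, Matrix.sub_apply, smul_eq_mul]
    ring
  · have h1 : ‖Lᵀ * (1 - Pr)‖ ≤ √(4 * ‖E‖ ^ 2 / a) := by
      refine opNorm_le_of_mulVec (Real.sqrt_nonneg _) fun x => ?_
      rw [Real.sq_sqrt (by positivity), div_mul_eq_mul_div, le_div_iff₀ ha, mul_comm]
      refine (hF _).trans ?_
      rw [Matrix.mulVec_mulVec]
      refine (mulVec_dotProduct_self_le _ x).trans ?_
      refine mul_le_mul_of_nonneg_right ?_ (Finset.sum_nonneg fun i _ => mul_self_nonneg _)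
      calc _ ≤ (2 * ‖E‖) ^ 2 := pow_le_pow_left₀ (norm_nonneg _) hFLR 2
        _ = _ := by ring
    have h2 := pow_le_pow_left₀ (norm_nonneg _) h1 2
    rw [Real.sq_sqrt (by positivity), le_div_iff₀ ha] at h2
    linarith

end PCA

/-! ### The two halves of the sample as diagonal projections -/

section Blocks

variable {T n r : ℕ}

/-- The diagonal projection on the rows of the first half of the sample. -/
noncomputable def firstHalf (T : ℕ) : Matrix (Fin T) (Fin T) ℝ :=
  Matrix.diagonal fun t => if (t : ℕ) < T / 2 then 1 else 0

/-- The diagonal projection on the rows of the second half of the sample. -/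
noncomputable def secondHalf (T : ℕ) : Matrix (Fin T) (Fin T) ℝ :=
  Matrix.diagonal fun t => if (t : ℕ) < T / 2 then 0 else 1

lemma norm_firstHalf_le : ‖firstHalf T‖ ≤ 1 := by
  rw [firstHalf, Matrix.l2_opNorm_diagonal]
  refine (pi_norm_le_iff_of_nonneg zero_le_one).2 fun t => ?_
  split_ifs <;> simp

lemma norm_secondHalf_le : ‖secondHalf T‖ ≤ 1 := by
  rw [secondHalf, Matrix.l2_opNorm_diagonal]
  refine (pi_norm_le_iff_of_nonneg zero_le_one).2 fun t => ?_
  split_ifs <;> simp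

lemma firstHalf_transpose : (firstHalf T)ᵀ = firstHalf T := Matrix.diagonal_transpose _

lemma secondHalf_transpose : (secondHalf T)ᵀ = secondHalf T := Matrix.diagonal_transpose _

lemma firstHalf_add_secondHalf : firstHalf T + secondHalf T = 1 := by
  rw [firstHalf, secondHalf, Matrix.diagonal_add, ← Matrix.diagonal_one]
  congr 1
  funext t
  split_ifs <;> simp

lemma stack_before_after (A : Matrix (Fin T) (Fin n) ℝ) (B C : Matrix (Fin n) (Fin r) ℝ) :
    stack (before A * B) (after A * C) = firstHalf T * (A * B) + secondHalf T * (A * C) := by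
  ext t j
  simp only [stack, firstHalf, secondHalf, Matrix.of_apply, Matrix.add_apply,
    Matrix.diagonal_mul, before, after]
  split_ifs <;> simp [Matrix.mul_apply]

lemma before_transpose_mul_before (A : Matrix (Fin T) (Fin n) ℝ) (B : Matrix (Fin T) (Fin r) ℝ) :
    (before A)ᵀ * before B = Aᵀ * (firstHalf T * B) := by
  ext i j
  have h : ∀ t, A t i * (firstHalf T * B) t j = if (t : ℕ) < T / 2 then A t i * B t j else 0 :=
    fun t => by simp [firstHalf, Matrix.diagonal_mul]
  simp only [Matrix.mul_apply (M := Aᵀ), Matrix.transpose_apply, h, ← Finset.sum_filter]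
  exact (Finset.sum_subtype (p := fun t : Fin T => (t : ℕ) < T / 2) _ (by simp)
    (fun t => A t i * B t j)).symm

lemma after_transpose_mul_after (A : Matrix (Fin T) (Fin n) ℝ) (B : Matrix (Fin T) (Fin r) ℝ) :
    (after A)ᵀ * after B = Aᵀ * (secondHalf T * B) := by
  ext i j
  have h : ∀ t, A t i * (secondHalf T * B) t j =
      if ¬ (t : ℕ) < T / 2 then A t i * B t j else 0 := fun t => by
    rw [secondHalf, Matrix.diagonal_mul]
    split_ifs <;> simp
  simp only [Matrix.mul_apply (M := Aᵀ), Matrix.transpose_apply, h, ← Finset.sum_filter]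
  exact (Finset.sum_subtype (p := fun t : Fin T => ¬ (t : ℕ) < T / 2) _ (by simp)
    (fun t => A t i * B t j)).symm

end Blocks

/-! ### Deterministic error bound for the factor estimator -/

section DeterministicBound

variable {T d r : ℕ}

lemma NullHypothesis.exists_eq_mul {L1 L2 : Matrix (Fin d) (Fin r) ℝ} (h : NullHypothesis L1 L2) :
    ∃ A : Matrix (Fin r) (Fin r) ℝ, L2 = L1 * A := by
  obtain ⟨L, A1, A2, -, h1, -, rfl, rfl⟩ := h
  refine ⟨A1⁻¹ * A2, ?_⟩
  rw [← Matrix.mul_assoc, Matrix.mul_assoc L, Matrix.mul_nonsing_inv _ h1, Matrix.mul_one]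

/-- A bound on `L₁' R` carries over to `L₂' R` when `L₂` has its columns in the span of those of
`L₁`. -/
lemma norm_transpose_mul_sq_le {L1 L2 : Matrix (Fin d) (Fin r) ℝ} {A : Matrix (Fin r) (Fin r) ℝ}
    (hA : L2 = L1 * A) {b : ℝ} (hb : 0 < b)
    (hL : ∀ c, b * (c ⬝ᵥ c) ≤ (L1 *ᵥ c) ⬝ᵥ (L1 *ᵥ c)) (R : Matrix (Fin d) (Fin d) ℝ) :
    b * ‖L2ᵀ * R‖ ^ 2 ≤ ‖L2‖ ^ 2 * ‖L1ᵀ * R‖ ^ 2 := by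
  have h1 : ‖A‖ ≤ √(‖L2‖ ^ 2 / b) := by
    refine opNorm_le_of_mulVec (Real.sqrt_nonneg _) fun x => ?_
    rw [Real.sq_sqrt (by positivity), div_mul_eq_mul_div, le_div_iff₀ hb, mul_comm]
    refine (hL _).trans ?_
    rw [Matrix.mulVec_mulVec, ← hA]
    exact mulVec_dotProduct_self_le _ x
  have h2 := pow_le_pow_left₀ (norm_nonneg _) h1 2
  rw [Real.sq_sqrt (by positivity), le_div_iff₀ hb] at h2
  have h3 : ‖L2ᵀ * R‖ ≤ ‖A‖ * ‖L1ᵀ * R‖ := by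
    rw [hA, Matrix.transpose_mul, Matrix.mul_assoc, ← opNorm_transpose A]
    exact Matrix.l2_opNorm_mul _ _
  have h4 := pow_le_pow_left₀ (norm_nonneg _) h3 2
  rw [mul_pow] at h4
  nlinarith [mul_le_mul_of_nonneg_right h2 (sq_nonneg ‖L1ᵀ * R‖)]

lemma transformed_eq (P1 P2 : Matrix (Fin d) (Fin d) ℝ) (X : Matrix (Fin T) (Fin d) ℝ) :
    transformed P1 P2 X = firstHalf T * (X * P1ᵀ) + secondHalf T * (X * P2ᵀ) :=
  stack_before_after X P1ᵀ P2ᵀ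

/-- This identity explains the form of the rotations: with the common part `M` of the transformed
data, the block `(i, j)` of `M M'` is `Fⁱ L' Pᵢ' Pⱼ L Fʲ'`, and the factor `Fⁱ` on the left splits
off. -/
lemma rotatedFactors_eq (P1 P2 : Matrix (Fin d) (Fin d) ℝ) (L : Matrix (Fin d) (Fin r) ℝ)
    (F Fhat : Matrix (Fin T) (Fin r) ℝ) (V : Matrix (Fin r) (Fin r) ℝ) :
    rotatedFactors P1 P2 L F Fhat V = (1 / ((d : ℝ) * T)) •
      (transformed P1 P2 (F * Lᵀ) * (transformed P1 P2 (F * Lᵀ))ᵀ * Fhat * V⁻¹) := by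
  rw [rotatedFactors, stack_before_after, rotation, rotation, transformed_eq]
  have hb : ∀ B : Matrix (Fin r) (Fin r) ℝ, B * (before F)ᵀ * before Fhat =
      B * (Fᵀ * (firstHalf T * Fhat)) := fun B => by
    rw [Matrix.mul_assoc, before_transpose_mul_before]
  have ha : ∀ B : Matrix (Fin r) (Fin r) ℝ, B * (after F)ᵀ * after Fhat =
      B * (Fᵀ * (secondHalf T * Fhat)) := fun B => by
    rw [Matrix.mul_assoc, after_transpose_mul_after]
  rw [hb, hb, ha, ha]
  simp only [Matrix.transpose_add, Matrix.transpose_mul, Matrix.transpose_transpose,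
    firstHalf_transpose, secondHalf_transpose, Matrix.mul_add, Matrix.add_mul, Matrix.mul_smul,
    Matrix.mul_assoc, ← smul_add]
  congr 1
  abel

lemma norm_mul_le_of_norm_le_one_left {l m n : Type*} [Fintype l] [Fintype m] [Fintype n]
    [DecidableEq l] [DecidableEq m] [DecidableEq n] {J : Matrix l m ℝ} (hJ : ‖J‖ ≤ 1)
    (A : Matrix m n ℝ) : ‖J * A‖ ≤ ‖A‖ :=
  (Matrix.l2_opNorm_mul J A).trans (mul_le_of_le_one_left (norm_nonneg _) hJ)

lemma norm_mul_le_of_norm_le_one_right {l m n : Type*} [Fintype l] [Fintype m] [Fintype n]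
    [DecidableEq l] [DecidableEq m] [DecidableEq n] {J : Matrix m n ℝ} (hJ : ‖J‖ ≤ 1)
    (A : Matrix l m ℝ) : ‖A * J‖ ≤ ‖A‖ :=
  (Matrix.l2_opNorm_mul A J).trans (mul_le_of_le_one_right (norm_nonneg _) hJ)

lemma norm_halves_le {n : ℕ} {c1 c2 : ℝ} {A B : Matrix (Fin T) (Fin n) ℝ} (hA : ‖A‖ ≤ c1)
    (hB : ‖B‖ ≤ c2) : ‖firstHalf T * A + secondHalf T * B‖ ≤ c1 + c2 :=
  (norm_add_le _ _).trans (add_le_add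
    ((norm_mul_le_of_norm_le_one_left norm_firstHalf_le A).trans hA)
    ((norm_mul_le_of_norm_le_one_left norm_secondHalf_le B).trans hB))

lemma norm_half_residual_le {R : Matrix (Fin d) (Fin d) ℝ} (hR : ‖R‖ ≤ 1) :
    ‖(1 : Matrix (Fin d) (Fin d) ℝ) - (1 / 2 : ℝ) • R‖ ≤ 3 / 2 := by
  have h1 : ‖(1 : Matrix (Fin d) (Fin d) ℝ)‖ ≤ 1 :=
    opNorm_le_one_of_projection Matrix.transpose_one (Matrix.mul_one 1)
  refine (norm_sub_le _ _).trans ?_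
  rw [norm_smul]
  norm_num
  linarith

/-- In the expansion `L'E'` is kept whole, since `‖L‖ ‖E‖` would be too large. The other terms
contain `L'R` or `L'S`, with weights ½, ½ and ¼, whence `5 / 4`. -/
lemma norm_loading_half_residual_noise_le {L : Matrix (Fin d) (Fin r) ℝ}
    {E : Matrix (Fin T) (Fin d) ℝ} {R S : Matrix (Fin d) (Fin d) ℝ} {g e ρ : ℝ}
    (hS : ‖S‖ ≤ 1) (hLR : ‖Lᵀ * R‖ ≤ ρ) (hLS : ‖Lᵀ * S‖ ≤ ρ) (hE : ‖E‖ ≤ e)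
    (hLE : ‖Lᵀ * Eᵀ‖ ≤ g) :
    ‖Lᵀ * ((1 - (1 / 2 : ℝ) • R) * ((1 - (1 / 2 : ℝ) • S) * Eᵀ))‖ ≤ g + 5 / 4 * (ρ * e) := by
  have hE' : ‖Eᵀ‖ ≤ e := by rwa [opNorm_transpose]
  have hρ : 0 ≤ ρ := (norm_nonneg _).trans hLR
  have he : 0 ≤ e := (norm_nonneg _).trans hE
  have h1 : ‖Lᵀ * R * Eᵀ‖ ≤ ρ * e := (Matrix.l2_opNorm_mul _ _).trans (by gcongr)
  have h2 : ‖Lᵀ * S * Eᵀ‖ ≤ ρ * e := (Matrix.l2_opNorm_mul _ _).trans (by gcongr)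
  have h3 : ‖Lᵀ * R * (S * Eᵀ)‖ ≤ ρ * e := (Matrix.l2_opNorm_mul _ _).trans (by
    have := (norm_mul_le_of_norm_le_one_left hS Eᵀ).trans hE'
    gcongr)
  have h4 : Lᵀ * ((1 - (1 / 2 : ℝ) • R) * ((1 - (1 / 2 : ℝ) • S) * Eᵀ)) =
      Lᵀ * Eᵀ - (1 / 2 : ℝ) • (Lᵀ * S * Eᵀ) - (1 / 2 : ℝ) • (Lᵀ * R * Eᵀ)
        + (1 / 4 : ℝ) • (Lᵀ * R * (S * Eᵀ)) := by
    simp only [Matrix.sub_mul, Matrix.mul_sub, Matrix.one_mul, Matrix.smul_mul, Matrix.mul_smul,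
      Matrix.mul_assoc, smul_sub, smul_smul]
    norm_num
    abel
  rw [h4]
  calc _ ≤ ‖Lᵀ * Eᵀ‖ + ‖(1 / 2 : ℝ) • (Lᵀ * S * Eᵀ)‖ + ‖(1 / 2 : ℝ) • (Lᵀ * R * Eᵀ)‖
        + ‖(1 / 4 : ℝ) • (Lᵀ * R * (S * Eᵀ))‖ :=
        (norm_add_le _ _).trans (add_le_add_left ((norm_sub_le _ _).trans
          (add_le_add_left (norm_sub_le _ _) _)) _)
    _ ≤ g + 5 / 4 * (ρ * e) := by
        rw [norm_smul, norm_smul, norm_smul, Real.norm_of_nonneg (by norm_num),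
          Real.norm_of_nonneg (by norm_num)]
        linarith

/-- The estimation error of the factors on the event where the signal dominates the noise. -/
theorem frobSq_sub_rotatedFactors_le (hT : 0 < T) (hd : 0 < d)
    {F1 F2 Fhat1 Fhat2 Fhat : Matrix (Fin T) (Fin r) ℝ} {L1 L2 : Matrix (Fin d) (Fin r) ℝ}
    {E1 E2 X1 X2 : Matrix (Fin T) (Fin d) ℝ} {a b f g e ℓ ρ : ℝ} (ha : 0 < a) (hb : 0 < b)
    (hnull : NullHypothesis L1 L2)
    (hF1 : ∀ c, a * (c ⬝ᵥ c) ≤ (F1 *ᵥ c) ⬝ᵥ (F1 *ᵥ c))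
    (hF2 : ∀ c, a * (c ⬝ᵥ c) ≤ (F2 *ᵥ c) ⬝ᵥ (F2 *ᵥ c))
    (hL1 : ∀ c, b * (c ⬝ᵥ c) ≤ (L1 *ᵥ c) ⬝ᵥ (L1 *ᵥ c))
    (hL2 : ∀ c, b * (c ⬝ᵥ c) ≤ (L2 *ᵥ c) ⬝ᵥ (L2 *ᵥ c))
    (hX1 : X1 = F1 * L1ᵀ + E1) (hX2 : X2 = F2 * L2ᵀ + E2)
    (hFn : ‖F2‖ ≤ f) (hLn : ‖L2‖ ≤ ℓ) (hE1 : ‖E1‖ ≤ e) (hE2 : ‖E2‖ ≤ e)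
    (hLE : ‖L2ᵀ * E2ᵀ‖ ≤ g) (hρ : 0 ≤ ρ) (h1 : 4 * e ^ 2 ≤ a * ρ ^ 2)
    (h2 : ℓ ^ 2 * (4 * e ^ 2) ≤ b * (a * ρ ^ 2)) (h3 : 4 * e ^ 2 < a * b)
    (h4 : 4 * (f * ρ + 3 * e) ^ 2 ≤ a * b)
    (hFhat1 : IsPCAFactor X1 Fhat1) (hFhat2 : IsPCAFactor X2 Fhat2)
    (hFhat : IsPCAFactor (transformed (halfProj X1 Fhat1) (halfProj X2 Fhat2) X2) Fhat) :
    (1 / (T : ℝ)) * frobSq (Fhat - rotatedFactors (halfProj X1 Fhat1) (halfProj X2 Fhat2) L2 F2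
      Fhat (Vhat r (transformed (halfProj X1 Fhat1) (halfProj X2 Fhat2) X2))) ≤
      r * (4 * (8 * f * (g + 5 / 4 * (ρ * e)) + 9 * e ^ 2) / (a * b)) ^ 2 := by
  have he : 0 ≤ e := (norm_nonneg _).trans hE1
  have hf : 0 ≤ f := (norm_nonneg _).trans hFn
  have hg : 0 ≤ g := (norm_nonneg _).trans hLE
  have hE1sq := pow_le_pow_left₀ (norm_nonneg _) hE1 2
  have hE2sq := pow_le_pow_left₀ (norm_nonneg _) hE2 2
  obtain ⟨R1, hP1, hR1t, hR1, hLR1⟩ :=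
    exists_residual_projection hT ha hb hF1 hL1 (by linarith) hX1 hFhat1
  obtain ⟨R2, hP2, hR2t, hR2, hLR2⟩ :=
    exists_residual_projection hT ha hb hF2 hL2 (by linarith) hX2 hFhat2
  have hρ2 : ‖L2ᵀ * R2‖ ≤ ρ := by
    refine abs_le_of_sq_le_sq' ?_ hρ |>.2
    exact le_of_mul_le_mul_left (by linarith) ha
  have hρ1 : ‖L2ᵀ * R1‖ ≤ ρ := by
    -- `R1` is fitted to the first series and nearly annihilates `L1`. The null hypothesis places
    -- the columns of `L2` in the span of those of `L1`.
    obtain ⟨A, hA⟩ := hnull.exists_eq_mul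
    have h5 := norm_transpose_mul_sq_le hA hb hL1 R1
    have h6 := pow_le_pow_left₀ (norm_nonneg _) hLn 2
    refine abs_le_of_sq_le_sq' ?_ hρ |>.2
    refine le_of_mul_le_mul_left (a := a * b) ?_ (by positivity)
    calc a * b * ‖L2ᵀ * R1‖ ^ 2 ≤ a * (‖L2‖ ^ 2 * ‖L1ᵀ * R1‖ ^ 2) := by
          rw [mul_assoc]; exact mul_le_mul_of_nonneg_left h5 ha.le
      _ = ‖L2‖ ^ 2 * (a * ‖L1ᵀ * R1‖ ^ 2) := by ring
      _ ≤ ℓ ^ 2 * (4 * e ^ 2) := by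
          refine mul_le_mul h6 (by linarith) (by positivity) (by positivity)
      _ ≤ _ := by linarith
  have hP1t : (1 - (1 / 2 : ℝ) • R1)ᵀ = 1 - (1 / 2 : ℝ) • R1 := by
    rw [Matrix.transpose_sub, Matrix.transpose_smul, hR1t, Matrix.transpose_one]
  have hP2t : (1 - (1 / 2 : ℝ) • R2)ᵀ = 1 - (1 / 2 : ℝ) • R2 := by
    rw [Matrix.transpose_sub, Matrix.transpose_smul, hR2t, Matrix.transpose_one]
  rw [hP1, hP2] at hFhat ⊢
  set P1 := (1 : Matrix (Fin d) (Fin d) ℝ) - (1 / 2 : ℝ) • R1 with hP1def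
  set P2 := (1 : Matrix (Fin d) (Fin d) ℝ) - (1 / 2 : ℝ) • R2 with hP2def
  set Y := transformed P1 P2 X2 with hY
  set M := transformed P1 P2 (F2 * L2ᵀ) with hM
  set U := transformed P1 P2 E2 with hU
  have hYMU : Y = M + U := by
    rw [hY, hM, hU, transformed_eq, transformed_eq, transformed_eq, hX2]
    simp only [Matrix.add_mul, Matrix.mul_add]
    abel
  -- Each half contributes `3/2 · e`, from `‖P_i‖ ≤ 3/2`, and the two halves are added by the
  -- triangle inequality.
  have hUn : ‖U‖ ≤ 3 * e := by
    have h5 : ∀ R : Matrix (Fin d) (Fin d) ℝ, ‖R‖ ≤ 1 →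
        ‖E2 * (1 - (1 / 2 : ℝ) • R)‖ ≤ e * (3 / 2) := fun R hR =>
      (Matrix.l2_opNorm_mul _ _).trans (mul_le_mul hE2 (norm_half_residual_le hR)
        (norm_nonneg _) he)
    rw [hU, transformed_eq, hP1t, hP2t]
    exact (norm_halves_le (h5 R1 hR1) (h5 R2 hR2)).trans (by linarith)
  have hMn : ‖M - F2 * L2ᵀ‖ ≤ f * ρ := by
    have h5 : M - F2 * L2ᵀ = -((1 / 2 : ℝ) • (firstHalf T * (F2 * (L2ᵀ * R1))
        + secondHalf T * (F2 * (L2ᵀ * R2)))) := by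
      have h6 : F2 * L2ᵀ = firstHalf T * (F2 * L2ᵀ) + secondHalf T * (F2 * L2ᵀ) := by
        rw [← Matrix.add_mul, firstHalf_add_secondHalf, Matrix.one_mul]
      conv_lhs => rw [h6]
      rw [hM, transformed_eq, hP1t, hP2t, hP1def, hP2def]
      simp only [Matrix.mul_sub, Matrix.mul_one, Matrix.mul_smul, Matrix.mul_assoc, smul_add]
      abel
    have h7 : ∀ R : Matrix (Fin d) (Fin d) ℝ, ‖L2ᵀ * R‖ ≤ ρ → ‖F2 * (L2ᵀ * R)‖ ≤ f * ρ :=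
      fun R hR => (Matrix.l2_opNorm_mul _ _).trans (mul_le_mul hFn hR (norm_nonneg _) hf)
    rw [h5, norm_neg, norm_smul, Real.norm_of_nonneg (by norm_num)]
    linarith [norm_halves_le (h7 R1 hρ1) (h7 R2 hρ2)]
  have hN : ‖Y - F2 * L2ᵀ‖ ≤ f * ρ + 3 * e := by
    have h5 : Y - F2 * L2ᵀ = (M - F2 * L2ᵀ) + U := by rw [hYMU]; abel
    rw [h5]
    exact (norm_add_le _ _).trans (add_le_add hMn hUn)
  -- The transformed data are read as the original signal `F2 * L2ᵀ` plus noise. The distortion of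
  -- the signal by the projections counts as noise.
  have hv : ∀ j : Fin r, a * b / 4 ≤ eigenvalueDesc (Y * Yᵀ) j := fun j => by
    have h5 := le_eigenvalueDesc_signal_add_noise ha hb hF2 hL2 (E := Y - F2 * L2ᵀ)
      (by linarith [pow_le_pow_left₀ (norm_nonneg _) hN 2]) j.2
    rwa [add_sub_cancel] at h5
  have hMU : ‖M * Uᵀ‖ ≤ 4 * f * (g + 5 / 4 * (ρ * e)) := by
    have h5 : ∀ R S : Matrix (Fin d) (Fin d) ℝ, ‖S‖ ≤ 1 → ‖L2ᵀ * R‖ ≤ ρ → ‖L2ᵀ * S‖ ≤ ρ →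
        ∀ J K : Matrix (Fin T) (Fin T) ℝ, ‖J‖ ≤ 1 → ‖K‖ ≤ 1 →
        ‖J * (F2 * (L2ᵀ * ((1 - (1 / 2 : ℝ) • R) * ((1 - (1 / 2 : ℝ) • S) * (E2ᵀ * K)))))‖ ≤
          f * (g + 5 / 4 * (ρ * e)) := by
      intro R S hS hLR hLS J K hJ hK
      have h6 := norm_loading_half_residual_noise_le hS hLR hLS hE2 hLE
      refine (norm_mul_le_of_norm_le_one_left hJ _).trans ?_
      have h7 : F2 * (L2ᵀ * ((1 - (1 / 2 : ℝ) • R) * ((1 - (1 / 2 : ℝ) • S) * (E2ᵀ * K)))) =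
          F2 * (L2ᵀ * ((1 - (1 / 2 : ℝ) • R) * ((1 - (1 / 2 : ℝ) • S) * E2ᵀ))) * K := by
        simp only [Matrix.mul_assoc]
      rw [h7]
      refine (norm_mul_le_of_norm_le_one_right hK _).trans ?_
      exact (Matrix.l2_opNorm_mul _ _).trans (mul_le_mul hFn h6 (norm_nonneg _) hf)
    have h6 : M * Uᵀ = firstHalf T * (F2 * (L2ᵀ * (P1 * (P1 * (E2ᵀ * firstHalf T)))))
        + firstHalf T * (F2 * (L2ᵀ * (P1 * (P2 * (E2ᵀ * secondHalf T)))))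
        + secondHalf T * (F2 * (L2ᵀ * (P2 * (P1 * (E2ᵀ * firstHalf T)))))
        + secondHalf T * (F2 * (L2ᵀ * (P2 * (P2 * (E2ᵀ * secondHalf T))))) := by
      rw [hM, hU, transformed_eq, transformed_eq, hP1t, hP2t]
      simp only [Matrix.transpose_add, Matrix.transpose_mul, firstHalf_transpose, hP1t, hP2t,
        secondHalf_transpose, Matrix.add_mul, Matrix.mul_add, Matrix.mul_assoc]
      abel
    rw [h6]
    have k1 := h5 R1 R1 hR1 hρ1 hρ1 _ _ norm_firstHalf_le norm_firstHalf_le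
    have k2 := h5 R1 R2 hR2 hρ1 hρ2 _ _ norm_firstHalf_le norm_secondHalf_le
    have k3 := h5 R2 R1 hR1 hρ2 hρ1 _ _ norm_secondHalf_le norm_firstHalf_le
    have k4 := h5 R2 R2 hR2 hρ2 hρ2 _ _ norm_secondHalf_le norm_secondHalf_le
    refine (norm_add_le _ _).trans ((add_le_add ((norm_add_le _ _).trans
      (add_le_add ((norm_add_le _ _).trans (add_le_add k1 k2)) k3)) k4).trans ?_)
    linarith
  have hW : ‖Y * Yᵀ - M * Mᵀ‖ ≤ 8 * f * (g + 5 / 4 * (ρ * e)) + 9 * e ^ 2 := by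
    have h5 : Y * Yᵀ - M * Mᵀ = M * Uᵀ + (M * Uᵀ)ᵀ + U * Uᵀ := by
      rw [hYMU, Matrix.transpose_mul, Matrix.transpose_transpose]
      simp only [Matrix.transpose_add, Matrix.add_mul, Matrix.mul_add]
      abel
    rw [h5]
    refine (norm_add_le _ _).trans ((add_le_add_left (norm_add_le _ _) _).trans ?_)
    rw [opNorm_transpose, opNorm_mul_transpose_self]
    have h6 := pow_le_pow_left₀ (norm_nonneg _) hUn 2
    nlinarith
  have hdT : (0 : ℝ) < d * T := by positivity
  have hT' : (0 : ℝ) < T := by positivity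
  set V := Vhat r Y with hV
  have hVdiag : V = Matrix.diagonal fun j : Fin r =>
      1 / ((d : ℝ) * T) * eigenvalueDesc (Y * Yᵀ) j := by
    obtain ⟨Q, ⟨hQ, -⟩, -⟩ := hFhat
    -- `eigenvalueDesc_smul` requires an index below `T`; `r` orthonormal vectors in dimension `T`
    -- provide it.
    have hrT : r ≤ T := by
      have h5 := Matrix.rank_mul_le_right Qᵀ Q
      rw [hQ, Matrix.rank_one, Fintype.card_fin] at h5
      simpa using h5.trans (Matrix.rank_le_card_height Q)
    rw [hV, Vhat, leadingEigenvalues]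
    congr 1
    funext j
    exact eigenvalueDesc_smul (isHermitian_mul_transpose Y) (by positivity) (j.2.trans_le hrT)
  have hVpos : ∀ j : Fin r, 0 < 1 / ((d : ℝ) * T) * eigenvalueDesc (Y * Yᵀ) j := fun j =>
    mul_pos (by positivity) (lt_of_lt_of_le (by positivity) (hv j))
  have hVinv : V⁻¹ = Matrix.diagonal fun j : Fin r =>
      (1 / ((d : ℝ) * T) * eigenvalueDesc (Y * Yᵀ) j)⁻¹ := by
    refine Matrix.inv_eq_right_inv ?_
    rw [hVdiag, Matrix.diagonal_mul_diagonal, ← Matrix.diagonal_one]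
    congr 1
    funext j
    exact mul_inv_cancel₀ (hVpos j).ne'
  have hVV : V * V⁻¹ = 1 := by
    rw [hVinv, hVdiag, Matrix.diagonal_mul_diagonal, ← Matrix.diagonal_one]
    congr 1
    funext j
    exact mul_inv_cancel₀ (hVpos j).ne'
  have hVn : ‖V⁻¹‖ ≤ 4 * (d * T) / (a * b) := by
    rw [hVinv, Matrix.l2_opNorm_diagonal]
    refine (pi_norm_le_iff_of_nonneg (by positivity)).2 fun j => ?_
    rw [Real.norm_of_nonneg (inv_nonneg.2 (hVpos j).le), inv_le_comm₀ (hVpos j) (by positivity)]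
    calc (4 * ((d : ℝ) * T) / (a * b))⁻¹ = 1 / (d * T) * (a * b / 4) := by field_simp
      _ ≤ _ := mul_le_mul_of_nonneg_left (hv j) (by positivity)
  -- The eigenvector equation solved for `Fhat`; subtracting `rotatedFactors_eq` leaves only `Y * Yᵀ
  -- - M * Mᵀ`.
  have hFV : Fhat = (1 / ((d : ℝ) * T)) • (Y * Yᵀ * Fhat * V⁻¹) := by
    obtain ⟨Q, ⟨-, hQ⟩, rfl⟩ := hFhat
    have h5 : Q * V = (1 / ((d : ℝ) * T)) • (Y * Yᵀ * Q) := by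
      rw [hQ, ← Matrix.mul_smul, hVdiag, leadingEigenvalues, ← Matrix.diagonal_smul]
      rfl
    calc √(T : ℝ) • Q = √(T : ℝ) • (Q * V * V⁻¹) := by rw [Matrix.mul_assoc, hVV, Matrix.mul_one]
      _ = _ := by
        rw [h5]
        simp only [Matrix.smul_mul, Matrix.mul_smul, smul_smul]
        rw [mul_comm]
  have hFhatn : ‖Fhat‖ ≤ √T := by
    obtain ⟨Q, ⟨hQ, -⟩, rfl⟩ := hFhat
    have h5 : ‖Q‖ ≤ 1 := by
      have h6 := opNorm_transpose_mul_self Q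
      rw [hQ] at h6
      have h7 : ‖(1 : Matrix (Fin r) (Fin r) ℝ)‖ ≤ 1 :=
        opNorm_le_one_of_projection Matrix.transpose_one (Matrix.mul_one 1)
      rw [h6] at h7
      exact (sq_le_one_iff₀ (norm_nonneg _)).1 h7
    rw [norm_smul, Real.norm_of_nonneg (Real.sqrt_nonneg _)]
    exact mul_le_of_le_one_right (Real.sqrt_nonneg _) h5
  set w := 8 * f * (g + 5 / 4 * (ρ * e)) + 9 * e ^ 2 with hw
  have hw0 : 0 ≤ w := (norm_nonneg _).trans hW
  have hdiff : Fhat - rotatedFactors P1 P2 L2 F2 Fhat V =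
      (1 / ((d : ℝ) * T)) • ((Y * Yᵀ - M * Mᵀ) * Fhat * V⁻¹) := by
    rw [rotatedFactors_eq, ← hM, Matrix.sub_mul, Matrix.sub_mul, smul_sub, ← hFV]
  have hnorm : ‖Fhat - rotatedFactors P1 P2 L2 F2 Fhat V‖ ≤ √T * (4 * w / (a * b)) := by
    rw [hdiff, norm_smul, Real.norm_of_nonneg (by positivity)]
    calc _ ≤ 1 / ((d : ℝ) * T) * (w * √T * (4 * (d * T) / (a * b))) := by
          refine mul_le_mul_of_nonneg_left ?_ (by positivity)
          refine (Matrix.l2_opNorm_mul _ _).trans (mul_le_mul ?_ hVn (norm_nonneg _)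
            (by positivity))
          exact (Matrix.l2_opNorm_mul _ _).trans (mul_le_mul hW hFhatn (norm_nonneg _) hw0)
      _ = _ := by field_simp
  have hfrob := sum_sq_le_card_mul_opNorm_sq (Fhat - rotatedFactors P1 P2 L2 F2 Fhat V)
  rw [Fintype.card_fin] at hfrob
  have hsq := pow_le_pow_left₀ (norm_nonneg _) hnorm 2
  rw [mul_pow, Real.sq_sqrt hT'.le] at hsq
  rw [one_div_mul_eq_div, div_le_iff₀ hT', frobSq]
  calc _ ≤ _ := hfrob
    _ ≤ (r : ℝ) * (T * (4 * w / (a * b)) ^ 2) := mul_le_mul_of_nonneg_left hsq (by positivity)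
    _ = _ := by ring

end DeterministicBound

/-! ### Second moments of sums, and Fatou with Markov -/

section Moments

variable {Ω : Type*} [MeasurableSpace Ω] {P : Measure Ω}

lemma memLp_two_mul_of_memLp_four {f g : Ω → ℝ} (hf : MemLp f 4 P) (hg : MemLp g 4 P) :
    MemLp (fun ω => f ω * g ω) 2 P := by
  have : ENNReal.HolderTriple 4 4 2 := ⟨by
    rw [← two_mul, show (4 : ENNReal) = 2 * 2 by norm_num,
      ENNReal.mul_inv (by simp) (by simp), ← mul_assoc, ENNReal.mul_inv_cancel (by simp) (by simp),
      one_mul]⟩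
  exact hg.mul' hf

lemma integrable_mul_of_memLp_two {f g : Ω → ℝ} (hf : MemLp f 2 P) (hg : MemLp g 2 P) :
    Integrable (fun ω => f ω * g ω) P :=
  hf.integrable_mul hg

/-- The second moment of a sum of orthogonal variables. -/
lemma integral_sum_sq_of_orthogonal {ι : Type*} (s : Finset ι) {f : ι → Ω → ℝ}
    (hf : ∀ i ∈ s, MemLp (f i) 2 P)
    (ho : ∀ i ∈ s, ∀ j ∈ s, i ≠ j → ∫ ω, f i ω * f j ω ∂P = 0) :
    ∫ ω, (∑ i ∈ s, f i ω) ^ 2 ∂P = ∑ i ∈ s, ∫ ω, f i ω ^ 2 ∂P := by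
  have h1 : ∀ ω, (∑ i ∈ s, f i ω) ^ 2 = ∑ i ∈ s, ∑ j ∈ s, f i ω * f j ω := fun ω => by
    rw [sq, Finset.sum_mul_sum]
  have hint : ∀ i ∈ s, ∀ j ∈ s, Integrable (fun ω => f i ω * f j ω) P := fun i hi j hj =>
    integrable_mul_of_memLp_two (hf i hi) (hf j hj)
  simp_rw [h1]
  rw [integral_finsetSum _ fun i hi => integrable_finsetSum _ (hint i hi)]
  refine Finset.sum_congr rfl fun i hi => ?_
  rw [integral_finsetSum _ (hint i hi), Finset.sum_eq_single i]
  · simp_rw [sq]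
  · exact fun j hj hij => ho i hi j hj hij.symm
  · exact fun h => absurd hi h

/-- Minkowski's inequality for second moments, in the form of a weighted Cauchy–Schwarz
inequality. -/
lemma integral_sum_sq_le_of_weights {ι : Type*} (s : Finset ι) {f : ι → Ω → ℝ} {w : ι → ℝ} {c : ℝ}
    (hf : ∀ i ∈ s, MemLp (f i) 2 P) (hw : ∀ i ∈ s, 0 < w i)
    (hb : ∀ i ∈ s, ∫ ω, f i ω ^ 2 ∂P ≤ w i ^ 2 * c) :
    ∫ ω, (∑ i ∈ s, f i ω) ^ 2 ∂P ≤ (∑ i ∈ s, w i) ^ 2 * c := by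
  have hint : ∀ i ∈ s, Integrable (fun ω => f i ω ^ 2 / w i) P := fun i hi =>
    (hf i hi).integrable_sq.div_const _
  have h1 : ∀ ω, (∑ i ∈ s, f i ω) ^ 2 ≤ (∑ i ∈ s, w i) * ∑ i ∈ s, f i ω ^ 2 / w i := fun ω =>
    Finset.sum_sq_le_sum_mul_sum_of_sq_le_mul s (fun i hi => (hw i hi).le)
      (fun i hi => div_nonneg (sq_nonneg _) (hw i hi).le)
      (fun i hi => by rw [mul_div_cancel₀ _ (hw i hi).ne'])
  have hw0 : 0 ≤ ∑ i ∈ s, w i := Finset.sum_nonneg fun i hi => (hw i hi).le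
  calc ∫ ω, (∑ i ∈ s, f i ω) ^ 2 ∂P
      ≤ ∫ ω, (∑ i ∈ s, w i) * ∑ i ∈ s, f i ω ^ 2 / w i ∂P :=
        integral_mono (memLp_finsetSum s hf).integrable_sq
          ((integrable_finsetSum s hint).const_mul _) h1
    _ = (∑ i ∈ s, w i) * ∑ i ∈ s, (∫ ω, f i ω ^ 2 ∂P) / w i := by
        rw [integral_const_mul, integral_finsetSum s hint]
        simp_rw [integral_div]
    _ ≤ (∑ i ∈ s, w i) * ∑ i ∈ s, w i * c := by
        refine mul_le_mul_of_nonneg_left (Finset.sum_le_sum fun i hi => ?_) hw0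
        rw [div_le_iff₀ (hw i hi)]
        linarith [hb i hi]
    _ = _ := by rw [← Finset.sum_mul]; ring

/-- Fatou's lemma combined with Markov's inequality. -/
lemma measure_gt_le_of_tendsto [IsProbabilityMeasure P] {f : ℕ → Ω → ℝ} {g : Ω → ℝ} {C K η : ℝ}
    (hf : ∀ N, Integrable (f N) P) (hf0 : ∀ N ω, 0 ≤ f N ω)
    (hC : ∀ᶠ N in atTop, ∫ ω, f N ω ∂P ≤ C) (hg : Measurable g)
    (hlim : ∀ᵐ ω ∂P, Tendsto (fun N => f N ω) atTop (nhds (g ω))) (hK : 0 < K)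
    (hCK : C ≤ K * η) : P {ω | K < g ω} ≤ ENNReal.ofReal η := by
  have h1 : ∫⁻ ω, ENNReal.ofReal (g ω) ∂P ≤ ENNReal.ofReal C := by
    calc ∫⁻ ω, ENNReal.ofReal (g ω) ∂P
        ≤ ∫⁻ ω, liminf (fun N => ENNReal.ofReal (f N ω)) atTop ∂P := by
          refine lintegral_mono_ae ?_
          filter_upwards [hlim] with ω hω
          exact ((ENNReal.tendsto_ofReal hω).liminf_eq).ge
      _ ≤ liminf (fun N => ∫⁻ ω, ENNReal.ofReal (f N ω) ∂P) atTop :=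
          lintegral_liminf_le' fun N => (hf N).aestronglyMeasurable.aemeasurable.ennreal_ofReal
      _ ≤ ENNReal.ofReal C := by
          refine liminf_le_of_frequently_le' (Eventually.frequently ?_)
          filter_upwards [hC] with N hN
          rw [← ofReal_integral_eq_lintegral_ofReal (hf N) (Eventually.of_forall (hf0 N))]
          exact ENNReal.ofReal_le_ofReal hN
  have hK' : ENNReal.ofReal K ≠ 0 := by simpa using hK
  calc P {ω | K < g ω} ≤ P {ω | ENNReal.ofReal K ≤ ENNReal.ofReal (g ω)} :=
        measure_mono fun ω hω => ENNReal.ofReal_le_ofReal (le_of_lt hω)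
    _ ≤ (∫⁻ ω, ENNReal.ofReal (g ω) ∂P) / ENNReal.ofReal K :=
        meas_ge_le_lintegral_div hg.ennreal_ofReal.aemeasurable hK' ENNReal.ofReal_ne_top
    _ ≤ ENNReal.ofReal C / ENNReal.ofReal K := ENNReal.div_le_div_right h1 _
    _ = ENNReal.ofReal (C / K) := (ENNReal.ofReal_div_of_pos hK).symm
    _ ≤ ENNReal.ofReal η := ENNReal.ofReal_le_ofReal (by rw [div_le_iff₀ hK]; linarith)

end Moments

/-! ### Second and fourth moments of white noise -/

section WhiteNoise

variable {Ω : Type*} [MeasurableSpace Ω] {P : Measure Ω} {n : ℕ} {b : ℤ → Ω → Fin n → ℝ}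

/-- The covariance matrix of a white noise. -/
noncomputable def noiseCov (P : Measure Ω) (b : ℤ → Ω → Fin n → ℝ) : Matrix (Fin n) (Fin n) ℝ :=
  Matrix.of fun i j => ∫ ω, b 0 ω i * b 0 ω j ∂P

lemma measurable_mulVec_apply (A : Matrix (Fin n) (Fin n) ℝ) (i : Fin n) :
    Measurable fun x : Fin n → ℝ => (A *ᵥ x) i := by
  unfold Matrix.mulVec dotProduct
  fun_prop

lemma mulVec_apply_sq_le (A : Matrix (Fin n) (Fin n) ℝ) (x : Fin n → ℝ) (i : Fin n) :
    (A *ᵥ x) i ^ 2 ≤ ‖A‖ ^ 2 * (x ⬝ᵥ x) := by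
  refine le_trans ?_ (mulVec_dotProduct_self_le A x)
  rw [sq]
  exact Finset.single_le_sum (f := fun j => (A *ᵥ x) j * (A *ᵥ x) j)
    (fun j _ => mul_self_nonneg _) (Finset.mem_univ i)

namespace IsWhiteNoise

lemma memLp_mulVec (hb : IsWhiteNoise P b) (A : Matrix (Fin n) (Fin n) ℝ) (t : ℤ) (i : Fin n) :
    MemLp (fun ω => (A *ᵥ b t ω) i) 2 P := by
  simp only [Matrix.mulVec, dotProduct]
  exact memLp_finsetSum _ fun j _ => (hb.memLp t j).const_mul (A i j)

lemma integrable_dotProduct_self (hb : IsWhiteNoise P b) (t : ℤ) :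
    Integrable (fun ω => b t ω ⬝ᵥ b t ω) P :=
  integrable_finsetSum _ fun i _ => integrable_mul_of_memLp_two (hb.memLp t i) (hb.memLp t i)

lemma integral_mulVec [IsProbabilityMeasure P] (hb : IsWhiteNoise P b)
    (A : Matrix (Fin n) (Fin n) ℝ) (t : ℤ) (i : Fin n) : ∫ ω, (A *ᵥ b t ω) i ∂P = 0 := by
  simp only [Matrix.mulVec, dotProduct]
  rw [integral_finsetSum _ fun j _ => ((hb.memLp t j).integrable one_le_two).const_mul _]
  simp [integral_const_mul, hb.mean_zero]

lemma integral_mulVec_mul_mulVec (hb : IsWhiteNoise P b) (A B : Matrix (Fin n) (Fin n) ℝ) (t : ℤ)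
    (i j : Fin n) :
    ∫ ω, (A *ᵥ b t ω) i * (B *ᵥ b t ω) j ∂P = (A * noiseCov P b * Bᵀ) i j := by
  simp only [Matrix.mulVec, dotProduct, Finset.sum_mul_sum]
  have hint : ∀ p q, Integrable (fun ω => A i p * b t ω p * (B j q * b t ω q)) P := fun p q =>
    integrable_mul_of_memLp_two ((hb.memLp t p).const_mul _) ((hb.memLp t q).const_mul _)
  rw [integral_finsetSum _ fun p _ => integrable_finsetSum _ fun q _ => hint p q]
  simp only [Matrix.mul_apply, Finset.sum_mul]
  rw [Finset.sum_comm]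
  refine Finset.sum_congr rfl fun p _ => ?_
  rw [integral_finsetSum _ fun q _ => hint p q]
  refine Finset.sum_congr rfl fun q _ => ?_
  have h : ∀ ω, A i p * b t ω p * (B j q * b t ω q) = A i p * B j q * (b t ω p * b t ω q) :=
    fun ω => by ring
  simp only [h, integral_const_mul, hb.cov_const t 0, noiseCov, Matrix.of_apply,
    Matrix.transpose_apply]
  ring

lemma integral_mul_of_ne [IsProbabilityMeasure P] (hb : IsWhiteNoise P b) {s t : ℤ} (hst : s ≠ t)
    (A B : Matrix (Fin n) (Fin n) ℝ) (i j : Fin n) :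
    ∫ ω, (A *ᵥ b s ω) i * (B *ᵥ b t ω) j ∂P = 0 := by
  have h : IndepFun (fun ω => (A *ᵥ b s ω) i) (fun ω => (B *ᵥ b t ω) j) P :=
    (hb.indep.indepFun hst).comp (measurable_mulVec_apply A i) (measurable_mulVec_apply B j)
  rw [h.integral_fun_mul_eq_mul_integral (hb.memLp_mulVec A s i).1 (hb.memLp_mulVec B t j).1,
    hb.integral_mulVec, zero_mul]

/-- A product of four noise variables has mean zero if one of the four times differs from the
other three. -/
lemma integral_mul_mul_mul_eq_zero [IsProbabilityMeasure P] (hb : IsWhiteNoise P b)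
    {w x y z : ℤ} (hx : w ≠ x) (hy : w ≠ y) (hz : w ≠ z) (A B C D : Matrix (Fin n) (Fin n) ℝ)
    (i j k l : Fin n) :
    ∫ ω, (A *ᵥ b w ω) i * ((B *ᵥ b x ω) j * ((C *ᵥ b y ω) k * (D *ᵥ b z ω) l)) ∂P = 0 := by
  have h0 := hb.indep.indepFun_finset {w} {x, y, z} (by simp [hx, hy, hz]) hb.measurable
  have hφ : Measurable fun v : ({w} : Finset ℤ) → Fin n → ℝ => (A *ᵥ v ⟨w, by simp⟩) i :=
    (measurable_mulVec_apply A i).comp (measurable_pi_apply _)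
  have hψ : Measurable fun v : ({x, y, z} : Finset ℤ) → Fin n → ℝ =>
      (B *ᵥ v ⟨x, by simp⟩) j * ((C *ᵥ v ⟨y, by simp⟩) k * (D *ᵥ v ⟨z, by simp⟩) l) :=
    ((measurable_mulVec_apply B j).comp (measurable_pi_apply _)).mul
      (((measurable_mulVec_apply C k).comp (measurable_pi_apply _)).mul
        ((measurable_mulVec_apply D l).comp (measurable_pi_apply _)))
  have h : IndepFun (fun ω => (A *ᵥ b w ω) i)
      (fun ω => (B *ᵥ b x ω) j * ((C *ᵥ b y ω) k * (D *ᵥ b z ω) l)) P := h0.comp hφ hψ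
  have hm : ∀ (A : Matrix (Fin n) (Fin n) ℝ) t i, Measurable fun ω => (A *ᵥ b t ω) i :=
    fun A t i => (measurable_mulVec_apply A i).comp (hb.measurable t)
  rw [h.integral_fun_mul_eq_mul_integral (hm A w i).aestronglyMeasurable
    ((hm B x j).mul ((hm C y k).mul (hm D z l))).aestronglyMeasurable, hb.integral_mulVec,
    zero_mul]

lemma integral_mul_mul_mul_of_ne [IsProbabilityMeasure P] (hb : IsWhiteNoise P b) {s t : ℤ}
    (hst : s ≠ t) (A B C D : Matrix (Fin n) (Fin n) ℝ) (i j k l : Fin n) :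
    ∫ ω, ((A *ᵥ b s ω) i * (B *ᵥ b s ω) j) * ((C *ᵥ b t ω) k * (D *ᵥ b t ω) l) ∂P =
      (A * noiseCov P b * Bᵀ) i j * (C * noiseCov P b * Dᵀ) k l := by
  have h : IndepFun (fun ω => (A *ᵥ b s ω) i * (B *ᵥ b s ω) j)
      (fun ω => (C *ᵥ b t ω) k * (D *ᵥ b t ω) l) P :=
    (hb.indep.indepFun hst).comp
      ((measurable_mulVec_apply A i).mul (measurable_mulVec_apply B j))
      ((measurable_mulVec_apply C k).mul (measurable_mulVec_apply D l))
  have hm : ∀ (A : Matrix (Fin n) (Fin n) ℝ) t i, Measurable fun ω => (A *ᵥ b t ω) i :=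
    fun A t i => (measurable_mulVec_apply A i).comp (hb.measurable t)
  rw [h.integral_fun_mul_eq_mul_integral ((hm A s i).mul (hm B s j)).aestronglyMeasurable
    ((hm C t k).mul (hm D t l)).aestronglyMeasurable, hb.integral_mulVec_mul_mulVec,
    hb.integral_mulVec_mul_mulVec]

lemma memLp_four_mulVec (h4 : ∀ t i, MemLp (fun ω => b t ω i) 4 P)
    (A : Matrix (Fin n) (Fin n) ℝ) (t : ℤ) (i : Fin n) :
    MemLp (fun ω => (A *ᵥ b t ω) i) 4 P := by
  simp only [Matrix.mulVec, dotProduct]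
  exact memLp_finsetSum _ fun j _ => (h4 t j).const_mul (A i j)

lemma memLp_mul (h4 : ∀ t i, MemLp (fun ω => b t ω i) 4 P) (A B : Matrix (Fin n) (Fin n) ℝ)
    (s t : ℤ) (i j : Fin n) : MemLp (fun ω => (A *ᵥ b s ω) i * (B *ᵥ b t ω) j) 2 P :=
  memLp_two_mul_of_memLp_four (memLp_four_mulVec h4 A s i) (memLp_four_mulVec h4 B t j)

lemma memLp_dotProduct (h4 : ∀ t i, MemLp (fun ω => b t ω i) 4 P)
    (A B : Matrix (Fin n) (Fin n) ℝ) (s t : ℤ) :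
    MemLp (fun ω => (A *ᵥ b s ω) ⬝ᵥ (B *ᵥ b t ω)) 2 P :=
  memLp_finsetSum _ fun i _ => memLp_mul h4 A B s t i i

lemma memLp_dotProduct_self (h4 : ∀ t i, MemLp (fun ω => b t ω i) 4 P) (t : ℤ) :
    MemLp (fun ω => b t ω ⬝ᵥ b t ω) 2 P :=
  memLp_finsetSum _ fun i _ => memLp_two_mul_of_memLp_four (h4 t i) (h4 t i)

/-- Cauchy–Schwarz over the coordinates, so that dependence among them is harmless. The price `n ^
2` is affordable because this bound will be used only for products of noise at equal times. -/
lemma integral_dotProduct_self_sq_le {M : ℝ} (h4 : FourthMomentsLE P M b) (t : ℤ) :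
    ∫ ω, (b t ω ⬝ᵥ b t ω) ^ 2 ∂P ≤ n ^ 2 * M := by
  have hint : ∀ i, Integrable (fun ω => b t ω i ^ 4) P := fun i => by
    have := (memLp_two_mul_of_memLp_four (h4 t i).1 (h4 t i).1).integrable_sq
    refine this.congr (Eventually.of_forall fun ω => ?_)
    ring
  have h1 : ∀ ω, (b t ω ⬝ᵥ b t ω) ^ 2 ≤ n * ∑ i, b t ω i ^ 4 := fun ω => by
    have := sq_sum_le_card_mul_sum_sq (s := Finset.univ) (f := fun i => b t ω i * b t ω i)
    rw [Finset.card_univ, Fintype.card_fin] at this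
    refine this.trans_eq ?_
    congr 1
    exact Finset.sum_congr rfl fun i _ => by ring
  calc _ ≤ ∫ ω, n * ∑ i, b t ω i ^ 4 ∂P :=
        integral_mono (memLp_dotProduct_self (fun t i => (h4 t i).1) t).integrable_sq
          ((integrable_finsetSum _ fun i _ => hint i).const_mul _) h1
    _ = n * ∑ i, ∫ ω, b t ω i ^ 4 ∂P := by
        rw [integral_const_mul, integral_finsetSum _ fun i _ => hint i]
    _ ≤ n * ∑ i : Fin n, M := by
        refine mul_le_mul_of_nonneg_left (Finset.sum_le_sum fun i _ => (h4 t i).2) (by positivity)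
    _ = n ^ 2 * M := by simp; ring

end IsWhiteNoise

end WhiteNoise

/-! ### Moment bounds for truncated moving averages -/

section TruncatedMovingAverage

variable {Ω : Type*} [MeasurableSpace Ω] {P : Measure Ω} {n : ℕ} {b : ℤ → Ω → Fin n → ℝ}

/-- The moving average truncated to the first `N` lags. -/
noncomputable def truncMA (D : ℕ → Matrix (Fin n) (Fin n) ℝ) (b : ℤ → Ω → Fin n → ℝ) (N : ℕ)
    (t : ℤ) (ω : Ω) : Fin n → ℝ :=
  ∑ k ∈ Finset.range N, D k *ᵥ b (t - k) ω

/-- The covariance matrix of the truncated moving average. -/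
noncomputable def truncCov (P : Measure Ω) (D : ℕ → Matrix (Fin n) (Fin n) ℝ)
    (b : ℤ → Ω → Fin n → ℝ) (N : ℕ) : Matrix (Fin n) (Fin n) ℝ :=
  ∑ k ∈ Finset.range N, D k * noiseCov P b * (D k)ᵀ

lemma truncMA_apply (D : ℕ → Matrix (Fin n) (Fin n) ℝ) (N : ℕ) (t : ℤ) (ω : Ω) (i : Fin n) :
    truncMA D b N t ω i = ∑ k ∈ Finset.range N, (D k *ᵥ b (t - k) ω) i := by
  rw [truncMA, Finset.sum_apply]

lemma truncMA_mul_truncMA (D : ℕ → Matrix (Fin n) (Fin n) ℝ) (N : ℕ) (s t : ℤ) (ω : Ω)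
    (i j : Fin n) :
    truncMA D b N s ω i * truncMA D b N t ω j = ∑ q ∈ Finset.range N ×ˢ Finset.range N,
      (D q.1 *ᵥ b (s - q.1) ω) i * (D q.2 *ᵥ b (t - q.2) ω) j := by
  rw [truncMA_apply, truncMA_apply, Finset.sum_mul_sum, Finset.sum_product]

lemma truncMA_dotProduct_truncMA (D : ℕ → Matrix (Fin n) (Fin n) ℝ) (N : ℕ) (s t : ℤ) (ω : Ω) :
    truncMA D b N s ω ⬝ᵥ truncMA D b N t ω = ∑ q ∈ Finset.range N ×ˢ Finset.range N,
      (D q.1 *ᵥ b (s - q.1) ω) ⬝ᵥ (D q.2 *ᵥ b (t - q.2) ω) := by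
  simp only [dotProduct, truncMA_mul_truncMA]
  rw [Finset.sum_comm]

namespace IsWhiteNoise

lemma memLp_truncMA (hb : IsWhiteNoise P b) (D : ℕ → Matrix (Fin n) (Fin n) ℝ) (N : ℕ) (t : ℤ)
    (i : Fin n) : MemLp (fun ω => truncMA D b N t ω i) 2 P := by
  simp only [truncMA_apply]
  exact memLp_finsetSum _ fun k _ => hb.memLp_mulVec (D k) (t - k) i

lemma integral_truncMA_mul_truncMA [IsProbabilityMeasure P] (hb : IsWhiteNoise P b)
    (D : ℕ → Matrix (Fin n) (Fin n) ℝ) (N : ℕ) (t : ℤ) (i j : Fin n) :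
    ∫ ω, truncMA D b N t ω i * truncMA D b N t ω j ∂P = truncCov P D b N i j := by
  simp only [truncMA_apply, Finset.sum_mul_sum]
  have hint : ∀ k l : ℕ, Integrable
      (fun ω => (D k *ᵥ b (t - k) ω) i * (D l *ᵥ b (t - l) ω) j) P := fun k l =>
    integrable_mul_of_memLp_two (hb.memLp_mulVec _ _ _) (hb.memLp_mulVec _ _ _)
  rw [integral_finsetSum _ fun k _ => integrable_finsetSum _ fun l _ => hint k l, truncCov,
    Matrix.sum_apply]
  refine Finset.sum_congr rfl fun k hk => ?_
  rw [integral_finsetSum _ fun l _ => hint k l, Finset.sum_eq_single k]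
  · exact hb.integral_mulVec_mul_mulVec _ _ _ _ _
  · exact fun l _ hlk => hb.integral_mul_of_ne (by omega) _ _ _ _
  · exact fun h => absurd hk h

variable [IsProbabilityMeasure P]

/-- As `s ≠ t` and the unordered pairs `{s, t}` and `{u, v}` differ, either `s` or `t` is distinct
from the other three times. -/
lemma integral_dotProduct_mul_dotProduct_eq_zero (hb : IsWhiteNoise P b)
    (h4 : ∀ t i, MemLp (fun ω => b t ω i) 4 P) (A B C D : Matrix (Fin n) (Fin n) ℝ)
    {s t u v : ℤ} (hst : s ≠ t) (h1 : ¬ (s = u ∧ t = v)) (h2 : ¬ (s = v ∧ t = u)) :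
    ∫ ω, ((A *ᵥ b s ω) ⬝ᵥ (B *ᵥ b t ω)) * ((C *ᵥ b u ω) ⬝ᵥ (D *ᵥ b v ω)) ∂P = 0 := by
  simp only [dotProduct, Finset.sum_mul_sum]
  have hint : ∀ i j, Integrable (fun ω => (A *ᵥ b s ω) i * (B *ᵥ b t ω) i *
      ((C *ᵥ b u ω) j * (D *ᵥ b v ω) j)) P := fun i j =>
    integrable_mul_of_memLp_two (memLp_mul h4 _ _ _ _ _ _) (memLp_mul h4 _ _ _ _ _ _)
  rw [integral_finsetSum _ fun i _ => integrable_finsetSum _ fun j _ => hint i j]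
  refine Finset.sum_eq_zero fun i _ => ?_
  rw [integral_finsetSum _ fun j _ => hint i j]
  refine Finset.sum_eq_zero fun j _ => ?_
  by_cases hs : s = u ∨ s = v
  · have h := hb.integral_mul_mul_mul_eq_zero (w := t) (x := s) (y := u) (z := v)
      (by omega) (by omega) (by omega) B A C D i i j j
    rw [← h]
    refine integral_congr_ae (Eventually.of_forall fun ω => ?_)
    ring
  · have h := hb.integral_mul_mul_mul_eq_zero (w := s) (x := t) (y := u) (z := v)
      (by omega) (by omega) (by omega) A B C D i i j j
    rw [← h]
    refine integral_congr_ae (Eventually.of_forall fun ω => ?_)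
    ring

lemma integral_dotProduct_sq (hb : IsWhiteNoise P b)
    (h4 : ∀ t i, MemLp (fun ω => b t ω i) 4 P) (A B : Matrix (Fin n) (Fin n) ℝ)
    {s t : ℤ} (hst : s ≠ t) :
    ∫ ω, ((A *ᵥ b s ω) ⬝ᵥ (B *ᵥ b t ω)) ^ 2 ∂P =
      ∑ i, ∑ j, (A * noiseCov P b * Aᵀ) i j * (B * noiseCov P b * Bᵀ) i j := by
  have h1 : ∀ ω, ((A *ᵥ b s ω) ⬝ᵥ (B *ᵥ b t ω)) ^ 2 = ∑ i, ∑ j,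
      ((A *ᵥ b s ω) i * (A *ᵥ b s ω) j) * ((B *ᵥ b t ω) i * (B *ᵥ b t ω) j) := fun ω => by
    rw [sq, dotProduct, Finset.sum_mul_sum]
    exact Finset.sum_congr rfl fun i _ => Finset.sum_congr rfl fun j _ => by ring
  have hint : ∀ i j, Integrable (fun ω => (A *ᵥ b s ω) i * (A *ᵥ b s ω) j *
      ((B *ᵥ b t ω) i * (B *ᵥ b t ω) j)) P := fun i j =>
    integrable_mul_of_memLp_two (memLp_mul h4 _ _ _ _ _ _) (memLp_mul h4 _ _ _ _ _ _)
  simp only [h1]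
  rw [integral_finsetSum _ fun i _ => integrable_finsetSum _ fun j _ => hint i j]
  refine Finset.sum_congr rfl fun i _ => ?_
  rw [integral_finsetSum _ fun j _ => hint i j]
  exact Finset.sum_congr rfl fun j _ => hb.integral_mul_mul_mul_of_ne hst _ _ _ _ _ _ _ _

omit [IsProbabilityMeasure P] in
lemma integral_dotProduct_same_sq_le {M : ℝ} (h4 : FourthMomentsLE P M b)
    {A B : Matrix (Fin n) (Fin n) ℝ} {x y : ℝ} (hA : ‖A‖ ≤ x) (hB : ‖B‖ ≤ y) (t : ℤ) :
    ∫ ω, ((A *ᵥ b t ω) ⬝ᵥ (B *ᵥ b t ω)) ^ 2 ∂P ≤ (x * y) ^ 2 * (n ^ 2 * M) := by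
  have h4' : ∀ t i, MemLp (fun ω => b t ω i) 4 P := fun t i => (h4 t i).1
  have h1 : ∀ ω, ((A *ᵥ b t ω) ⬝ᵥ (B *ᵥ b t ω)) ^ 2 ≤ (x * y) ^ 2 * (b t ω ⬝ᵥ b t ω) ^ 2 := by
    intro ω
    have h2 : ((A *ᵥ b t ω) ⬝ᵥ (B *ᵥ b t ω)) ^ 2 ≤
        ((A *ᵥ b t ω) ⬝ᵥ (A *ᵥ b t ω)) * ((B *ᵥ b t ω) ⬝ᵥ (B *ᵥ b t ω)) := by
      simpa [dotProduct, sq] using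
        Finset.sum_mul_sq_le_sq_mul_sq Finset.univ (A *ᵥ b t ω) (B *ᵥ b t ω)
    have h0 : 0 ≤ b t ω ⬝ᵥ b t ω := Finset.sum_nonneg fun i _ => mul_self_nonneg _
    have hA' := (mulVec_dotProduct_self_le A (b t ω)).trans
      (mul_le_mul_of_nonneg_right (pow_le_pow_left₀ (norm_nonneg _) hA 2) h0)
    have hB' := (mulVec_dotProduct_self_le B (b t ω)).trans
      (mul_le_mul_of_nonneg_right (pow_le_pow_left₀ (norm_nonneg _) hB 2) h0)
    refine h2.trans ((mul_le_mul hA' hB' (Finset.sum_nonneg fun i _ => mul_self_nonneg _)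
      (by positivity)).trans_eq (by ring))
  calc _ ≤ ∫ ω, (x * y) ^ 2 * (b t ω ⬝ᵥ b t ω) ^ 2 ∂P :=
        integral_mono (memLp_dotProduct h4' _ _ _ _).integrable_sq
          ((memLp_dotProduct_self h4' t).integrable_sq.const_mul _) h1
    _ ≤ _ := by
        rw [integral_const_mul]
        exact mul_le_mul_of_nonneg_left (integral_dotProduct_self_sq_le h4 t) (sq_nonneg _)

lemma sum_cov_mul_cov_nonneg (hb : IsWhiteNoise P b)
    (h4 : ∀ t i, MemLp (fun ω => b t ω i) 4 P) (A B : Matrix (Fin n) (Fin n) ℝ) :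
    0 ≤ ∑ i, ∑ j, (A * noiseCov P b * Aᵀ) i j * (B * noiseCov P b * Bᵀ) i j := by
  rw [← hb.integral_dotProduct_sq h4 A B (zero_ne_one : (0 : ℤ) ≠ 1)]
  exact integral_nonneg fun ω => sq_nonneg _

lemma frobSq_truncCov (D : ℕ → Matrix (Fin n) (Fin n) ℝ) (N : ℕ) :
    frobSq (truncCov P D b N) = ∑ q ∈ Finset.range N ×ˢ Finset.range N, ∑ i, ∑ j,
      (D q.1 * noiseCov P b * (D q.1)ᵀ) i j * (D q.2 * noiseCov P b * (D q.2)ᵀ) i j := by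
  symm
  rw [Finset.sum_comm, frobSq]
  refine Finset.sum_congr rfl fun i _ => ?_
  rw [Finset.sum_comm]
  refine Finset.sum_congr rfl fun j _ => ?_
  rw [truncCov, Matrix.sum_apply, sq, Finset.sum_mul_sum, Finset.sum_product]

/-- Two lag pairs may give the same two noise times interchanged, and such terms are correlated.
Fixing the order of the times excludes this: the terms become orthogonal, and their second moments
are some of the nonnegative summands of `frobSq (truncCov P D b N)`. -/
lemma integral_sum_dotProduct_sq_le (hb : IsWhiteNoise P b)
    (h4 : ∀ t i, MemLp (fun ω => b t ω i) 4 P) (D : ℕ → Matrix (Fin n) (Fin n) ℝ) (N : ℕ)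
    (s t : ℤ) {I : Finset (ℕ × ℕ)} (hI : I ⊆ Finset.range N ×ˢ Finset.range N)
    (hlt : (∀ q ∈ I, s - q.1 < t - q.2) ∨ (∀ q ∈ I, t - q.2 < s - q.1)) :
    ∫ ω, (∑ q ∈ I, (D q.1 *ᵥ b (s - q.1) ω) ⬝ᵥ (D q.2 *ᵥ b (t - q.2) ω)) ^ 2 ∂P ≤
      frobSq (truncCov P D b N) := by
  have hne : ∀ q ∈ I, s - (q.1 : ℤ) ≠ t - q.2 := fun q hq =>
    hlt.elim (fun h => (h q hq).ne) (fun h => (h q hq).ne')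
  rw [integral_sum_sq_of_orthogonal I (fun q _ => memLp_dotProduct h4 _ _ _ _), frobSq_truncCov]
  · calc _ = ∑ q ∈ I, ∑ i, ∑ j, (D q.1 * noiseCov P b * (D q.1)ᵀ) i j *
          (D q.2 * noiseCov P b * (D q.2)ᵀ) i j :=
        Finset.sum_congr rfl fun q hq => hb.integral_dotProduct_sq h4 _ _ (hne q hq)
      _ ≤ _ := Finset.sum_le_sum_of_subset_of_nonneg hI fun q _ _ =>
          hb.sum_cov_mul_cov_nonneg h4 _ _
  · intro p hp q hq hpq
    refine hb.integral_dotProduct_mul_dotProduct_eq_zero h4 _ _ _ _ (hne p hp) ?_ ?_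
    · rintro ⟨h1, h2⟩
      exact hpq (Prod.ext (by omega) (by omega))
    · rintro ⟨h1, h2⟩
      rcases hlt with h | h
      · have := h p hp; have := h q hq; omega
      · have := h p hp; have := h q hq; omega

/-- The lag pairs are split according to whether the first noise time equals, precedes or follows
the second. The two ordered parts each cost one `frobSq`. The part with equal times needs fourth
moments, but its constraint on the lags will make it summable over `t`. The factors 3 and 6 come
from squaring a sum of three terms. -/
lemma integral_truncMA_dotProduct_sq_le (hb : IsWhiteNoise P b) {M : ℝ}
    (h4 : FourthMomentsLE P M b) {D : ℕ → Matrix (Fin n) (Fin n) ℝ} {w : ℕ → ℝ}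
    (hw : ∀ k, 0 < w k) (hD : ∀ k, ‖D k‖ ≤ w k) {K : ℝ} {N : ℕ}
    (hK : ∑ k ∈ Finset.range N, w k ≤ K) (s t : ℤ) :
    ∫ ω, (truncMA D b N s ω ⬝ᵥ truncMA D b N t ω) ^ 2 ∂P ≤
      6 * frobSq (truncCov P D b N) + 3 * (K ^ 2 * (n ^ 2 * M)) *
        ∑ q ∈ Finset.range N ×ˢ Finset.range N,
          if s - (q.1 : ℤ) = t - q.2 then w q.1 * w q.2 else 0 := by
  have h4' : ∀ t i, MemLp (fun ω => b t ω i) 4 P := fun t i => (h4 t i).1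
  have hc : 0 ≤ n ^ 2 * M :=
    (integral_nonneg fun ω => sq_nonneg _).trans (integral_dotProduct_self_sq_le h4 0)
  set R := Finset.range N ×ˢ Finset.range N with hR
  set x : ℕ × ℕ → Ω → ℝ := fun q ω => (D q.1 *ᵥ b (s - q.1) ω) ⬝ᵥ (D q.2 *ᵥ b (t - q.2) ω)
    with hx
  have hxm : ∀ q, MemLp (x q) 2 P := fun q => memLp_dotProduct h4' _ _ _ _
  set I1 := R.filter fun q => s - (q.1 : ℤ) = t - q.2 with hI1
  set I2 := R.filter fun q => s - (q.1 : ℤ) < t - q.2 with hI2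
  set I3 := R.filter fun q => t - (q.2 : ℤ) < s - q.1 with hI3
  have hsplit : ∀ ω, truncMA D b N s ω ⬝ᵥ truncMA D b N t ω =
      ∑ q ∈ I1, x q ω + ∑ q ∈ I2, x q ω + ∑ q ∈ I3, x q ω := by
    intro ω
    rw [truncMA_dotProduct_truncMA, hI1, hI2, hI3, Finset.sum_filter, Finset.sum_filter,
      Finset.sum_filter, ← Finset.sum_add_distrib, ← Finset.sum_add_distrib]
    refine Finset.sum_congr rfl fun q _ => ?_
    rcases lt_trichotomy (s - (q.1 : ℤ)) (t - q.2) with h | h | h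
    · simp [h.ne, h, h.not_gt, x]
    · simp [h, x]
    · simp [h.ne', h, h.not_gt, x]
  have hle : ∀ ω, (truncMA D b N s ω ⬝ᵥ truncMA D b N t ω) ^ 2 ≤
      3 * ((∑ q ∈ I1, x q ω) ^ 2 + (∑ q ∈ I2, x q ω) ^ 2 + (∑ q ∈ I3, x q ω) ^ 2) := by
    intro ω
    rw [hsplit]
    nlinarith [sq_nonneg (∑ q ∈ I1, x q ω - ∑ q ∈ I2, x q ω),
      sq_nonneg (∑ q ∈ I2, x q ω - ∑ q ∈ I3, x q ω), sq_nonneg (∑ q ∈ I1, x q ω - ∑ q ∈ I3, x q ω)]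
  have hint : ∀ I : Finset (ℕ × ℕ), Integrable (fun ω => (∑ q ∈ I, x q ω) ^ 2) P := fun I =>
    (memLp_finsetSum I fun q _ => hxm q).integrable_sq
  have hint0 : Integrable (fun ω => (truncMA D b N s ω ⬝ᵥ truncMA D b N t ω) ^ 2) P := by
    simp only [truncMA_dotProduct_truncMA]
    exact hint R
  have b2 : ∫ ω, (∑ q ∈ I2, x q ω) ^ 2 ∂P ≤ frobSq (truncCov P D b N) :=
    hb.integral_sum_dotProduct_sq_le h4' D N s t (Finset.filter_subset _ _)
      (Or.inl fun q hq => (Finset.mem_filter.1 hq).2)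
  have b3 : ∫ ω, (∑ q ∈ I3, x q ω) ^ 2 ∂P ≤ frobSq (truncCov P D b N) :=
    hb.integral_sum_dotProduct_sq_le h4' D N s t (Finset.filter_subset _ _)
      (Or.inr fun q hq => (Finset.mem_filter.1 hq).2)
  have b1 : ∫ ω, (∑ q ∈ I1, x q ω) ^ 2 ∂P ≤ (∑ q ∈ I1, w q.1 * w q.2) ^ 2 * (n ^ 2 * M) := by
    refine integral_sum_sq_le_of_weights I1 (fun q _ => hxm q)
      (fun q _ => mul_pos (hw _) (hw _)) fun q hq => ?_
    have hq' := (Finset.mem_filter.1 hq).2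
    simp only [hx, hq']
    exact integral_dotProduct_same_sq_le h4 (hD _) (hD _) _
  have hW0 : 0 ≤ ∑ q ∈ I1, w q.1 * w q.2 :=
    Finset.sum_nonneg fun q _ => (mul_pos (hw _) (hw _)).le
  have hWK : ∑ q ∈ I1, w q.1 * w q.2 ≤ K ^ 2 := by
    calc _ ≤ ∑ q ∈ R, w q.1 * w q.2 :=
          Finset.sum_le_sum_of_subset_of_nonneg (Finset.filter_subset _ _)
            fun q _ _ => (mul_pos (hw _) (hw _)).le
      _ = (∑ k ∈ Finset.range N, w k) ^ 2 := by
          rw [hR, Finset.sum_product, sq, Finset.sum_mul_sum]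
      _ ≤ K ^ 2 := pow_le_pow_left₀ (Finset.sum_nonneg fun k _ => (hw k).le) hK 2
  -- Only one of the two weight sums is replaced by `K ^ 2`; the other keeps the constraint linking
  -- `s` and `t`.
  have b1' : ∫ ω, (∑ q ∈ I1, x q ω) ^ 2 ∂P ≤ K ^ 2 * (n ^ 2 * M) * ∑ q ∈ I1, w q.1 * w q.2 := by
    refine b1.trans ?_
    have := mul_le_mul_of_nonneg_right (mul_le_mul_of_nonneg_right hWK hW0) hc
    linarith
  rw [← Finset.sum_filter, ← hI1]
  calc _ ≤ ∫ ω, 3 * ((∑ q ∈ I1, x q ω) ^ 2 + (∑ q ∈ I2, x q ω) ^ 2 + (∑ q ∈ I3, x q ω) ^ 2) ∂P :=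
        integral_mono hint0 ((((hint I1).add (hint I2)).add (hint I3)).const_mul 3) hle
    _ = 3 * (∫ ω, (∑ q ∈ I1, x q ω) ^ 2 ∂P + ∫ ω, (∑ q ∈ I2, x q ω) ^ 2 ∂P
          + ∫ ω, (∑ q ∈ I3, x q ω) ^ 2 ∂P) := by
        have h12 : Integrable (fun ω => (∑ q ∈ I1, x q ω) ^ 2 + (∑ q ∈ I2, x q ω) ^ 2) P :=
          (hint I1).add (hint I2)
        rw [integral_const_mul, integral_add h12 (hint I3),
          integral_add (hint I1) (hint I2)]
    _ ≤ _ := by linarith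

omit [IsProbabilityMeasure P] in
lemma frobSq_mul_transpose_sample (Z : ℤ → Ω → Fin n → ℝ) (T : ℕ) (ω : Ω) :
    frobSq (sample T Z ω * (sample T Z ω)ᵀ) =
      ∑ s : Fin T, ∑ t : Fin T, (Z ((s : ℤ) + 1) ω ⬝ᵥ Z ((t : ℤ) + 1) ω) ^ 2 := by
  rfl

omit [IsProbabilityMeasure P] in
lemma integrable_truncMA_dotProduct_sq (h4 : ∀ t i, MemLp (fun ω => b t ω i) 4 P)
    (D : ℕ → Matrix (Fin n) (Fin n) ℝ) (N : ℕ) (s t : ℤ) :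
    Integrable (fun ω => (truncMA D b N s ω ⬝ᵥ truncMA D b N t ω) ^ 2) P := by
  simp only [truncMA_dotProduct_truncMA]
  exact (memLp_finsetSum _ fun q _ => memLp_dotProduct h4 _ _ _ _).integrable_sq

/-- The fourth Schatten norm of a sample of the truncated moving average. -/
lemma integral_frobSq_sample_mul_transpose_le (hb : IsWhiteNoise P b) {M : ℝ}
    (h4 : FourthMomentsLE P M b) {D : ℕ → Matrix (Fin n) (Fin n) ℝ} {w : ℕ → ℝ}
    (hw : ∀ k, 0 < w k) (hD : ∀ k, ‖D k‖ ≤ w k) {K : ℝ} {N : ℕ}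
    (hK : ∑ k ∈ Finset.range N, w k ≤ K) (T : ℕ) :
    ∫ ω, frobSq (sample T (truncMA D b N) ω * (sample T (truncMA D b N) ω)ᵀ) ∂P ≤
      6 * (T ^ 2 * frobSq (truncCov P D b N)) + 3 * (T * (K ^ 4 * (n ^ 2 * M))) := by
  have h4' : ∀ t i, MemLp (fun ω => b t ω i) 4 P := fun t i => (h4 t i).1
  have hc : 0 ≤ n ^ 2 * M :=
    (integral_nonneg fun ω => sq_nonneg _).trans (integral_dotProduct_self_sq_le h4 0)
  have hint : ∀ s t : ℤ, Integrable
      (fun ω => (truncMA D b N s ω ⬝ᵥ truncMA D b N t ω) ^ 2) P := fun s t =>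
    integrable_truncMA_dotProduct_sq h4' D N s t
  simp only [frobSq_mul_transpose_sample]
  rw [integral_finsetSum _ fun s _ => integrable_finsetSum _ fun t _ => hint _ _]
  set R := Finset.range N ×ˢ Finset.range N with hR
  -- For given `s` and `q` at most one `t` meets the constraint, so the sum over `t` costs no factor
  -- `T`.
  have hrow : ∀ s : Fin T, ∑ t : Fin T, ∑ q ∈ R,
      (if (s : ℤ) + 1 - (q.1 : ℤ) = (t : ℤ) + 1 - q.2 then w q.1 * w q.2 else 0) ≤ K ^ 2 := by
    intro s
    rw [Finset.sum_comm]
    calc _ ≤ ∑ q ∈ R, w q.1 * w q.2 := by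
          refine Finset.sum_le_sum fun q _ => ?_
          have hpos := (mul_pos (hw q.1) (hw q.2)).le
          rw [← Finset.sum_filter, Finset.sum_const, nsmul_eq_mul]
          refine mul_le_of_le_one_left hpos ?_
          have : (Finset.univ.filter fun t : Fin T =>
              (s : ℤ) + 1 - (q.1 : ℤ) = (t : ℤ) + 1 - q.2).card ≤ 1 :=
            Finset.card_le_one.2 fun t ht u hu => by
              have h1 := (Finset.mem_filter.1 ht).2
              have h2 := (Finset.mem_filter.1 hu).2
              exact Fin.ext (by omega)
          exact_mod_cast this
      _ = (∑ k ∈ Finset.range N, w k) ^ 2 := by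
          rw [hR, Finset.sum_product, sq, Finset.sum_mul_sum]
      _ ≤ K ^ 2 := pow_le_pow_left₀ (Finset.sum_nonneg fun k _ => (hw k).le) hK 2
  calc _ = ∑ s : Fin T, ∑ t : Fin T,
        ∫ ω, (truncMA D b N ((s : ℤ) + 1) ω ⬝ᵥ truncMA D b N ((t : ℤ) + 1) ω) ^ 2 ∂P :=
        Finset.sum_congr rfl fun s _ => integral_finsetSum _ fun t _ => hint _ _
    _ ≤ ∑ s : Fin T, ∑ t : Fin T, (6 * frobSq (truncCov P D b N) +
        3 * (K ^ 2 * (n ^ 2 * M)) * ∑ q ∈ R,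
          if (s : ℤ) + 1 - (q.1 : ℤ) = (t : ℤ) + 1 - q.2 then w q.1 * w q.2 else 0) :=
        Finset.sum_le_sum fun s _ => Finset.sum_le_sum fun t _ =>
          hb.integral_truncMA_dotProduct_sq_le h4 hw hD hK _ _
    _ = ∑ s : Fin T, (T * (6 * frobSq (truncCov P D b N)) +
        3 * (K ^ 2 * (n ^ 2 * M)) * ∑ t : Fin T, ∑ q ∈ R,
          if (s : ℤ) + 1 - (q.1 : ℤ) = (t : ℤ) + 1 - q.2 then w q.1 * w q.2 else 0) := by
        refine Finset.sum_congr rfl fun s _ => ?_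
        rw [Finset.sum_add_distrib, Finset.mul_sum Finset.univ]
        simp
    _ ≤ ∑ s : Fin T, (T * (6 * frobSq (truncCov P D b N)) +
        3 * (K ^ 2 * (n ^ 2 * M)) * K ^ 2) :=
        Finset.sum_le_sum fun s _ => add_le_add_right
          (mul_le_mul_of_nonneg_left (hrow s) (by positivity)) _
    _ = _ := by simp; ring

/-- The law of large numbers for the second moments of the truncated moving average. -/
lemma integral_sampleCov_sub_sq_le (hb : IsWhiteNoise P b) {M : ℝ}
    (h4 : FourthMomentsLE P M b) {D : ℕ → Matrix (Fin n) (Fin n) ℝ} {w : ℕ → ℝ}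
    (hw : ∀ k, 0 < w k) (hD : ∀ k, ‖D k‖ ≤ w k) {K : ℝ} {N : ℕ}
    (hK : ∑ k ∈ Finset.range N, w k ≤ K) (T : ℕ) (i j : Fin n) :
    ∫ ω, (∑ t : Fin T, (truncMA D b N ((t : ℤ) + 1) ω i * truncMA D b N ((t : ℤ) + 1) ω j
      - truncCov P D b N i j)) ^ 2 ∂P ≤ T * (K ^ 4 * (n ^ 2 * M)) := by
  have h4' : ∀ t i, MemLp (fun ω => b t ω i) 4 P := fun t i => (h4 t i).1
  have hc : 0 ≤ n ^ 2 * M :=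
    (integral_nonneg fun ω => sq_nonneg _).trans (integral_dotProduct_self_sq_le h4 0)
  set R := Finset.range N ×ˢ Finset.range N with hR
  set y : ℕ → ℤ → Fin n → Ω → ℝ := fun k t p ω => (D k *ᵥ b (t - k) ω) p with hy
  set S : ℕ → ℝ := fun k => (D k * noiseCov P b * (D k)ᵀ) i j with hS
  -- The products are grouped by lag pair and centred. For a fixed lag pair, terms at different `t`
  -- are orthogonal, which gives the factor `T`; the lag pairs are then combined by the weighted
  -- Minkowski inequality, without any control of their correlations.
  set x : ℕ × ℕ → ℤ → Ω → ℝ := fun q t ω =>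
    y q.1 t i ω * y q.2 t j ω - if q.1 = q.2 then S q.1 else 0 with hx
  have hyy : ∀ k l s t p q, MemLp (fun ω => y k s p ω * y l t q ω) 2 P := fun k l s t p q =>
    memLp_mul h4' _ _ _ _ _ _
  have hxm : ∀ q t, MemLp (x q t) 2 P := fun q t => (hyy _ _ _ _ _ _).sub (memLp_const _)
  have hsum : ∀ ω, ∑ t : Fin T, (truncMA D b N ((t : ℤ) + 1) ω i *
      truncMA D b N ((t : ℤ) + 1) ω j - truncCov P D b N i j) =
      ∑ q ∈ R, ∑ t : Fin T, x q ((t : ℤ) + 1) ω := by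
    intro ω
    rw [Finset.sum_comm]
    refine Finset.sum_congr rfl fun t _ => ?_
    simp only [hx, Finset.sum_sub_distrib]
    rw [truncMA_mul_truncMA, truncCov, Matrix.sum_apply]
    congr 1
    rw [hR, Finset.sum_product]
    exact Finset.sum_congr rfl fun k hk => by simp [Finset.mem_range.1 hk, S]
  have hmean : ∀ k t, ∫ ω, y k t i ω * y k t j ω ∂P = S k := fun k t =>
    hb.integral_mulVec_mul_mulVec _ _ _ _ _
  have horth : ∀ q, ∀ s t : Fin T, s ≠ t →
      ∫ ω, x q ((s : ℤ) + 1) ω * x q ((t : ℤ) + 1) ω ∂P = 0 := by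
    rintro ⟨k, l⟩ s t hst
    have hst' : (s : ℤ) ≠ t := fun h => hst (Fin.ext (by exact_mod_cast h))
    by_cases hkl : k = l
    · subst hkl
      have h1 : ∀ ω, x (k, k) ((s : ℤ) + 1) ω * x (k, k) ((t : ℤ) + 1) ω =
          y k (s + 1) i ω * y k (s + 1) j ω * (y k (t + 1) i ω * y k (t + 1) j ω)
          - S k * (y k (s + 1) i ω * y k (s + 1) j ω)
          - S k * (y k (t + 1) i ω * y k (t + 1) j ω) + S k * S k := fun ω => by
        simp only [hx, if_true]
        ring
      have i1 : ∀ t, Integrable (fun ω => S k * (y k t i ω * y k t j ω)) P := fun t =>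
        ((hyy k k t t i j).integrable one_le_two).const_mul _
      have i2 := integrable_mul_of_memLp_two (hyy k k (s + 1) (s + 1) i j)
        (hyy k k (t + 1) (t + 1) i j)
      have i3 : Integrable (fun ω => y k (s + 1) i ω * y k (s + 1) j ω *
          (y k (t + 1) i ω * y k (t + 1) j ω) - S k * (y k (s + 1) i ω * y k (s + 1) j ω)) P :=
        i2.sub (i1 _)
      have i4 : Integrable (fun ω => y k (s + 1) i ω * y k (s + 1) j ω *
          (y k (t + 1) i ω * y k (t + 1) j ω) - S k * (y k (s + 1) i ω * y k (s + 1) j ω)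
          - S k * (y k (t + 1) i ω * y k (t + 1) j ω)) P := i3.sub (i1 _)
      simp only [h1]
      rw [integral_add i4 (integrable_const _), integral_sub i3 (i1 _), integral_sub i2 (i1 _), integral_const_mul,
        integral_const_mul, hmean, hmean, integral_const]
      have h2 : ∫ ω, y k (s + 1) i ω * y k (s + 1) j ω * (y k (t + 1) i ω * y k (t + 1) j ω) ∂P =
          S k * S k := hb.integral_mul_mul_mul_of_ne (by omega) _ _ _ _ _ _ _ _
      rw [h2]
      simp
    · have h1 : ∀ ω, x (k, l) ((s : ℤ) + 1) ω * x (k, l) ((t : ℤ) + 1) ω =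
          y k (s + 1) i ω * y l (s + 1) j ω * (y k (t + 1) i ω * y l (t + 1) j ω) := fun ω => by
        simp only [hx, if_neg hkl, sub_zero]
      simp only [h1]
      have hkl' : (k : ℤ) ≠ l := by exact_mod_cast hkl
      -- If these times differ, `s + 1 - k` is distinct from the other three. If they agree, `s + 1
      -- - l` is, since `s - l = t - k` in addition would force `k = l`.
      by_cases hs : (s : ℤ) + 1 - k = t + 1 - l
      · have h := hb.integral_mul_mul_mul_eq_zero (w := (s : ℤ) + 1 - l) (x := s + 1 - k)
          (y := t + 1 - k) (z := t + 1 - l) (by omega) (by omega) (by omega)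
          (D l) (D k) (D k) (D l) j i i j
        rw [← h]
        refine integral_congr_ae (Eventually.of_forall fun ω => ?_)
        simp only [hy]
        ring
      · have h := hb.integral_mul_mul_mul_eq_zero (w := (s : ℤ) + 1 - k) (x := s + 1 - l)
          (y := t + 1 - k) (z := t + 1 - l) (by omega) (by omega) (by omega)
          (D k) (D l) (D k) (D l) i j i j
        rw [← h]
        refine integral_congr_ae (Eventually.of_forall fun ω => ?_)
        simp only [hy]
        ring
  have hprod : ∀ k l t, ∫ ω, (y k t i ω * y l t j ω) ^ 2 ∂P ≤ (w k * w l) ^ 2 * (n ^ 2 * M) := by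
    intro k l t
    have h1 : ∀ ω, (y k t i ω * y l t j ω) ^ 2 ≤ (w k * w l) ^ 2 *
        (1 / 2 * (b (t - k) ω ⬝ᵥ b (t - k) ω) ^ 2 + 1 / 2 * (b (t - l) ω ⬝ᵥ b (t - l) ω) ^ 2) := by
      intro ω
      have e0 : ∀ u, 0 ≤ b u ω ⬝ᵥ b u ω := fun u => Finset.sum_nonneg fun i _ => mul_self_nonneg _
      have e1 : ∀ k p, y k t p ω ^ 2 ≤ w k ^ 2 * (b (t - k) ω ⬝ᵥ b (t - k) ω) := fun k p =>
        (mulVec_apply_sq_le _ _ _).trans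
          (mul_le_mul_of_nonneg_right (pow_le_pow_left₀ (norm_nonneg _) (hD k) 2) (e0 _))
      rw [mul_pow]
      refine (mul_le_mul (e1 k i) (e1 l j) (sq_nonneg _)
        (mul_nonneg (sq_nonneg _) (e0 _))).trans ?_
      have e2 := two_mul_le_add_sq (b (t - k) ω ⬝ᵥ b (t - k) ω) (b (t - l) ω ⬝ᵥ b (t - l) ω)
      have e3 := mul_le_mul_of_nonneg_left e2 (sq_nonneg (w k * w l))
      linarith
    have i1 : ∀ u, Integrable (fun ω => 1 / 2 * (b u ω ⬝ᵥ b u ω) ^ 2) P := fun u =>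
      (memLp_dotProduct_self h4' u).integrable_sq.const_mul _
    calc _ ≤ ∫ ω, (w k * w l) ^ 2 * (1 / 2 * (b (t - k) ω ⬝ᵥ b (t - k) ω) ^ 2 +
          1 / 2 * (b (t - l) ω ⬝ᵥ b (t - l) ω) ^ 2) ∂P :=
          integral_mono (hyy _ _ _ _ _ _).integrable_sq
            (((i1 _).add (i1 _)).const_mul _) h1
      _ = (w k * w l) ^ 2 * (1 / 2 * ∫ ω, (b (t - k) ω ⬝ᵥ b (t - k) ω) ^ 2 ∂P +
          1 / 2 * ∫ ω, (b (t - l) ω ⬝ᵥ b (t - l) ω) ^ 2 ∂P) := by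
          rw [integral_const_mul, integral_add (i1 _) (i1 _), integral_const_mul,
            integral_const_mul]
      _ ≤ _ := by
          refine mul_le_mul_of_nonneg_left ?_ (sq_nonneg _)
          linarith [integral_dotProduct_self_sq_le h4 (t - k),
            integral_dotProduct_self_sq_le h4 (t - l)]
  -- Centring can only lower the second moment.
  have hx2 : ∀ q t, ∫ ω, x q t ω ^ 2 ∂P ≤ (w q.1 * w q.2) ^ 2 * (n ^ 2 * M) := by
    rintro ⟨k, l⟩ t
    refine le_trans ?_ (hprod k l t)
    by_cases hkl : k = l
    · subst hkl
      have h1 : ∀ ω, x (k, k) t ω ^ 2 = (y k t i ω * y k t j ω) ^ 2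
          - 2 * S k * (y k t i ω * y k t j ω) + S k ^ 2 := fun ω => by
        simp only [hx, if_true]
        ring
      have i1 : Integrable (fun ω => 2 * S k * (y k t i ω * y k t j ω)) P :=
        ((hyy k k t t i j).integrable one_le_two).const_mul _
      have i2 := (hyy k k t t i j).integrable_sq
      have i3 : Integrable (fun ω => (y k t i ω * y k t j ω) ^ 2
          - 2 * S k * (y k t i ω * y k t j ω)) P := i2.sub i1
      simp only [h1]
      rw [integral_add i3 (integrable_const _), integral_sub i2 i1, integral_const_mul,
        hmean, integral_const]
      simp only [probReal_univ, smul_eq_mul, one_mul]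
      nlinarith [sq_nonneg (S k)]
    · simp only [hx, if_neg hkl, sub_zero]
      exact le_rfl
  have hm : ∀ q, ∫ ω, (∑ t : Fin T, x q ((t : ℤ) + 1) ω) ^ 2 ∂P ≤
      (w q.1 * w q.2) ^ 2 * (T * (n ^ 2 * M)) := by
    intro q
    rw [integral_sum_sq_of_orthogonal _ (fun t _ => hxm q _) fun s _ t _ h => horth q s t h]
    calc _ ≤ ∑ t : Fin T, (w q.1 * w q.2) ^ 2 * (n ^ 2 * M) :=
          Finset.sum_le_sum fun t _ => hx2 q _
      _ = _ := by simp; ring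
  simp only [hsum]
  refine (integral_sum_sq_le_of_weights R (fun q _ => memLp_finsetSum _ fun t _ => hxm q _)
    (fun q _ => mul_pos (hw _) (hw _)) fun q _ => hm q).trans ?_
  have hWK : ∑ q ∈ R, w q.1 * w q.2 = (∑ k ∈ Finset.range N, w k) ^ 2 := by
    rw [hR, Finset.sum_product, sq, Finset.sum_mul_sum]
  rw [hWK, ← pow_mul]
  calc _ ≤ K ^ 4 * (T * (n ^ 2 * M)) := mul_le_mul_of_nonneg_right
        (pow_le_pow_left₀ (Finset.sum_nonneg fun k _ => (hw k).le) hK 4) (by positivity)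
    _ = _ := by ring

end IsWhiteNoise

end TruncatedMovingAverage

/-! ### From truncated to infinite moving averages -/

section MovingAverageLimit

variable {Ω : Type*} [MeasurableSpace Ω] {P : Measure Ω} {n : ℕ} {b Z : ℤ → Ω → Fin n → ℝ}
  {D : ℕ → Matrix (Fin n) (Fin n) ℝ}

lemma IsMovingAverage.ae_tendsto_truncMA (h : IsMovingAverage P D b Z) :
    ∀ᵐ ω ∂P, ∀ t i, Tendsto (fun N => truncMA D b N t ω i) atTop (nhds (Z t ω i)) := by
  rw [ae_all_iff]
  intro t
  filter_upwards [h t] with ω hω i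
  exact (continuous_apply i).continuousAt.tendsto.comp hω.tendsto_sum_nat

lemma truncMA_sq_le {K : ℝ} {N : ℕ} (hK : ∑ k ∈ Finset.range N, ‖D k‖ ≤ K) (t : ℤ) (ω : Ω)
    (i : Fin n) :
    truncMA D b N t ω i ^ 2 ≤
      K * ∑ k ∈ Finset.range N, ‖D k‖ * (b (t - k) ω ⬝ᵥ b (t - k) ω) := by
  have h0 : ∀ u, 0 ≤ b u ω ⬝ᵥ b u ω := fun u => Finset.sum_nonneg fun i _ => mul_self_nonneg _
  rw [truncMA_apply]
  refine (Finset.sum_sq_le_sum_mul_sum_of_sq_le_mul _ (fun k _ => norm_nonneg (D k))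
    (fun k _ => mul_nonneg (norm_nonneg (D k)) (h0 (t - k))) fun k _ => ?_).trans
    (mul_le_mul_of_nonneg_right hK
      (Finset.sum_nonneg fun k _ => mul_nonneg (norm_nonneg _) (h0 _)))
  rw [← mul_assoc, ← sq]
  exact mulVec_apply_sq_le _ _ _

/-- The full series `∑ ‖D k‖ |b_{t-k}|²` has finite mean, because the second moments of the noise do
not depend on time. It serves as the majorant, uniform in `N`, for dominated convergence. -/
lemma IsWhiteNoise.exists_integrable_bound (hb : IsWhiteNoise P b)
    (hD : Summable fun k => ‖D k‖) (t : ℤ) :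
    ∃ V : Ω → ℝ, Integrable V P ∧ ∀ᵐ ω ∂P, ∀ N,
      ∑ k ∈ Finset.range N, ‖D k‖ * (b (t - k) ω ⬝ᵥ b (t - k) ω) ≤ V ω := by
  have h0 : ∀ u ω, 0 ≤ b u ω ⬝ᵥ b u ω := fun u ω =>
    Finset.sum_nonneg fun i _ => mul_self_nonneg _
  have hx0 : ∀ k ω, 0 ≤ ‖D k‖ * (b (t - (k : ℕ)) ω ⬝ᵥ b (t - k) ω) := fun k ω =>
    mul_nonneg (norm_nonneg _) (h0 _ _)
  set x : ℕ → Ω → ENNReal := fun k ω =>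
    ENNReal.ofReal (‖D k‖ * (b (t - k) ω ⬝ᵥ b (t - k) ω)) with hx
  have hint : ∀ k : ℕ, Integrable (fun ω => ‖D k‖ * (b (t - k) ω ⬝ᵥ b (t - k) ω)) P := fun k =>
    (hb.integrable_dotProduct_self _).const_mul _
  have hm : ∀ k, AEMeasurable (x k) P := fun k =>
    (hint k).aestronglyMeasurable.aemeasurable.ennreal_ofReal
  have hvar : ∀ u, ∫ ω, b u ω ⬝ᵥ b u ω ∂P = ∫ ω, b 0 ω ⬝ᵥ b 0 ω ∂P := by
    intro u
    simp only [dotProduct]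
    rw [integral_finsetSum _ fun i _ => integrable_mul_of_memLp_two (hb.memLp u i) (hb.memLp u i),
      integral_finsetSum _ fun i _ => integrable_mul_of_memLp_two (hb.memLp 0 i) (hb.memLp 0 i)]
    exact Finset.sum_congr rfl fun i _ => hb.cov_const u 0 i i
  have hfin : ∫⁻ ω, ∑' k, x k ω ∂P ≠ ⊤ := by
    rw [lintegral_tsum hm]
    have h1 : ∀ k, ∫⁻ ω, x k ω ∂P = ENNReal.ofReal (‖D k‖ * ∫ ω, b 0 ω ⬝ᵥ b 0 ω ∂P) := fun k => by
      rw [← ofReal_integral_eq_lintegral_ofReal (hint k) (Eventually.of_forall (hx0 k)),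
        integral_const_mul, hvar]
    simp only [h1]
    exact (hD.mul_right _).tsum_ofReal_ne_top
  refine ⟨fun ω => (∑' k, x k ω).toReal,
    integrable_toReal_of_lintegral_ne_top (AEMeasurable.tsum hm) hfin, ?_⟩
  filter_upwards [ae_lt_top' (AEMeasurable.tsum hm) hfin] with ω hω N
  rw [← ENNReal.ofReal_le_iff_le_toReal hω.ne, ENNReal.ofReal_sum_of_nonneg fun k _ => hx0 k ω]
  exact ENNReal.sum_le_tsum _

/-- The covariances of the truncated moving averages converge to those of the moving average. -/
lemma IsMovingAverage.tendsto_truncCov [IsProbabilityMeasure P] (h : IsMovingAverage P D b Z)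
    (hb : IsWhiteNoise P b) (hD : Summable fun k => ‖D k‖) (t : ℤ) (i j : Fin n) :
    Tendsto (fun N => truncCov P D b N i j) atTop (nhds (∫ ω, Z t ω i * Z t ω j ∂P)) := by
  obtain ⟨V, hV, hle⟩ := hb.exists_integrable_bound hD t
  simp only [← hb.integral_truncMA_mul_truncMA D _ t i j]
  refine tendsto_integral_of_dominated_convergence (fun ω => (∑' k, ‖D k‖) * V ω)
    (fun N => (integrable_mul_of_memLp_two (hb.memLp_truncMA D N t i)
      (hb.memLp_truncMA D N t j)).aestronglyMeasurable) (hV.const_mul _) ?_ ?_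
  · intro N
    filter_upwards [hle] with ω hω
    have hK := hD.sum_le_tsum (Finset.range N) fun k _ => norm_nonneg (D k)
    have hK0 : 0 ≤ ∑' k, ‖D k‖ := tsum_nonneg fun k => norm_nonneg (D k)
    have h1 := (truncMA_sq_le (b := b) hK t ω i).trans (mul_le_mul_of_nonneg_left (hω N) hK0)
    have h2 := (truncMA_sq_le (b := b) hK t ω j).trans (mul_le_mul_of_nonneg_left (hω N) hK0)
    rw [Real.norm_eq_abs, abs_le]
    constructor <;>
      nlinarith [sq_nonneg (truncMA D b N t ω i + truncMA D b N t ω j),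
        sq_nonneg (truncMA D b N t ω i - truncMA D b N t ω j)]
  · filter_upwards [h.ae_tendsto_truncMA] with ω hω
    exact (hω t i).mul (hω t j)

/-- `integral_sum_sq_le_of_weights` requires strictly positive weights, whereas `D k` may vanish. A
geometric sequence of sum 2 is added, whence the constant `K + 2` in the later bounds. -/
lemma exists_summable_weights (hD : Summable fun k => ‖D k‖) {K : ℝ} (hK : ∑' k, ‖D k‖ ≤ K) :
    ∃ w : ℕ → ℝ, (∀ k, 0 < w k) ∧ (∀ k, ‖D k‖ ≤ w k) ∧
      ∀ N, ∑ k ∈ Finset.range N, w k ≤ K + 2 := by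
  refine ⟨fun k => ‖D k‖ + (1 / 2) ^ k, fun k => by positivity, fun k => by simp, fun N => ?_⟩
  rw [Finset.sum_add_distrib]
  refine add_le_add ((hD.sum_le_tsum _ fun k _ => norm_nonneg _).trans hK) ?_
  exact (summable_geometric_two.sum_le_tsum _ fun k _ => by positivity).trans
    tsum_geometric_two.le

end MovingAverageLimit

/-! ### Tail bounds for samples of moving averages -/

section TailBounds

variable {Ω : Type*} [MeasurableSpace Ω] {P : Measure Ω} [IsProbabilityMeasure P] {n : ℕ}
  {b Z : ℤ → Ω → Fin n → ℝ} {D : ℕ → Matrix (Fin n) (Fin n) ℝ}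

/-- The covariance matrix of a moving average is consistently estimated. -/
lemma measure_frobSq_sampleCov_gt_le (hZ : IsMovingAverage P D b Z) (hb : IsWhiteNoise P b)
    (hm : ∀ t, Measurable (Z t)) {M K : ℝ} (h4 : FourthMomentsLE P M b)
    (hD : Summable fun k => ‖D k‖) (hK : ∑' k, ‖D k‖ ≤ K) {S : Matrix (Fin n) (Fin n) ℝ}
    (hS : ∀ t i j, ∫ ω, Z t ω i * Z t ω j ∂P = S i j) (T : ℕ) {c η : ℝ} (hc : 0 < c)
    (hcη : n ^ 2 * (T * ((K + 2) ^ 4 * (n ^ 2 * M))) ≤ c * η) :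
    P {ω | c < frobSq ((sample T Z ω)ᵀ * sample T Z ω - (T : ℝ) • S)} ≤ ENNReal.ofReal η := by
  obtain ⟨w, hw, hDw, hwK⟩ := exists_summable_weights hD hK
  have h4' : ∀ t i, MemLp (fun ω => b t ω i) 4 P := fun t i => (h4 t i).1
  have hfrob : ∀ ω, frobSq ((sample T Z ω)ᵀ * sample T Z ω - (T : ℝ) • S) =
      ∑ i, ∑ j, (∑ t : Fin T, (Z ((t : ℤ) + 1) ω i * Z ((t : ℤ) + 1) ω j - S i j)) ^ 2 := by
    intro ω
    refine Finset.sum_congr rfl fun i _ => Finset.sum_congr rfl fun j _ => ?_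
    simp [Matrix.mul_apply, sample]
  simp only [hfrob]
  have hint : ∀ N i j, Integrable (fun ω => (∑ t : Fin T, (truncMA D b N ((t : ℤ) + 1) ω i *
      truncMA D b N ((t : ℤ) + 1) ω j - truncCov P D b N i j)) ^ 2) P := by
    intro N i j
    have h1 : ∀ t : ℤ, MemLp (fun ω => truncMA D b N t ω i * truncMA D b N t ω j
        - truncCov P D b N i j) 2 P := by
      intro t
      simp only [truncMA_mul_truncMA]
      exact (memLp_finsetSum _ fun q _ => IsWhiteNoise.memLp_mul h4' _ _ _ _ _ _).sub
        (memLp_const _)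
    exact (memLp_finsetSum Finset.univ fun (t : Fin T) _ => h1 ((t : ℤ) + 1)).integrable_sq
  refine measure_gt_le_of_tendsto (f := fun N ω => ∑ i, ∑ j, (∑ t : Fin T,
    (truncMA D b N ((t : ℤ) + 1) ω i * truncMA D b N ((t : ℤ) + 1) ω j
      - truncCov P D b N i j)) ^ 2)
    (fun N => ?_) (fun N ω => ?_) (Eventually.of_forall fun N => ?_) ?_ ?_ hc hcη
  · exact integrable_finsetSum _ fun i _ => integrable_finsetSum _ fun j _ => hint N i j
  · exact Finset.sum_nonneg fun i _ => Finset.sum_nonneg fun j _ => sq_nonneg _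
  · rw [integral_finsetSum _ fun i _ => integrable_finsetSum _ fun j _ => hint N i j]
    calc _ = ∑ i, ∑ j, ∫ ω, (∑ t : Fin T, (truncMA D b N ((t : ℤ) + 1) ω i *
          truncMA D b N ((t : ℤ) + 1) ω j - truncCov P D b N i j)) ^ 2 ∂P :=
          Finset.sum_congr rfl fun i _ => integral_finsetSum _ fun j _ => hint N i j
      _ ≤ ∑ i : Fin n, ∑ j : Fin n, T * ((K + 2) ^ 4 * (n ^ 2 * M)) :=
          Finset.sum_le_sum fun i _ => Finset.sum_le_sum fun j _ =>
            hb.integral_sampleCov_sub_sq_le h4 hw hDw (hwK N) T i j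
      _ = _ := by simp; ring
  · have hm' : ∀ t i, Measurable fun ω => Z t ω i := fun t i =>
      (measurable_pi_apply i).comp (hm t)
    fun_prop
  · filter_upwards [hZ.ae_tendsto_truncMA] with ω hω
    refine tendsto_finsetSum _ fun i _ => tendsto_finsetSum _ fun j _ =>
      (tendsto_finsetSum _ fun t _ => ((hω _ i).mul (hω _ j)).sub ?_).pow 2
    rw [← hS 0 i j]
    exact hZ.tendsto_truncCov hb hD 0 i j

/-- The summand 1 is slack for the truncation: the Frobenius norms of the truncated covariances
converge, hence are eventually below the limit plus one. -/
lemma measure_frobSq_mul_transpose_gt_le (hZ : IsMovingAverage P D b Z) (hb : IsWhiteNoise P b)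
    (hm : ∀ t, Measurable (Z t)) {M K : ℝ} (h4 : FourthMomentsLE P M b)
    (hD : Summable fun k => ‖D k‖) (hK : ∑' k, ‖D k‖ ≤ K) (T : ℕ) {c η : ℝ} (hc : 0 < c)
    (hcη : 6 * (T ^ 2 * (frobSq (autocov P Z 0) + 1)) +
      3 * (T * ((K + 2) ^ 4 * (n ^ 2 * M))) ≤ c * η) :
    P {ω | c < frobSq (sample T Z ω * (sample T Z ω)ᵀ)} ≤ ENNReal.ofReal η := by
  obtain ⟨w, hw, hDw, hwK⟩ := exists_summable_weights hD hK
  have h4' : ∀ t i, MemLp (fun ω => b t ω i) 4 P := fun t i => (h4 t i).1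
  have hlim : Tendsto (fun N => frobSq (truncCov P D b N)) atTop
      (nhds (frobSq (autocov P Z 0))) :=
    tendsto_finsetSum _ fun i _ => tendsto_finsetSum _ fun j _ =>
      (hZ.tendsto_truncCov hb hD 0 i j).pow 2
  refine measure_gt_le_of_tendsto
    (f := fun N ω => frobSq (sample T (truncMA D b N) ω * (sample T (truncMA D b N) ω)ᵀ))
    (fun N => ?_) (fun N ω => by unfold frobSq; positivity) ?_ ?_ ?_ hc hcη
  · simp only [IsWhiteNoise.frobSq_mul_transpose_sample]
    exact integrable_finsetSum _ fun s _ => integrable_finsetSum _ fun t _ =>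
      IsWhiteNoise.integrable_truncMA_dotProduct_sq h4' _ _ _ _
  · filter_upwards [hlim.eventually_le_const (lt_add_one _)] with N hN
    refine (hb.integral_frobSq_sample_mul_transpose_le h4 hw hDw (hwK N) T).trans ?_
    gcongr
  · have hm' : ∀ t i, Measurable fun ω => Z t ω i := fun t i =>
      (measurable_pi_apply i).comp (hm t)
    simp only [IsWhiteNoise.frobSq_mul_transpose_sample, dotProduct]
    fun_prop
  · filter_upwards [hZ.ae_tendsto_truncMA] with ω hω
    simp only [IsWhiteNoise.frobSq_mul_transpose_sample, dotProduct]
    exact tendsto_finsetSum _ fun s _ => tendsto_finsetSum _ fun t _ =>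
      (tendsto_finsetSum _ fun i _ => (hω _ i).mul (hω _ i)).pow 2

/-- Only second moments at equal times enter: the mean of `‖L'Z_t‖²` is the trace of `L'ΓL`, at most
`r ‖L‖² ‖Γ‖`. The summand 1 is again slack for the truncation. -/
lemma measure_frobSq_loading_mul_gt_le (hZ : IsMovingAverage P D b Z) (hb : IsWhiteNoise P b)
    (hm : ∀ t, Measurable (Z t)) (hD : Summable fun k => ‖D k‖) {r : ℕ}
    (L : Matrix (Fin n) (Fin r) ℝ) (T : ℕ) {c η : ℝ} (hc : 0 < c)
    (hcη : T * (r * (‖L‖ ^ 2 * ‖autocov P Z 0‖) + 1) ≤ c * η) :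
    P {ω | c < frobSq (Lᵀ * (sample T Z ω)ᵀ)} ≤ ENNReal.ofReal η := by
  have hfrob : ∀ (Z : ℤ → Ω → Fin n → ℝ) ω, frobSq (Lᵀ * (sample T Z ω)ᵀ) =
      ∑ i, ∑ t : Fin T, ∑ p, ∑ q, L p i * L q i * (Z ((t : ℤ) + 1) ω p * Z ((t : ℤ) + 1) ω q) := by
    intro Z ω
    refine Finset.sum_congr rfl fun i _ => Finset.sum_congr rfl fun t _ => ?_
    simp only [Matrix.mul_apply, sample, Matrix.transpose_apply, Matrix.of_apply, sq,
      Finset.sum_mul_sum]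
    exact Finset.sum_congr rfl fun p _ => Finset.sum_congr rfl fun q _ => by ring
  have hint : ∀ N i p q t, Integrable (fun ω => L p i * L q i *
      (truncMA D b N t ω p * truncMA D b N t ω q)) P := fun N i p q t =>
    (integrable_mul_of_memLp_two (hb.memLp_truncMA D N t p) (hb.memLp_truncMA D N t q)).const_mul _
  have hval : ∀ N, ∫ ω, frobSq (Lᵀ * (sample T (truncMA D b N) ω)ᵀ) ∂P =
      T * ∑ i, ∑ p, ∑ q, L p i * L q i * truncCov P D b N p q := by
    intro N
    simp only [hfrob]
    rw [integral_finsetSum _ fun i _ => integrable_finsetSum _ fun t _ =>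
      integrable_finsetSum _ fun p _ => integrable_finsetSum _ fun q _ => hint N i p q _,
      Finset.mul_sum]
    refine Finset.sum_congr rfl fun i _ => ?_
    rw [integral_finsetSum _ fun t _ =>
      integrable_finsetSum _ fun p _ => integrable_finsetSum _ fun q _ => hint N i p q _]
    have h1 : ∀ t : ℤ, ∫ ω, ∑ p, ∑ q, L p i * L q i *
        (truncMA D b N t ω p * truncMA D b N t ω q) ∂P =
        ∑ p, ∑ q, L p i * L q i * truncCov P D b N p q := by
      intro t
      rw [integral_finsetSum _ fun p _ => integrable_finsetSum _ fun q _ => hint N i p q _]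
      refine Finset.sum_congr rfl fun p _ => ?_
      rw [integral_finsetSum _ fun q _ => hint N i p q _]
      refine Finset.sum_congr rfl fun q _ => ?_
      rw [integral_const_mul, hb.integral_truncMA_mul_truncMA]
    simp [h1]
  have hlim : Tendsto (fun N => ∑ i, ∑ p, ∑ q, L p i * L q i * truncCov P D b N p q) atTop
      (nhds (∑ i, ∑ p, ∑ q, L p i * L q i * autocov P Z 0 p q)) :=
    tendsto_finsetSum _ fun i _ => tendsto_finsetSum _ fun p _ => tendsto_finsetSum _ fun q _ =>
      (hZ.tendsto_truncCov hb hD 0 p q).const_mul _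
  have hbound : ∑ i, ∑ p, ∑ q, L p i * L q i * autocov P Z 0 p q ≤
      r * (‖L‖ ^ 2 * ‖autocov P Z 0‖) := by
    calc _ = ∑ i, (Lᵀ * autocov P Z 0 * L) i i := by
          refine Finset.sum_congr rfl fun i _ => ?_
          simp only [Matrix.mul_apply, Matrix.transpose_apply, Finset.sum_mul]
          rw [Finset.sum_comm]
          exact Finset.sum_congr rfl fun p _ => Finset.sum_congr rfl fun q _ => by ring
      _ ≤ ∑ i : Fin r, ‖L‖ ^ 2 * ‖autocov P Z 0‖ := by
          refine Finset.sum_le_sum fun i _ => (le_abs_self _).trans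
            ((abs_entry_le_opNorm _ _ _).trans ?_)
          refine (Matrix.l2_opNorm_mul _ _).trans ((mul_le_mul_of_nonneg_right
            (Matrix.l2_opNorm_mul _ _) (norm_nonneg _)).trans_eq ?_)
          rw [opNorm_transpose]
          ring
      _ = _ := by simp
  refine measure_gt_le_of_tendsto
    (f := fun N ω => frobSq (Lᵀ * (sample T (truncMA D b N) ω)ᵀ))
    (fun N => ?_) (fun N ω => by unfold frobSq; positivity) ?_ ?_ ?_ hc hcη
  · simp only [hfrob]
    exact integrable_finsetSum _ fun i _ => integrable_finsetSum _ fun t _ =>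
      integrable_finsetSum _ fun p _ => integrable_finsetSum _ fun q _ => hint N i p q _
  · filter_upwards [hlim.eventually_le_const (lt_add_one _)] with N hN
    rw [hval]
    refine mul_le_mul_of_nonneg_left (hN.trans ?_) (by positivity)
    linarith
  · have hm' : ∀ t i, Measurable fun ω => Z t ω i := fun t i =>
      (measurable_pi_apply i).comp (hm t)
    simp only [hfrob]
    fun_prop
  · filter_upwards [hZ.ae_tendsto_truncMA] with ω hω
    simp only [hfrob]
    exact tendsto_finsetSum _ fun i _ => tendsto_finsetSum _ fun t _ =>
      tendsto_finsetSum _ fun p _ => tendsto_finsetSum _ fun q _ =>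
        ((hω _ p).mul (hω _ q)).const_mul _

end TailBounds

/-! ### Good events of a factor model -/

section ModelBounds

variable {Ω : Type*} [MeasurableSpace Ω] {P : Measure Ω} [IsProbabilityMeasure P] {r : ℕ}
  {F : ℤ → Ω → Fin r → ℝ} {e : (d : ℕ) → ℤ → Ω → Fin d → ℝ}
  {L : (d : ℕ) → Matrix (Fin d) (Fin r) ℝ}

lemma sample_observed {d : ℕ} (A : Matrix (Fin d) (Fin r) ℝ) (F : ℤ → Ω → Fin r → ℝ)
    (e : ℤ → Ω → Fin d → ℝ) (T : ℕ) (ω : Ω) :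
    sample T (observed A F e) ω = sample T F ω * Aᵀ + sample T e ω := by
  ext t j
  simp only [sample, observed, Matrix.of_apply, Matrix.add_apply, Matrix.mul_apply, Pi.add_apply,
    Matrix.mulVec, dotProduct, Matrix.transpose_apply]
  congr 1
  exact Finset.sum_congr rfl fun k _ => mul_comm _ _

namespace FactorModelAssumptions

/-- With high probability `F'F` is within `α T / 2` of `T S`, where `α` bounds the form of `S` from
below. This costs half of the lower bound and adds `α / 2` to the upper one. -/
lemma factor_bounds (h : FactorModelAssumptions P F e L) {η : ℝ} (hη : 0 < η) :
    ∃ α κ : ℝ, 0 < α ∧ 0 < κ ∧ ∀ᶠ T : ℕ in atTop,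
      P {ω | ¬ ((∀ c, α * T * (c ⬝ᵥ c) ≤ (sample T F ω *ᵥ c) ⬝ᵥ (sample T F ω *ᵥ c)) ∧
        ‖sample T F ω‖ ^ 2 ≤ κ * T)} ≤ ENNReal.ofReal η := by
  obtain ⟨C, a, M, hC, ha, h4, hma⟩ := h.factor_linear
  obtain ⟨S, hS, hcov⟩ := h.factor_cov
  obtain ⟨α, hα, hαS⟩ := exists_pos_le_of_posDef hS
  set K := ∑' k, ‖C k‖ with hK
  set q : ℝ := r ^ 2 * ((K + 2) ^ 4 * (r ^ 2 * M)) with hq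
  refine ⟨α / 2, ‖S‖ + α / 2, by positivity, by positivity, ?_⟩
  filter_upwards [eventually_gt_atTop 0,
    tendsto_natCast_atTop_atTop.eventually_ge_atTop (q * 4 / (α ^ 2 * η))] with T hT hTq
  have hT' : (0 : ℝ) < T := by exact_mod_cast hT
  refine le_trans (measure_mono ?_) (measure_frobSq_sampleCov_gt_le hma ha h.measurable_factor h4
    hC le_rfl hcov T (c := (α / 2 * T) ^ 2) (η := η) (by positivity) ?_)
  · intro ω hω
    by_contra hle
    simp only [Set.mem_ofPred_eq, not_lt] at hle
    refine hω ?_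
    set Fs := sample T F ω
    have h1 : ‖Fsᵀ * Fs - (T : ℝ) • S‖ ≤ α / 2 * T :=
      abs_le_of_sq_le_sq' ((opNorm_sq_le_sum _).trans hle) (by positivity) |>.2
    refine ⟨fun c => ?_, ?_⟩
    · have h0 : 0 ≤ c ⬝ᵥ c := Finset.sum_nonneg fun i _ => mul_self_nonneg _
      have h2 := (abs_le.1 (dotProduct_mulVec_le (Fsᵀ * Fs - (T : ℝ) • S) c)).1
      rw [Matrix.sub_mulVec, dotProduct_sub, dotProduct_transpose_mul_self_mulVec,
        Matrix.smul_mulVec, dotProduct_smul, smul_eq_mul] at h2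
      have h3 := mul_le_mul_of_nonneg_left (hαS c) hT'.le
      have h4 := mul_le_mul_of_nonneg_right h1 h0
      linarith
    · have h2 : Fsᵀ * Fs = (Fsᵀ * Fs - (T : ℝ) • S) + (T : ℝ) • S := by abel
      rw [← opNorm_transpose_mul_self, h2]
      refine (norm_add_le _ _).trans ?_
      rw [norm_smul, Real.norm_of_nonneg hT'.le]
      linarith
  · rw [div_le_iff₀ (by positivity)] at hTq
    have := mul_le_mul_of_nonneg_right hTq hT'.le
    calc _ = q * T := by rw [hq]; ring
      _ ≤ _ := by linarith

/-- The rate enters only through convergence: once the scaled eigenvalues are within half the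
smallest limit of their limits, they exceed that half. -/
lemma loading_lower_bound (h : FactorModelAssumptions P F e L) :
    ∃ β : ℝ, 0 < β ∧ ∀ᶠ d : ℕ in atTop, ∀ c,
      β * d * (c ⬝ᵥ c) ≤ (L d *ᵥ c) ⬝ᵥ (L d *ᵥ c) := by
  obtain ⟨p, hp, hO⟩ := h.pervasive
  obtain ⟨β, hβ, hβp⟩ : ∃ β : ℝ, 0 < β ∧ ∀ j, β ≤ p j / 2 := by
    rcases isEmpty_or_nonempty (Fin r) with hr | hr
    · exact ⟨1, one_pos, fun j => (hr.false j).elim⟩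
    · obtain ⟨j, hj⟩ := Finite.exists_min p
      exact ⟨p j / 2, half_pos (hp j), fun i => by linarith [hj i]⟩
  have h0 : Tendsto (fun d : ℕ => 1 / √(d : ℝ)) atTop (nhds 0) := by
    simp only [one_div]
    exact tendsto_inv_atTop_zero.comp
      (Real.tendsto_sqrt_atTop.comp tendsto_natCast_atTop_atTop)
  refine ⟨β, hβ, ?_⟩
  filter_upwards [(hO.trans_tendsto h0).eventually_lt_const hβ, eventually_gt_atTop 0]
    with d hd hd0 c
  have hd' : (0 : ℝ) < d := by exact_mod_cast hd0
  have hA : ((L d)ᵀ * L d).IsHermitian := by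
    have := isHermitian_mul_transpose (L d)ᵀ
    rwa [Matrix.transpose_transpose] at this
  rw [← dotProduct_transpose_mul_self_mulVec]
  refine le_dotProduct_mulVec_of_le_eigenvalueDesc hA (fun j => ?_) c
  have h1 := (abs_entry_le_opNorm ((1 / (d : ℝ)) • leadingEigenvalues r ((L d)ᵀ * L d)
    - Matrix.diagonal p) j j).trans hd.le
  simp only [Matrix.sub_apply, Matrix.smul_apply, leadingEigenvalues, Matrix.diagonal_apply_eq,
    smul_eq_mul, one_div_mul_eq_div] at h1
  have h2 := (abs_le.1 h1).1
  have h3 : β ≤ eigenvalueDesc ((L d)ᵀ * L d) j / d := by linarith [hβp j]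
  rwa [le_div_iff₀ hd'] at h3

lemma loading_upper_bound (h : FactorModelAssumptions P F e L) :
    ∃ κ : ℝ, 0 < κ ∧ ∀ᶠ d : ℕ in atTop, ‖L d‖ ^ 2 ≤ κ * d := by
  obtain ⟨B, hB⟩ := h.loading_bounded
  refine ⟨r * B ^ 2 + 1, by positivity, ?_⟩
  filter_upwards [eventually_gt_atTop r] with d hd
  calc ‖L d‖ ^ 2 ≤ ∑ i, ∑ j, L d i j ^ 2 := opNorm_sq_le_sum _
    _ ≤ ∑ i : Fin d, ∑ j : Fin r, B ^ 2 := Finset.sum_le_sum fun i _ =>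
        Finset.sum_le_sum fun j _ => sq_le_sq' (abs_le.1 (hB d hd i j)).1 (abs_le.1 (hB d hd i j)).2
    _ = r * B ^ 2 * d := by simp; ring
    _ ≤ _ := by nlinarith [(Nat.cast_nonneg d : (0 : ℝ) ≤ d)]

omit [IsProbabilityMeasure P] in
-- The covariance at lag zero is one summand of the series of norms.
lemma error_cov_bound (h : FactorModelAssumptions P F e L) :
    ∃ C : ℝ, 0 ≤ C ∧ ∀ᶠ d : ℕ in atTop, ‖autocov P (e d) 0‖ ≤ C := by
  obtain ⟨C, hC, -⟩ := ENNReal.lt_iff_exists_nnreal_btwn.1 h.error_autocov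
  refine ⟨C, C.2, ?_⟩
  filter_upwards [eventually_lt_of_limsup_lt hC] with d hd
  have h1 := (ENNReal.le_tsum (f := fun h : ℤ => ENNReal.ofReal (specNorm (autocov P (e d) h)))
    0).trans hd.le
  rw [ENNReal.ofReal_le_iff_le_toReal ENNReal.coe_ne_top, ENNReal.coe_toReal] at h1
  exact h1

/-- A `d × d` covariance of norm at most `C` has squared Frobenius norm at most `d C²`, which yields
the term `d T²`; the fourth moments yield `d² T`. -/
lemma error_bound (h : FactorModelAssumptions P F e L) {η : ℝ} (hη : 0 < η) :
    ∃ κ : ℝ, 0 < κ ∧ ∀ᶠ p : ℕ × ℕ in atTop,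
      P {ω | κ * (p.1 ^ 2 * p.2 + p.1 * p.2 ^ 2) <
        frobSq (sample p.2 (e p.1) ω * (sample p.2 (e p.1) ω)ᵀ)} ≤ ENNReal.ofReal η := by
  obtain ⟨D, b, K, M, hlin⟩ := h.error_linear
  obtain ⟨C, hC, hcov⟩ := h.error_cov_bound
  set q : ℝ := 6 * (C ^ 2 + 1) + 3 * ((K + 2) ^ 4 * |M|) with hq
  have hqpos : 0 < q := by positivity
  refine ⟨q / η, by positivity, ?_⟩
  rw [← prod_atTop_atTop_eq]
  filter_upwards [((eventually_gt_atTop r).and hcov).prod_mk (eventually_gt_atTop 0)]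
    with ⟨d, T⟩ ⟨⟨hd, hcd⟩, hT⟩
  have hT' : (0 : ℝ) < T := by exact_mod_cast hT
  have hd' : (1 : ℝ) ≤ d := by exact_mod_cast (Nat.zero_lt_of_lt hd)
  obtain ⟨hsum, hK, hwn, h4, hma⟩ := hlin d hd
  refine measure_frobSq_mul_transpose_gt_le hma hwn (h.measurable_error d hd) h4 hsum hK T
    (by positivity) ?_
  have h1 : frobSq (autocov P (e d) 0) ≤ d * C ^ 2 := by
    have := sum_sq_le_card_mul_opNorm_sq (autocov P (e d) 0)
    rw [Fintype.card_fin] at this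
    exact this.trans (mul_le_mul_of_nonneg_left (pow_le_pow_left₀ (norm_nonneg _) hcd 2)
      (by positivity))
  have h2 : (K + 2) ^ 4 * ((d : ℝ) ^ 2 * M) ≤ d ^ 2 * ((K + 2) ^ 4 * |M|) := by
    have := mul_le_mul_of_nonneg_left (le_abs_self M)
      (show 0 ≤ (K + 2) ^ 4 * (d : ℝ) ^ 2 by positivity)
    linarith
  have h3 : q / η * ((d : ℝ) ^ 2 * T + d * T ^ 2) * η = q * (d ^ 2 * T + d * T ^ 2) := by
    field_simp
  have h4 : (T : ℝ) ^ 2 * (frobSq (autocov P (e d) 0) + 1) ≤ T ^ 2 * (d * (C ^ 2 + 1)) :=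
    mul_le_mul_of_nonneg_left (by linarith) (by positivity)
  have h5 := mul_le_mul_of_nonneg_left h2 hT'.le
  rw [h3]
  have h6 : 0 ≤ 6 * (C ^ 2 + 1) * ((d : ℝ) ^ 2 * T) := by positivity
  have h7 : 0 ≤ 3 * ((K + 2) ^ 4 * |M|) * ((d : ℝ) * T ^ 2) := by positivity
  calc _ ≤ 6 * ((T : ℝ) ^ 2 * (d * (C ^ 2 + 1))) + 3 * (T * (d ^ 2 * ((K + 2) ^ 4 * |M|))) :=
        add_le_add (mul_le_mul_of_nonneg_left h4 (by norm_num))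
          (mul_le_mul_of_nonneg_left h5 (by norm_num))
    _ ≤ _ := by rw [hq]; linarith

lemma loading_error_bound (h : FactorModelAssumptions P F e L) {η : ℝ} (hη : 0 < η) :
    ∃ κ : ℝ, 0 < κ ∧ ∀ᶠ p : ℕ × ℕ in atTop,
      P {ω | κ * (p.1 * p.2) < frobSq ((L p.1)ᵀ * (sample p.2 (e p.1) ω)ᵀ)} ≤
        ENNReal.ofReal η := by
  obtain ⟨D, b, K, M, hlin⟩ := h.error_linear
  obtain ⟨C, hC, hcov⟩ := h.error_cov_bound
  obtain ⟨B, hB, hL⟩ := h.loading_upper_bound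
  set q : ℝ := r * (B * C) + 1 with hq
  have hqpos : 0 < q := by positivity
  refine ⟨q / η, by positivity, ?_⟩
  rw [← prod_atTop_atTop_eq]
  filter_upwards [((eventually_gt_atTop r).and (hcov.and hL)).prod_mk (eventually_gt_atTop 0)]
    with ⟨d, T⟩ ⟨⟨hd, hcd, hLd⟩, hT⟩
  have hT' : (0 : ℝ) < T := by exact_mod_cast hT
  have hd' : (1 : ℝ) ≤ d := by exact_mod_cast (Nat.zero_lt_of_lt hd)
  obtain ⟨hsum, hK, hwn, h4, hma⟩ := hlin d hd
  refine measure_frobSq_loading_mul_gt_le hma hwn (h.measurable_error d hd) hsum (L d) T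
    (by positivity) ?_
  have h1 : ‖L d‖ ^ 2 * ‖autocov P (e d) 0‖ ≤ B * d * C :=
    mul_le_mul hLd hcd (norm_nonneg _) (by positivity)
  have h2 : q / η * ((d : ℝ) * T) * η = q * (d * T) := by field_simp
  rw [h2]
  calc (T : ℝ) * (r * (‖L d‖ ^ 2 * ‖autocov P (e d) 0‖) + 1) ≤ T * (r * (B * d * C) + d) := by
        gcongr
    _ = _ := by rw [hq]; ring

/-- The joint good event of a factor model. -/
lemma exists_good_event (h : FactorModelAssumptions P F e L) {η : ℝ} (hη : 0 < η) :
    ∃ α β κ : ℝ, 0 < α ∧ 0 < β ∧ 0 < κ ∧ ∀ᶠ p : ℕ × ℕ in atTop,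
      (∀ c, β * p.1 * (c ⬝ᵥ c) ≤ (L p.1 *ᵥ c) ⬝ᵥ (L p.1 *ᵥ c)) ∧ ‖L p.1‖ ^ 2 ≤ κ * p.1 ∧
      ∃ N : Set Ω, P N ≤ ENNReal.ofReal η ∧ ∀ ω ∉ N,
        (∀ c, α * p.2 * (c ⬝ᵥ c) ≤ (sample p.2 F ω *ᵥ c) ⬝ᵥ (sample p.2 F ω *ᵥ c)) ∧
        ‖sample p.2 F ω‖ ^ 2 ≤ κ * p.2 ∧
        ‖sample p.2 (e p.1) ω‖ ^ 2 ≤ κ * (p.1 * p.2 / delta p.1 p.2) ∧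
        ‖(L p.1)ᵀ * (sample p.2 (e p.1) ω)ᵀ‖ ^ 2 ≤ κ * (p.1 * p.2) := by
  have hη3 : 0 < η / 3 := by positivity
  obtain ⟨α, κ1, hα, hκ1, hF⟩ := h.factor_bounds hη3
  obtain ⟨β, hβ, hL⟩ := h.loading_lower_bound
  obtain ⟨κ2, hκ2, hLu⟩ := h.loading_upper_bound
  obtain ⟨κ3, hκ3, hE⟩ := h.error_bound hη3
  obtain ⟨κ4, hκ4, hLE⟩ := h.loading_error_bound hη3
  -- The root arises because the bound concerns `‖E‖⁴`: as `δ² ≤ d` and `δ² ≤ T`, one has `d²T + dT²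
  -- ≤ 2 (dT/δ)²`.
  refine ⟨α, β, κ1 + κ2 + √(2 * κ3) + κ4, hα, hβ, by positivity, ?_⟩
  rw [← prod_atTop_atTop_eq] at hE hLE ⊢
  filter_upwards [hE, hLE, (hL.and (hLu.and (eventually_gt_atTop 0))).prod_mk
    (hF.and (eventually_gt_atTop 0))] with ⟨d, T⟩ hE hLE ⟨⟨hL, hLu, hd⟩, hF, hT⟩
  have hT' : (0 : ℝ) < T := by exact_mod_cast hT
  have hd' : (0 : ℝ) < d := by exact_mod_cast hd
  have hs : 0 ≤ √(2 * κ3) := Real.sqrt_nonneg _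
  have hunion : ∀ N1 N2 N3 : Set Ω, P N1 ≤ ENNReal.ofReal (η / 3) →
      P N2 ≤ ENNReal.ofReal (η / 3) → P N3 ≤ ENNReal.ofReal (η / 3) →
      P (N1 ∪ (N2 ∪ N3)) ≤ ENNReal.ofReal η := by
    intro N1 N2 N3 h1 h2 h3
    refine (measure_union_le _ _).trans ((add_le_add h1 ((measure_union_le _ _).trans
      (add_le_add h2 h3))).trans ?_)
    rw [← ENNReal.ofReal_add hη3.le hη3.le, ← ENNReal.ofReal_add hη3.le (by positivity)]
    exact ENNReal.ofReal_le_ofReal (by linarith)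
  refine ⟨hL, hLu.trans (mul_le_mul_of_nonneg_right (by linarith) hd'.le), _,
    hunion _ _ _ hF hE hLE, fun ω hω => ?_⟩
  · simp only [Set.mem_union, Set.mem_ofPred_eq, not_or, not_not, not_lt] at hω
    obtain ⟨⟨h1, h2⟩, h3, h4⟩ := hω
    have hδ : 0 < delta d T := lt_min (Real.sqrt_pos.2 hd') (Real.sqrt_pos.2 hT')
    refine ⟨h1, h2.trans (mul_le_mul_of_nonneg_right (by linarith) hT'.le), ?_, ?_⟩
    · have h5 := (opNorm_sq_le_sum (sample T (e d) ω * (sample T (e d) ω)ᵀ)).trans h3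
      rw [opNorm_mul_transpose_self] at h5
      have hδd : delta d T ^ 2 ≤ d := by
        calc delta d T ^ 2 ≤ √(d : ℝ) ^ 2 := pow_le_pow_left₀ hδ.le (min_le_left _ _) 2
          _ = d := Real.sq_sqrt hd'.le
      have hδT : delta d T ^ 2 ≤ T := by
        calc delta d T ^ 2 ≤ √(T : ℝ) ^ 2 := pow_le_pow_left₀ hδ.le (min_le_right _ _) 2
          _ = T := Real.sq_sqrt hT'.le
      have h6 : κ3 * ((d : ℝ) ^ 2 * T + d * T ^ 2) ≤
          (√(2 * κ3) * (d * T / delta d T)) ^ 2 := by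
        rw [mul_pow, Real.sq_sqrt (by positivity), div_pow, mul_assoc 2, mul_left_comm]
        refine mul_le_mul_of_nonneg_left ?_ hκ3.le
        rw [mul_div_assoc', le_div_iff₀ (by positivity)]
        have e1 := mul_le_mul_of_nonneg_left hδT (show 0 ≤ (d : ℝ) ^ 2 * T by positivity)
        have e2 := mul_le_mul_of_nonneg_left hδd (show 0 ≤ (d : ℝ) * T ^ 2 by positivity)
        nlinarith
      have h7 := (abs_le_of_sq_le_sq' (h5.trans h6) (by positivity)).2
      exact h7.trans (mul_le_mul_of_nonneg_right (by linarith) (by positivity))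
    · exact (opNorm_sq_le_sum _).trans (h4.trans
        (mul_le_mul_of_nonneg_right (by linarith) (by positivity)))

end FactorModelAssumptions

end ModelBounds

/-! ### Insertion of the rates -/

lemma tendsto_delta : Tendsto (fun p : ℕ × ℕ => delta p.1 p.2) atTop atTop := by
  have h : Tendsto (fun n : ℕ => √(n : ℝ)) atTop atTop :=
    Real.tendsto_sqrt_atTop.comp tendsto_natCast_atTop_atTop
  refine tendsto_atTop.2 fun c => ?_
  rw [← prod_atTop_atTop_eq]
  filter_upwards [(h.eventually_ge_atTop c).prod_mk (h.eventually_ge_atTop c)] with p hp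
  exact le_min hp.1 hp.2

/-- The deterministic error bound with the rates of the good event inserted. -/
lemma frobSq_sub_rotatedFactors_le_of_rates {T d r : ℕ} (hT : 0 < T) (hd : 0 < d)
    {F1 F2 Fhat1 Fhat2 Fhat : Matrix (Fin T) (Fin r) ℝ} {L1 L2 : Matrix (Fin d) (Fin r) ℝ}
    {E1 E2 X1 X2 : Matrix (Fin T) (Fin d) ℝ} {α β κ : ℝ} (hα : 0 < α) (hβ : 0 < β) (hκ : 0 < κ)
    (hnull : NullHypothesis L1 L2)
    (hF1 : ∀ c, α * T * (c ⬝ᵥ c) ≤ (F1 *ᵥ c) ⬝ᵥ (F1 *ᵥ c))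
    (hF2 : ∀ c, α * T * (c ⬝ᵥ c) ≤ (F2 *ᵥ c) ⬝ᵥ (F2 *ᵥ c))
    (hL1 : ∀ c, β * d * (c ⬝ᵥ c) ≤ (L1 *ᵥ c) ⬝ᵥ (L1 *ᵥ c))
    (hL2 : ∀ c, β * d * (c ⬝ᵥ c) ≤ (L2 *ᵥ c) ⬝ᵥ (L2 *ᵥ c))
    (hX1 : X1 = F1 * L1ᵀ + E1) (hX2 : X2 = F2 * L2ᵀ + E2)
    (hFn : ‖F2‖ ^ 2 ≤ κ * T) (hLn : ‖L2‖ ^ 2 ≤ κ * d)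
    (hE1 : ‖E1‖ ^ 2 ≤ κ * (d * T / delta d T)) (hE2 : ‖E2‖ ^ 2 ≤ κ * (d * T / delta d T))
    (hLE : ‖L2ᵀ * E2ᵀ‖ ^ 2 ≤ κ * (d * T)) {κ' : ℝ} (hκ' : 0 < κ') (h1 : 4 * κ ≤ α * κ')
    (h2 : 4 * κ ^ 2 ≤ α * β * κ') (h3 : 4 * κ / (α * β) < delta d T)
    (h4 : 4 * κ * (√κ' + 3) ^ 2 / (α * β) ≤ delta d T)
    (hFhat1 : IsPCAFactor X1 Fhat1) (hFhat2 : IsPCAFactor X2 Fhat2)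
    (hFhat : IsPCAFactor (transformed (halfProj X1 Fhat1) (halfProj X2 Fhat2) X2) Fhat) :
    (1 / (T : ℝ)) * frobSq (Fhat - rotatedFactors (halfProj X1 Fhat1) (halfProj X2 Fhat2) L2 F2
      Fhat (Vhat r (transformed (halfProj X1 Fhat1) (halfProj X2 Fhat2) X2))) ≤
      r * (4 * κ * (10 * √κ' + 17) / (α * β)) ^ 2 * (1 / delta d T ^ 2) := by
  have hT' : (0 : ℝ) < T := by exact_mod_cast hT
  have hd' : (0 : ℝ) < d := by exact_mod_cast hd
  have hδ : 0 < delta d T := lt_min (Real.sqrt_pos.2 hd') (Real.sqrt_pos.2 hT')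
  have hδd : delta d T ≤ √(d : ℝ) := min_le_left _ _
  set δ := delta d T with hδdef
  have hsq : ∀ {x y : ℝ}, x ^ 2 ≤ y → x ≤ √y := fun h => Real.le_sqrt_of_sq_le h
  have he2 : √(κ * (d * T / δ)) ^ 2 = κ * (d * T / δ) := Real.sq_sqrt (by positivity)
  have hρ2 : √(κ' * (d / δ)) ^ 2 = κ' * (d / δ) := Real.sq_sqrt (by positivity)
  have hℓ2 : √(κ * d) ^ 2 = κ * d := Real.sq_sqrt (by positivity)
  have hfρ : √(κ * T) * √(κ' * (d / δ)) = √κ' * √(κ * (d * T / δ)) := by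
    rw [← Real.sqrt_mul (by positivity), ← Real.sqrt_mul (by positivity)]
    congr 1
    field_simp
  -- The size of `ρ²` is that of `e²` divided by the strength `T` of the factors. The first two side
  -- conditions fix `κ'`; the last two state that the signal dominates, which holds for large `δ`.
  have hmain := frobSq_sub_rotatedFactors_le hT hd (a := α * T) (b := β * d) (f := √(κ * T))
    (g := √(κ * (d * T))) (e := √(κ * (d * T / δ))) (ℓ := √(κ * d)) (ρ := √(κ' * (d / δ)))
    (by positivity) (by positivity) hnull hF1 hF2 hL1 hL2 hX1 hX2 (hsq hFn) (hsq hLn) (hsq hE1)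
    (hsq hE2) (hsq hLE) (Real.sqrt_nonneg _)
    (by
      rw [he2, hρ2]
      calc 4 * (κ * (d * T / δ)) = 4 * κ * (d * T / δ) := by ring
        _ ≤ α * κ' * (d * T / δ) := by gcongr
        _ = _ := by ring)
    (by
      rw [he2, hρ2, hℓ2]
      calc κ * d * (4 * (κ * (d * T / δ))) = 4 * κ ^ 2 * (d * d * T / δ) := by ring
        _ ≤ α * β * κ' * (d * d * T / δ) := by gcongr
        _ = _ := by ring)
    (by
      rw [he2]
      rw [div_lt_iff₀ (by positivity)] at h3
      rw [← mul_assoc, mul_div_assoc', div_lt_iff₀ hδ]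
      calc 4 * κ * (d * T) < δ * (α * β) * (d * T) := by gcongr
        _ = _ := by ring)
    (by
      rw [hfρ, ← add_mul, mul_pow, he2]
      rw [div_le_iff₀ (by positivity)] at h4
      calc 4 * ((√κ' + 3) ^ 2 * (κ * (d * T / δ))) = 4 * κ * (√κ' + 3) ^ 2 * (d * T) / δ := by ring
        _ ≤ δ * (α * β) * (d * T) / δ := by gcongr
        _ = _ := by field_simp)
    hFhat1 hFhat2 hFhat
  refine hmain.trans ?_
  -- The term with `L'E'` has order `T √d`, and `δ ≤ √d` turns this into `dT/δ`.
  have hfg : √(κ * T) * √(κ * (d * T)) ≤ κ * (d * T / δ) := by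
    rw [← Real.sqrt_mul (by positivity), show κ * (T : ℝ) * (κ * (d * T)) = (κ * T) ^ 2 * d by ring,
      Real.sqrt_mul (by positivity), Real.sqrt_sq (by positivity), mul_div_assoc', le_div_iff₀ hδ]
    calc κ * T * √d * δ ≤ κ * T * √d * √d := by gcongr
      _ = κ * T * d := by rw [mul_assoc, Real.mul_self_sqrt hd'.le]
      _ = _ := by ring
  have hfρe : √(κ * T) * (√(κ' * (d / δ)) * √(κ * (d * T / δ))) = √κ' * (κ * (d * T / δ)) := by
    rw [← mul_assoc, hfρ, mul_assoc, ← sq, he2]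
  have hw : 8 * √(κ * T) * (√(κ * (d * T)) + 5 / 4 * (√(κ' * (d / δ)) * √(κ * (d * T / δ))))
      + 9 * √(κ * (d * T / δ)) ^ 2 ≤ κ * (10 * √κ' + 17) * (d * T / δ) := by
    rw [he2]
    calc _ = 8 * (√(κ * T) * √(κ * (d * T)))
          + 10 * (√(κ * T) * (√(κ' * (d / δ)) * √(κ * (d * T / δ)))) + 9 * (κ * (d * T / δ)) := by
          ring
      _ ≤ 8 * (κ * (d * T / δ)) + 10 * (√κ' * (κ * (d * T / δ))) + 9 * (κ * (d * T / δ)) := by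
          rw [hfρe]
          gcongr
      _ = _ := by ring
  have hfrac : 4 * (8 * √(κ * T) * (√(κ * (d * T)) +
      5 / 4 * (√(κ' * (d / δ)) * √(κ * (d * T / δ)))) + 9 * √(κ * (d * T / δ)) ^ 2) /
      (α * T * (β * d)) ≤ 4 * κ * (10 * √κ' + 17) / (α * β) * (1 / δ) := by
    rw [div_le_iff₀ (by positivity)]
    calc _ ≤ 4 * (κ * (10 * √κ' + 17) * (d * T / δ)) := mul_le_mul_of_nonneg_left hw (by norm_num)
      _ = _ := by field_simp
  calc _ ≤ (r : ℝ) * (4 * κ * (10 * √κ' + 17) / (α * β) * (1 / δ)) ^ 2 := by gcongr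
    _ = _ := by rw [mul_pow, div_pow 1, one_pow]; ring

end FactorTest

/-! ### Union bound over the two models -/

theorem mainTheorem5 {Ω : Type*} [MeasurableSpace Ω] (P : Measure Ω) [IsProbabilityMeasure P]
    (r : ℕ) (F1 F2 : ℤ → Ω → Fin r → ℝ) (e1 e2 : (d : ℕ) → ℤ → Ω → Fin d → ℝ)
    (L1 L2 : (d : ℕ) → Matrix (Fin d) (Fin r) ℝ)
    (h1 : FactorTest.FactorModelAssumptions P F1 e1 L1)
    (h2 : FactorTest.FactorModelAssumptions P F2 e2 L2)
    (hnull : ∀ d, r < d → FactorTest.NullHypothesis (L1 d) (L2 d))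
    (X1 X2 : (d T : ℕ) → Ω → Matrix (Fin T) (Fin d) ℝ)
    (hX1 : ∀ d T ω, X1 d T ω = FactorTest.sample T (FactorTest.observed (L1 d) F1 (e1 d)) ω)
    (hX2 : ∀ d T ω, X2 d T ω = FactorTest.sample T (FactorTest.observed (L2 d) F2 (e2 d)) ω)
    (Fhat1 Fhat2 : (d T : ℕ) → Ω → Matrix (Fin T) (Fin r) ℝ)
    (hFhat1 : ∀ d T, r < d → r ≤ T → ∀ ω, FactorTest.IsPCAFactor (X1 d T ω) (Fhat1 d T ω))
    (hFhat2 : ∀ d T, r < d → r ≤ T → ∀ ω, FactorTest.IsPCAFactor (X2 d T ω) (Fhat2 d T ω))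
    (P1 P2 : (d T : ℕ) → Ω → Matrix (Fin d) (Fin d) ℝ)
    (hP1 : ∀ d T ω, P1 d T ω = FactorTest.halfProj (X1 d T ω) (Fhat1 d T ω))
    (hP2 : ∀ d T ω, P2 d T ω = FactorTest.halfProj (X2 d T ω) (Fhat2 d T ω))
    (Y : (d T : ℕ) → Ω → Matrix (Fin T) (Fin d) ℝ)
    (hY : ∀ d T ω, Y d T ω = FactorTest.transformed (P1 d T ω) (P2 d T ω) (X2 d T ω))
    (Fhat : (d T : ℕ) → Ω → Matrix (Fin T) (Fin r) ℝ)
    (hFhat : ∀ d T, r < d → r ≤ T → ∀ ω, FactorTest.IsPCAFactor (Y d T ω) (Fhat d T ω)) :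
    FactorTest.IsBigOInProbability P
      (fun d T ω => (1 / (T : ℝ)) * FactorTest.frobSq (Fhat d T ω -
        FactorTest.rotatedFactors (P1 d T ω) (P2 d T ω) (L2 d) (FactorTest.sample T F2 ω)
          (Fhat d T ω) (FactorTest.Vhat r (Y d T ω))))
      (fun d T => 1 / FactorTest.delta d T ^ 2) := by
  intro η hη
  have hη2 : 0 < η / 2 := by positivity
  obtain ⟨α1, β1, κ1, hα1, hβ1, hκ1, hgood1⟩ := h1.exists_good_event hη2
  obtain ⟨α2, β2, κ2, hα2, hβ2, hκ2, hgood2⟩ := h2.exists_good_event hη2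
  set α := min α1 α2 with hα
  set β := min β1 β2 with hβ
  set κ := max κ1 κ2 with hκ
  have hα0 : 0 < α := lt_min hα1 hα2
  have hβ0 : 0 < β := lt_min hβ1 hβ2
  have hκ0 : 0 < κ := lt_max_of_lt_left hκ1
  -- The first summand serves the residual of the second fit, the other that of the first fit after
  -- its transfer from `L1` to `L2`.
  set κ' := 4 * κ / α + 4 * κ ^ 2 / (α * β) with hκ'
  have hκ'0 : 0 < κ' := by positivity
  have e1 : 4 * κ ≤ α * κ' := by
    have : α * κ' = 4 * κ + 4 * κ ^ 2 / β := by rw [hκ']; field_simp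
    rw [this]
    exact le_add_of_nonneg_right (by positivity)
  have e2 : 4 * κ ^ 2 ≤ α * β * κ' := by
    have : α * β * κ' = 4 * κ * β + 4 * κ ^ 2 := by rw [hκ']; field_simp
    rw [this]
    exact le_add_of_nonneg_left (by positivity)
  refine ⟨r * (4 * κ * (10 * √κ' + 17) / (α * β)) ^ 2, ?_⟩
  have hlarge : ∀ᶠ p : ℕ × ℕ in atTop, (r < p.1 ∧ 0 < p.1) ∧ r ≤ p.2 ∧ 0 < p.2 := by
    rw [← prod_atTop_atTop_eq]
    exact ((eventually_gt_atTop r).and (eventually_gt_atTop 0)).prod_mk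
      ((eventually_ge_atTop r).and (eventually_gt_atTop 0))
  filter_upwards [hgood1, hgood2, hlarge,
    FactorTest.tendsto_delta.eventually_gt_atTop (4 * κ / (α * β)),
    FactorTest.tendsto_delta.eventually_ge_atTop (4 * κ * (√κ' + 3) ^ 2 / (α * β))]
  rintro ⟨d, T⟩ ⟨hL1, -, N1, hN1, hω1⟩ ⟨hL2, hL2n, N2, hN2, hω2⟩ ⟨⟨hrd, hd⟩, hrT, hT⟩ hδ1 hδ2
  have hdT : 0 ≤ (d : ℝ) * T / FactorTest.delta d T :=
    div_nonneg (by positivity) (le_min (Real.sqrt_nonneg _) (Real.sqrt_nonneg _))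
  have mono : ∀ {a b : ℝ}, a ≤ b → ∀ {x y z : ℝ}, 0 ≤ x → 0 ≤ y → b * x * y ≤ z → a * x * y ≤ z :=
    fun hab _ _ _ hx hy h => le_trans
      (mul_le_mul_of_nonneg_right (mul_le_mul_of_nonneg_right hab hx) hy) h
  have mono' : ∀ {a b : ℝ}, a ≤ b → ∀ {x z : ℝ}, 0 ≤ x → z ≤ a * x → z ≤ b * x :=
    fun hab _ _ hx h => h.trans (mul_le_mul_of_nonneg_right hab hx)
  have dot : ∀ c : Fin r → ℝ, 0 ≤ dotProduct c c := fun c =>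
    Finset.sum_nonneg fun i _ => mul_self_nonneg _
  -- Monotonicity of the outer measure suffices: with arbitrary choices of eigenvectors the event
  -- need not be measurable.
  calc P _ ≤ P (N1 ∪ N2) := measure_mono fun ω hω => by
        by_contra hN
        rw [Set.mem_union, not_or] at hN
        obtain ⟨hF1, -, hE1, -⟩ := hω1 ω hN.1
        obtain ⟨hF2, hF2n, hE2, hLE⟩ := hω2 ω hN.2
        rw [Set.mem_ofPred_eq] at hω
        refine absurd hω (not_lt.2 ?_)
        rw [abs_of_nonneg (mul_nonneg (by positivity)
          (Finset.sum_nonneg fun i _ => Finset.sum_nonneg fun j _ => sq_nonneg _))]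
        have hpca := hFhat d T hrd hrT ω
        have hpca1 := hFhat1 d T hrd hrT ω
        have hpca2 := hFhat2 d T hrd hrT ω
        rw [hY, hP1, hP2] at hpca
        rw [hY, hP1, hP2]
        exact FactorTest.frobSq_sub_rotatedFactors_le_of_rates hT hd hα0 hβ0 hκ0 (hnull d hrd)
          (fun c => mono (min_le_left _ _) (Nat.cast_nonneg _) (dot c) (hF1 c))
          (fun c => mono (min_le_right _ _) (Nat.cast_nonneg _) (dot c) (hF2 c))
          (fun c => mono (min_le_left _ _) (Nat.cast_nonneg _) (dot c) (hL1 c))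
          (fun c => mono (min_le_right _ _) (Nat.cast_nonneg _) (dot c) (hL2 c))
          ((hX1 d T ω).trans (FactorTest.sample_observed _ _ _ _ _))
          ((hX2 d T ω).trans (FactorTest.sample_observed _ _ _ _ _))
          (mono' (le_max_right _ _) (Nat.cast_nonneg _) hF2n)
          (mono' (le_max_right _ _) (Nat.cast_nonneg _) hL2n)
          (mono' (le_max_left _ _) hdT hE1) (mono' (le_max_right _ _) hdT hE2)
          (mono' (le_max_right _ _) (by positivity) hLE) hκ'0 e1 e2 hδ1 hδ2 hpca1 hpca2 hpca
    _ ≤ ENNReal.ofReal (η / 2) + ENNReal.ofReal (η / 2) :=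
        (measure_union_le _ _).trans (add_le_add hN1 hN2)
    _ = ENNReal.ofReal η := by rw [← ENNReal.ofReal_add hη2.le hη2.le, add_halves]
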